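/- Let $G$ be a (Hausdorff, second countable) real Lie group of dimension $d\ge 1$ with Lie algebra $\mathfrak g$, let $\Gamma<G$ be a lattice, $X=G/\Gamma$, and let $\mu$ be the $G$-invariant (Haar) probability measure on $X$. Fix a right-invariant smooth Riemannian metric on $G$ and let $\mathbf d$ be the induced Riemannian distance on $X$ (the least distance in $G$ between representatives). Let $(a_t)_{t\in\mathbb R}$ be a one-parameter subgroup of $G$ such that $\mathrm{Ad}(a_t)$ is diagonalizable: there are a basis $\zeta_1,\dots,\zeta_d$ of $\mathfrak g$ and $\gamma_1,\dots,\gamma_d\in\mathbb R$ with $\mathrm{Ad}(a_t)\zeta_i=e^{\gamma_i t}\zeta_i$ for all $t$. Put $\gamma=\max_i\gamma_i$. For $f:X\to\mathbb R$ put $D_\zeta f(x)=\frac{d}{dt}f(\exp(t\zeta)x)|_{t=0}$. Let $W^{(2,k)}(X)$ be the set of $f$ for which all $D_{\zeta_{n_1}}\cdots D_{\zeta_{n_q}}f$ with $0\le q\le k$ exist and lie in $L^2(X,\mu)$, and let $$S_k(f)^2=\sum_{q=0}^{k}\ \sum_{n_1,\dots,n_q=1}^{d}\|D_{\zeta_{n_1}}\cdots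 D_{\zeta_{n_q}}f\|_2^2 .$$ Assume that $a_t$ has exponential decay of correlations: for some $k\in\mathbb N$, $\delta>0$ and $c>0$, all $f,g\in W^{(2,k)}(X)$ and all $t\ge 0$ satisfy $$\Big|\int_X f(x)\,g(a_tx)\,d\mu(x)-\int_X f\,d\mu\int_X g\,d\mu\Big|\le c\,e^{-\delta t}S_k(f)S_k(g).$$ Let $(m_j)_{j\ge 0}$ be positive real numbers with $$\rho^{-1}:=\sup_{s\ge 1}\frac{m_{s-1}}{m_s}<\min\Big(1,\frac{\delta}{k\gamma}\Big).$$ Let $\alpha_n<\beta_n$ be natural numbers with $\alpha_n\to\infty$ and $\beta_n-\alpha_n\to\infty$, and put $N_n=\beta_n-\alpha_n+1$. Let $l\ge 1$ be an integer and assume that $$N_n=o\big(e^{\sigma\rho^{\alpha_n}}\big),\qquad \sigma=\frac{-m_0}{k\left(\frac32+\frac2d\right)+\frac12(l-1)}\Big(\frac{k\gamma}{\rho}-\delta\Big).$$ Then there is a constant $w>0$ such that for every $x_0\in X$ $$\mu\big(\{x:-\log\mathbf d(x,x_0)>z\}\big)=we^{-dz}+o(e^{-dz})\qquad(z\to\infty),$$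 and, denoting by $M^{(l)}_{I_n}(x)$ the $l$-th largest (counted with multiplicity) of the values $-\log\mathbf d(a_{m_j}x,x_0)$, $\alpha_n\le j\le\beta_n$, for every $r\in\mathbb R$, with $u_n(r)=r+\frac1d\log N_n$, $$\lim_{n\to\infty}\mu\big(M^{(l)}_{I_n}\le u_n(r)\big)=e^{-we^{-dr}}\sum_{i=0}^{l-1}\frac{(we^{-dr})^i}{i!}.$$ -/

import Mathlib

open Filter Topology Set MeasureTheory Bundle
open scoped Manifold ContDiff ENNReal Asymptotics

noncomputable section

section LieGroups

variable {d : ℕ} {G : Type*} [TopologicalSpace G] [ChartedSpace (EuclideanSpace ℝ (Fin d)) G]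
  [Group G]

/-- The exponential map of a Lie group: `exp ζ` is the value at time `1` of the integral curve,
starting at the identity, of the left-invariant vector field with value `ζ` at the identity. (On a
Lie group this curve exists and is unique, and it is the one-parameter subgroup `t ↦ exp (t ζ)`.) -/
def lieExp (ζ : GroupLieAlgebra (𝓡 d) G) : G :=
  open Classical in
  if h : ∃ e : ℝ → G, e 0 = 1 ∧
      IsMIntegralCurve (I := 𝓡 d) e (mulInvariantVectorField (I := 𝓡 d) ζ)
  then h.choose 1 else 1

/-- The adjoint action of `g` on the Lie algebra: the derivative at `1` of `x ↦ g x g⁻¹`. -/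
def lieAd (g : G) : GroupLieAlgebra (𝓡 d) G →L[ℝ] GroupLieAlgebra (𝓡 d) G :=
  mfderiv (𝓡 d) (𝓡 d) (fun x : G => g * x * g⁻¹) 1

/-- A one-parameter subgroup `t ↦ a_t`. -/
structure IsOneParameterSubgroup (a : ℝ → G) : Prop where
  continuous : Continuous a
  map_add : ∀ s t : ℝ, a (s + t) = a s * a t

/-- Smooth Riemannian metrics on `G`. -/
abbrev LieRiemannianMetric (d : ℕ) (G : Type*) [TopologicalSpace G]
    [ChartedSpace (EuclideanSpace ℝ (Fin d)) G] [IsManifold (𝓡 d) ∞ G] :=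
  ContMDiffRiemannianMetric (𝓡 d) ∞ (EuclideanSpace ℝ (Fin d))
    (fun x : G => TangentSpace (𝓡 d) x)

/-- All right translations `x ↦ x h` preserve the metric. -/
def LieRiemannianMetric.IsRightInvariant [IsManifold (𝓡 d) ∞ G]
    (B : LieRiemannianMetric d G) : Prop :=
  ∀ (h x : G) (v w : TangentSpace (𝓡 d) x),
    B.inner (x * h) (mfderiv (𝓡 d) (𝓡 d) (fun y : G => y * h) x v)
      (mfderiv (𝓡 d) (𝓡 d) (fun y : G => y * h) x w) = B.inner x v w

/-- The Riemannian distance on `G` (infimum of the lengths of `C¹` paths; it is `∞` between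
different components). -/
def LieRiemannianMetric.distG [IsManifold (𝓡 d) ∞ G]
    (B : LieRiemannianMetric d G) (g h : G) : ℝ≥0∞ :=
  letI : RiemannianBundle (fun x : G => TangentSpace (𝓡 d) x) := ⟨B.toRiemannianMetric⟩
  Manifold.riemannianEDist (𝓡 d) g h

/-- The Riemannian distance on `X = G ⧸ Γ` for the metric induced by a right-invariant metric on
`G`: the least distance between representatives (paths in `X` lift to paths of the same length). -/
def LieRiemannianMetric.dist [IsManifold (𝓡 d) ∞ G]
    (B : LieRiemannianMetric d G) (Γ : Subgroup G) (x y : G ⧸ Γ) : ℝ≥0∞ :=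
  ⨅ (g : G) (h : G) (_ : (g : G ⧸ Γ) = x) (_ : (h : G ⧸ Γ) = y), B.distG g h

/-- The observable `x ↦ - log dist (x, x₀)`, with values in `[-∞, ∞]` (it is `∞` exactly at
`x₀`). -/
def LieRiemannianMetric.closeness [IsManifold (𝓡 d) ∞ G]
    (B : LieRiemannianMetric d G) (Γ : Subgroup G) (x₀ x : G ⧸ Γ) : EReal :=
  -ENNReal.log (B.dist Γ x x₀)

variable {Γ : Subgroup G}

/-- `t ↦ f (exp (t ζ) x)` is differentiable at `0` for every `x`. -/
def HasLieDeriv (ζ : GroupLieAlgebra (𝓡 d) G) (f : G ⧸ Γ → ℝ) : Prop :=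
  ∀ x : G ⧸ Γ, DifferentiableAt ℝ (fun t : ℝ => f (lieExp (t • ζ) • x)) 0

/-- `D_ζ f (x) = d/dt f (exp (t ζ) x)` at `t = 0`. -/
def lieDeriv (ζ : GroupLieAlgebra (𝓡 d) G) (f : G ⧸ Γ → ℝ) (x : G ⧸ Γ) : ℝ :=
  deriv (fun t : ℝ => f (lieExp (t • ζ) • x)) 0

/-- `D_{ζ n₁} (D_{ζ n₂} (⋯ (D_{ζ n_q} f)))` for the word `[n₁, …, n_q]`. -/
def iterLieDeriv (ζ : Fin d → GroupLieAlgebra (𝓡 d) G) (f : G ⧸ Γ → ℝ) :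
    List (Fin d) → (G ⧸ Γ → ℝ)
  | [] => f
  | n :: w => lieDeriv (ζ n) (iterLieDeriv ζ f w)

variable [MeasurableSpace (G ⧸ Γ)]

/-- The Sobolev space `W^{(2,k)}(X)`: all derivatives of order at most `k` along the vectors `ζ n`
exist and are square integrable. -/
structure IsSobolev (ζ : Fin d → GroupLieAlgebra (𝓡 d) G) (μ : Measure (G ⧸ Γ)) (k : ℕ)
    (f : G ⧸ Γ → ℝ) : Prop where
  hasLieDeriv : ∀ (n : Fin d) (w : List (Fin d)), w.length < k →
    HasLieDeriv (ζ n) (iterLieDeriv ζ f w)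
  memLp : ∀ w : List (Fin d), w.length ≤ k → MemLp (iterLieDeriv ζ f w) 2 μ

/-- The Sobolev norm `S_k`: the square root of the sum of the squared `L²` norms of all
derivatives `D_{ζ n₁} ⋯ D_{ζ n_q} f` of order `0 ≤ q ≤ k`. -/
def sobolevNorm (ζ : Fin d → GroupLieAlgebra (𝓡 d) G) (μ : Measure (G ⧸ Γ)) (k : ℕ)
    (f : G ⧸ Γ → ℝ) : ℝ :=
  √(∑ q ∈ Finset.range (k + 1), ∑ w : Fin q → Fin d,
      ∫ x, (iterLieDeriv ζ f (List.ofFn w) x) ^ 2 ∂μ)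

/-- `a_t` has exponential decay of correlations, with rate `δ`, against `W^{(2,k)}` Sobolev
observables. -/
def HasExpDecayOfCorrelations (a : ℝ → G) (ζ : Fin d → GroupLieAlgebra (𝓡 d) G)
    (μ : Measure (G ⧸ Γ)) (k : ℕ) (δ : ℝ) : Prop :=
  ∃ c : ℝ, 0 < c ∧ ∀ f g : G ⧸ Γ → ℝ, IsSobolev ζ μ k f → IsSobolev ζ μ k g →
    ∀ t : ℝ, 0 ≤ t →
      |(∫ x, f x * g (a t • x) ∂μ) - (∫ x, f x ∂μ) * (∫ x, g x ∂μ)|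
        ≤ c * Real.exp (-δ * t) * sobolevNorm ζ μ k f * sobolevNorm ζ μ k g

end LieGroups

/-- The `l`-th largest (`l ≥ 1`) of the values `ξ j`, `j ∈ s`, counted with multiplicity: the
greatest `v` such that at least `l` of the `ξ j` are `≥ v` (and `-∞` if `s` has fewer than `l`
elements). -/
def lthLargest {ι : Type*} (s : Finset ι) (ξ : ι → EReal) (l : ℕ) : EReal :=
  sSup {v : EReal | l ≤ (s.filter fun j => v ≤ ξ j).card}

end

/-! The `l`-th largest closeness is at most `u_n(r)` exactly when fewer than `l` of the points
`a_{m_j} x` lie in the ball `S` of radius `e^{-r} N_n^{-1/d}` about `x₀`. So it suffices that the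
number `Z_n` of visits converges in law to a Poisson variable of mean `w e^{-dr}`. This is read off,
for every `l` at once, from the generating functions `∫ q ^ Z_n = ∫ ∏ (1 - (1 - q) 1_S(a_{m_j} x))`
with `0 < q < 1` (`tendsto_prob_lt_of_tendsto_pgf`).

Were the visits independent, this integral would be `(1 - (1 - q) μ(S)) ^ N_n`, which has the right
limit because `N_n μ(S)` tends to `w e^{-dr}`. Independence up to a negligible error is
`abs_integral_prod_sub_le`. With a smooth bump of scale `R` in place of `1_S`, split off the factor
at the latest time `m_i` and apply mixing to it and the product of the `i` earlier factors.
Derivative rates add under products and the flow expands them by at most `e^{γ t}`, so that product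
has Sobolev norm of order at most `(i e^{γ m_{i-1}} / R) ^ k`. Since `m_{i-1} ≤ m_i / ρ`, the decay
`e^{-δ m_i}` wins and leaves `i ^ k e^{-c₁ m_i} R^{-2k}` with `c₁ = δ - kγ/ρ > 0`. The times grow at
least like `m_0 ρ ^ j`, so the sum of these errors over a window, `R^{-2k}` aside, is much smaller
than `e^{-c₁ m_0 ρ^α}`. The factor `R^{-2k}` is of order `N^{2k/d}`, which the growth hypothesis
keeps below `e^{c₁ m_0 ρ^α}`. Bumps from inside and outside then give the indicator
(`tendsto_integral_prod_indicator`).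

That balls have measure asymptotic to `w R ^ d`, with one `w` for all centres, is
`exists_tendsto_measureReal_ball`. The pullback of `μ` to a chart has a density almost everywhere.
Moving from a good point `x₁` to `g x₁` multiplies the density by `|det Ad g⁻¹|`, a character of
`G`; invariance of a probability measure forces this character to be `1`. Riemannian balls are
Euclidean to first order in a suitable chart. -/

/-! ### Poisson limits from generating functions. -/

section Poisson

/-- Splitting off the values `< l` of a generating function, the remainder is `q ^ l` times a
quantity between `P (Z = l)` and `P (Z = l) + q`. -/
lemma pgf_split {Ω : Type*} [MeasurableSpace Ω] (μ : Measure Ω) [IsProbabilityMeasure μ]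
    {Z : Ω → ℕ} (hZ : Measurable Z) {q : ℝ} (hq0 : 0 < q) (hq1 : q < 1) (l : ℕ) :
    q ^ l * μ.real {x | Z x = l} ≤
        ∫ x, q ^ Z x ∂μ - ∑ i ∈ Finset.range l, μ.real {x | Z x = i} * q ^ i ∧
      ∫ x, q ^ Z x ∂μ - ∑ i ∈ Finset.range l, μ.real {x | Z x = i} * q ^ i ≤
        q ^ l * (μ.real {x | Z x = l} + q) := by
  have hm : ∀ i, MeasurableSet {x | Z x = i} := fun i => hZ (measurableSet_singleton i)
  have hint : ∀ i, Integrable ({x | Z x = i}.indicator fun _ => q ^ i) μ := fun i =>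
    (integrable_const _).indicator (hm i)
  have hqZ : Integrable (fun x => q ^ Z x) μ := by
    refine Integrable.of_bound (C := 1) ?_ ?_
    · exact ((measurable_from_nat (f := fun n => q ^ n)).comp hZ).aestronglyMeasurable
    · refine Eventually.of_forall fun x => ?_
      rw [Real.norm_of_nonneg (by positivity)]
      exact pow_le_one₀ hq0.le hq1.le
  have hI : ∀ i, ∫ x, {x | Z x = i}.indicator (fun _ => q ^ i) x ∂μ
      = μ.real {x | Z x = i} * q ^ i := fun i => by
    rw [integral_indicator_const _ (hm i), smul_eq_mul]
  have hsum : ∑ i ∈ Finset.range l, μ.real {x | Z x = i} * q ^ i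
      = ∫ x, ∑ i ∈ Finset.range l, {x | Z x = i}.indicator (fun _ => q ^ i) x ∂μ := by
    rw [integral_finsetSum _ fun i _ => hint i]
    simp only [hI]
  have hpt : ∀ x, ∑ i ∈ Finset.range l, {x | Z x = i}.indicator (fun _ => q ^ i) x
      = if Z x < l then q ^ Z x else 0 := by
    intro x
    simp only [indicator_apply, mem_ofPred_eq]
    rw [Finset.sum_ite_eq]
    simp
  have hsumint : Integrable
      (fun x => ∑ i ∈ Finset.range l, {x | Z x = i}.indicator (fun _ => q ^ i) x) μ :=
    integrable_finsetSum _ fun i _ => hint i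
  rw [hsum, ← integral_sub hqZ hsumint]
  -- The remainder is `q ^ Z` on `{Z ≥ l}`: it equals `q ^ l` on `{Z = l}` and is at most `q ^ (l +
  -- 1)` on `{Z > l}`.
  constructor
  · rw [mul_comm, ← hI l]
    refine integral_mono (hint l) (hqZ.sub hsumint) fun x => ?_
    rw [hpt]
    simp only [indicator_apply, mem_ofPred_eq]
    rcases lt_trichotomy (Z x) l with h | h | h
    · simp [h, h.ne]
    · simp [h]
    · rw [if_neg h.ne', if_neg (by omega)]
      simp; positivity
  · have : q ^ l * (μ.real {x | Z x = l} + q)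
        = ∫ x, ({x | Z x = l}.indicator (fun _ => q ^ l) x + q ^ (l + 1)) ∂μ := by
      rw [integral_add (hint l) (integrable_const _), hI l]
      simp; ring
    rw [this]
    refine integral_mono (hqZ.sub hsumint) ((hint l).add (integrable_const _)) fun x => ?_
    rw [hpt]
    simp only [indicator_apply, mem_ofPred_eq]
    have hp : 0 < q ^ (l + 1) := by positivity
    rcases lt_trichotomy (Z x) l with h | h | h
    · simp [h, h.ne, hp.le]
    · simp [h, hp.le]
    · rw [if_neg h.ne', if_neg (by omega)]
      simp only [sub_zero, zero_add]
      exact pow_le_pow_of_le_one hq0.le hq1.le h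

/-- Convergence of generating functions on `(0, 1)` to that of a Poisson law gives convergence of
the point probabilities. -/
lemma tendsto_prob_of_tendsto_pgf {Ω : Type*} [MeasurableSpace Ω] (μ : Measure Ω)
    [IsProbabilityMeasure μ] {Z : ℕ → Ω → ℕ} (hZ : ∀ n, Measurable (Z n)) {τ : ℝ} (hτ : 0 ≤ τ)
    (h : ∀ q : ℝ, 0 < q → q < 1 →
      Tendsto (fun n => ∫ x, q ^ Z n x ∂μ) atTop (𝓝 (Real.exp (-(1 - q) * τ)))) (l : ℕ) :
    Tendsto (fun n => μ.real {x | Z n x = l}) atTop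
      (𝓝 (Real.exp (-τ) * (τ ^ l / (l.factorial : ℝ)))) := by
  induction l using Nat.strong_induction_on with
  | _ l ih =>
    set p : ℕ → ℝ := fun i => Real.exp (-τ) * (τ ^ i / (i.factorial : ℝ)) with hp
    -- the tail of the Poisson generating function
    set H : ℝ → ℝ := fun q =>
      (Real.exp (-(1 - q) * τ) - ∑ i ∈ Finset.range l, p i * q ^ i) / q ^ l with hH
    have hHq : ∀ q : ℝ, 0 < q → q < 1 → Tendsto (fun n => (∫ x, q ^ Z n x ∂μ
        - ∑ i ∈ Finset.range l, μ.real {x | Z n x = i} * q ^ i) / q ^ l) atTop (𝓝 (H q)) :=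
      fun q h0 h1 => ((h q h0 h1).sub (tendsto_finsetSum _ fun i hi =>
        (ih i (Finset.mem_range.1 hi)).mul_const _)).div_const _
    -- By the Poisson series, `H q - p l` is the sum of `p i * q ^ (i - l)` over `i > l`, hence at
    -- most `q`; the factor `exp τ` is slack.
    have hbd : ∀ q : ℝ, 0 < q → q < 1 → |H q - p l| ≤ q * Real.exp τ := by
      intro q h0 h1
      have hser : HasSum (fun i => p i * q ^ i) (Real.exp (-(1 - q) * τ)) := by
        have := (NormedSpace.expSeries_div_hasSum_exp (q * τ)).mul_left (Real.exp (-τ))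
        rw [← Real.exp_eq_exp_ℝ, ← Real.exp_add] at this
        convert! this using 1
        · ext i; simp only [hp]; rw [mul_pow]; ring
        · congr 1; ring
      have hp1 : Summable p := by
        have := (NormedSpace.expSeries_div_hasSum_exp τ).mul_left (Real.exp (-τ))
        exact this.summable
      have hpsum : ∑' i, p (i + (l + 1)) ≤ 1 := by
        have h1 := (NormedSpace.expSeries_div_hasSum_exp τ).mul_left (Real.exp (-τ))
        rw [← Real.exp_eq_exp_ℝ, ← Real.exp_add, neg_add_cancel, Real.exp_zero] at h1
        have h2 := hp1.sum_add_tsum_nat_add (l + 1)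
        have h3 : ∑' i, p i = 1 := h1.tsum_eq
        have h4 : 0 ≤ ∑ i ∈ Finset.range (l + 1), p i :=
          Finset.sum_nonneg fun i _ => by simp only [hp]; positivity
        linarith
      have hs := hser.summable.sum_add_tsum_nat_add (l + 1)
      rw [hser.tsum_eq, Finset.sum_range_succ] at hs
      have hq : 0 < q ^ l := by positivity
      have e1 : H q - p l = (∑' i, p (i + (l + 1)) * q ^ (i + (l + 1))) / q ^ l := by
        simp only [hH]; rw [← hs]; field_simp; ring
      have hle : ∑' i, p (i + (l + 1)) * q ^ (i + (l + 1)) ≤ q ^ (l + 1) := by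
        calc ∑' i, p (i + (l + 1)) * q ^ (i + (l + 1))
            ≤ ∑' i, p (i + (l + 1)) * q ^ (l + 1) := by
              refine Summable.tsum_le_tsum (fun i => ?_)
                ((summable_nat_add_iff (f := fun i => p i * q ^ i) (l + 1)).2 hser.summable)
                (((summable_nat_add_iff (l + 1)).2 hp1).mul_right _)
              exact mul_le_mul_of_nonneg_left (pow_le_pow_of_le_one h0.le h1.le (by omega))
                (by simp only [hp]; positivity)
          _ = (∑' i, p (i + (l + 1))) * q ^ (l + 1) := tsum_mul_right
          _ ≤ 1 * q ^ (l + 1) := by gcongr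
          _ = q ^ (l + 1) := one_mul _
      have h0' : 0 ≤ ∑' i, p (i + (l + 1)) * q ^ (i + (l + 1)) :=
        tsum_nonneg fun i => by simp only [hp]; positivity
      rw [e1, abs_of_nonneg (by positivity)]
      calc _ ≤ q ^ (l + 1) / q ^ l := by gcongr
        _ = q := by rw [pow_succ]; field_simp
        _ ≤ q * Real.exp τ := le_mul_of_one_le_right h0.le (Real.one_le_exp hτ)
    rw [Metric.tendsto_atTop']
    intro ε hε
    -- One `q` pays for the gap between the two sides of `pgf_split`, the other term for `hbd`; `q`
    -- is fixed before `n` grows.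
    obtain ⟨q, hq0, hq1, hqε⟩ : ∃ q : ℝ, 0 < q ∧ q < 1 ∧ q + q * Real.exp τ < ε / 2 := by
      have : Tendsto (fun q : ℝ => q + q * Real.exp τ) (𝓝[>] 0) (𝓝 (0 + 0 * Real.exp τ)) :=
        ((continuous_id.add (continuous_id.mul continuous_const)).tendsto 0).mono_left
          nhdsWithin_le_nhds
      rw [zero_mul, zero_add] at this
      have h1 := this.eventually (gt_mem_nhds (half_pos hε))
      have h2 : ∀ᶠ q : ℝ in 𝓝[>] 0, q ∈ Ioo (0 : ℝ) 1 := Ioo_mem_nhdsGT one_pos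
      obtain ⟨q, h3, h4⟩ := (h1.and h2).exists
      exact ⟨q, h4.1, h4.2, h3⟩
    obtain ⟨n₀, hn₀⟩ := Metric.tendsto_atTop'.1 (hHq q hq0 hq1) (ε / 2) (half_pos hε)
    refine ⟨n₀, fun n hn => ?_⟩
    have h1 := hn₀ n hn
    obtain ⟨h2, h3⟩ := pgf_split μ (hZ n) hq0 hq1 l
    have hql : 0 < q ^ l := by positivity
    rw [mul_comm, ← le_div_iff₀ hql] at h2
    rw [mul_comm, ← div_le_iff₀ hql] at h3
    rw [Real.dist_eq, abs_lt] at h1 ⊢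
    have h4 := abs_le.1 (hbd q hq0 hq1)
    change _ < _ - p l ∧ _ - p l < _
    constructor <;> linarith [h1.1, h1.2, h4.1, h4.2]

lemma tendsto_prob_lt_of_tendsto_pgf {Ω : Type*} [MeasurableSpace Ω] (μ : Measure Ω)
    [IsProbabilityMeasure μ] {Z : ℕ → Ω → ℕ} (hZ : ∀ n, Measurable (Z n)) {τ : ℝ} (hτ : 0 ≤ τ)
    (h : ∀ q : ℝ, 0 < q → q < 1 →
      Tendsto (fun n => ∫ x, q ^ Z n x ∂μ) atTop (𝓝 (Real.exp (-(1 - q) * τ)))) (l : ℕ) :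
    Tendsto (fun n => μ.real {x | Z n x < l}) atTop
      (𝓝 (Real.exp (-τ) * ∑ i ∈ Finset.range l, τ ^ i / (i.factorial : ℝ))) := by
  have e : ∀ n, μ.real {x | Z n x < l} = ∑ i ∈ Finset.range l, μ.real {x | Z n x = i} := by
    intro n
    rw [← measureReal_biUnion_finset]
    · congr 1; ext x; simp
    · intro i _ j _ hij
      exact disjoint_left.2 fun x h1 h2 => hij ((show Z n x = i from h1).symm.trans h2)
    · exact fun i _ => hZ n (measurableSet_singleton i)
  simp only [e, Finset.mul_sum]
  exact tendsto_finsetSum _ fun i _ => tendsto_prob_of_tendsto_pgf μ hZ hτ h i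

end Poisson

/-! ### Order statistics as counts of exceedances. -/

section LthLargest

/-- If at least `l` values exceed `u`, the smallest of these belongs to the set under the supremum
and exceeds `u`. For `l = 0` the supremum is `⊤` while no count is negative, hence `1 ≤ l`. -/
lemma lthLargest_le_iff {ι : Type*} (s : Finset ι) (ξ : ι → EReal) {l : ℕ} (hl : 1 ≤ l)
    (u : EReal) : lthLargest s ξ l ≤ u ↔ (s.filter fun j => u < ξ j).card < l := by
  classical
  rw [lthLargest, sSup_le_iff]
  constructor
  · intro h
    by_contra! hc
    have hne : (s.filter fun j => u < ξ j).Nonempty := Finset.card_pos.1 (by omega)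
    obtain ⟨i, hi, hmin⟩ := Finset.exists_min_image _ ξ hne
    have h1 : ξ i ≤ u := h _ (by
      refine hc.trans (Finset.card_le_card fun j hj => ?_)
      rw [Finset.mem_filter]
      exact ⟨(Finset.mem_filter.1 hj).1, hmin j hj⟩)
    exact absurd (Finset.mem_filter.1 hi).2 (not_lt.2 h1)
  · intro h v hv
    by_contra! hc
    have hv' : l ≤ (s.filter fun j => v ≤ ξ j).card := by convert! hv
    refine absurd (hv'.trans (Finset.card_le_card fun j hj => ?_)) (not_le.2 h)
    rw [Finset.mem_filter] at hj ⊢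
    exact ⟨hj.1, hc.trans_le hj.2⟩

end LthLargest

/-! ### Summing errors along superexponentially growing times. -/

section Series

/-- A polynomial power of `i` is harmless against super-exponential decay. -/
lemma tendsto_sum_pow_mul_exp {c ρ : ℝ} (hc : 0 < c) (hρ : 1 < ρ) (k : ℕ)
    {α N : ℕ → ℕ} (hα : Tendsto α atTop atTop) {A : ℕ → ℝ} (hA : ∀ n, 0 ≤ A n)
    (hAα : ∀ᶠ n in atTop, A n ≤ Real.exp (c * ρ ^ α n)) :
    Tendsto (fun n => A n * ∑ i ∈ Finset.Icc 1 (N n), (i : ℝ) ^ k * Real.exp (-c * ρ ^ (α n + i)))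
      atTop (𝓝 0) := by
  have hρ0 : 0 < ρ := one_pos.trans hρ
  -- Once `exp (c ρ ^ α)` is cancelled, Bernoulli's `ρ ^ i - 1 ≥ i (ρ - 1)` bounds the `i`-th
  -- exponential by `θ ^ i`. For `i ≥ 1` one factor `θ` is kept to give the limit and the others are
  -- replaced by `1 / 2` to give summability.
  set θ : ℕ → ℝ := fun n => Real.exp (-(c * (ρ - 1) * ρ ^ α n)) with hθ
  have hθ0 : Tendsto θ atTop (𝓝 0) := by
    refine Real.tendsto_exp_neg_atTop_nhds_zero.comp ?_
    exact ((tendsto_pow_atTop_atTop_of_one_lt hρ).comp hα).const_mul_atTop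
      (mul_pos hc (sub_pos.2 hρ))
  have hS : Summable fun i : ℕ => (i : ℝ) ^ k * (1 / 2 : ℝ) ^ i :=
    summable_pow_mul_geometric_of_norm_lt_one k (by norm_num)
  have hbound : ∀ᶠ n in atTop,
      A n * ∑ i ∈ Finset.Icc 1 (N n), (i : ℝ) ^ k * Real.exp (-c * ρ ^ (α n + i))
        ≤ θ n * (2 * ∑' i : ℕ, (i : ℝ) ^ k * (1 / 2 : ℝ) ^ i) := by
    filter_upwards [hAα, hθ0.eventually (ge_mem_nhds (show (0 : ℝ) < 1 / 2 by norm_num))]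
      with n h1 h2
    have hsum : ∑ i ∈ Finset.Icc 1 (N n), (i : ℝ) ^ k * (1 / 2 : ℝ) ^ i
        ≤ ∑' i : ℕ, (i : ℝ) ^ k * (1 / 2 : ℝ) ^ i :=
      hS.sum_le_tsum _ fun i _ => by positivity
    calc A n * ∑ i ∈ Finset.Icc 1 (N n), (i : ℝ) ^ k * Real.exp (-c * ρ ^ (α n + i))
        ≤ Real.exp (c * ρ ^ α n) *
          ∑ i ∈ Finset.Icc 1 (N n), (i : ℝ) ^ k * Real.exp (-c * ρ ^ (α n + i)) := by
            gcongr
      _ = ∑ i ∈ Finset.Icc 1 (N n), (i : ℝ) ^ k * Real.exp (-(c * ρ ^ α n * (ρ ^ i - 1))) := by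
            rw [Finset.mul_sum]
            refine Finset.sum_congr rfl fun i _ => ?_
            rw [mul_left_comm, ← Real.exp_add]
            congr 2
            rw [pow_add]; ring
      _ ≤ ∑ i ∈ Finset.Icc 1 (N n), (i : ℝ) ^ k * (θ n * (2 * (1 / 2 : ℝ) ^ i)) := by
            refine Finset.sum_le_sum fun i hi => ?_
            obtain ⟨hi1, -⟩ := Finset.mem_Icc.1 hi
            gcongr
            have hber : (i : ℝ) * (ρ - 1) ≤ ρ ^ i - 1 := by
              have := one_add_mul_le_pow (show (-2 : ℝ) ≤ ρ - 1 by linarith) i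
              rw [show 1 + (ρ - 1) = ρ by ring] at this
              linarith
            calc Real.exp (-(c * ρ ^ α n * (ρ ^ i - 1)))
                ≤ Real.exp (-(c * ρ ^ α n * ((i : ℝ) * (ρ - 1)))) := by gcongr
              _ = θ n ^ i := by
                simp only [hθ]; rw [← Real.exp_nat_mul]; congr 1; ring
              _ = θ n * θ n ^ (i - 1) := by rw [← pow_succ']; congr 1; omega
              _ ≤ θ n * (1 / 2) ^ (i - 1) := by
                gcongr
              _ = θ n * (2 * (1 / 2 : ℝ) ^ i) := by
                congr 1
                obtain ⟨j, rfl⟩ := Nat.exists_eq_add_of_le' hi1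
                rw [Nat.add_sub_cancel, pow_succ]; ring
      _ = θ n * (2 * ∑ i ∈ Finset.Icc 1 (N n), (i : ℝ) ^ k * (1 / 2 : ℝ) ^ i) := by
            rw [Finset.mul_sum, Finset.mul_sum]
            exact Finset.sum_congr rfl fun i _ => by ring
      _ ≤ _ := by
            have : 0 ≤ θ n := (Real.exp_pos _).le
            gcongr
  refine squeeze_zero' (Eventually.of_forall fun n => ?_) hbound ?_
  · exact mul_nonneg (hA n) (Finset.sum_nonneg fun i _ => by positivity)
  · simpa using hθ0.mul_const (2 * ∑' i : ℕ, (i : ℝ) ^ k * (1 / 2 : ℝ) ^ i)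

end Series


/-! ### The exponential map and the adjoint action. -/

section LieExp

variable {d : ℕ} {G : Type*} [TopologicalSpace G] [ChartedSpace (EuclideanSpace ℝ (Fin d)) G]

/-- The derivative of a self-map of a manifold modelled on `ℝ^d`, as a map of the model space. -/
noncomputable def modelDeriv (f : G → G) (x : G) :
    EuclideanSpace ℝ (Fin d) →L[ℝ] EuclideanSpace ℝ (Fin d) :=
  mfderiv (𝓡 d) (𝓡 d) f x

/-- The curve `e` has velocity `v` at time `t`. -/
def HasVelocityAt (e : ℝ → G) (v : EuclideanSpace ℝ (Fin d)) (t : ℝ) : Prop :=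
  HasMFDerivAt 𝓘(ℝ, ℝ) (𝓡 d) e t ((1 : ℝ →L[ℝ] ℝ).smulRight v)

lemma modelDeriv_comp {f g : G → G} {x : G} (hg : MDifferentiableAt (𝓡 d) (𝓡 d) g (f x))
    (hf : MDifferentiableAt (𝓡 d) (𝓡 d) f x) :
    modelDeriv (g ∘ f) x = (modelDeriv (d := d) g (f x)).comp (modelDeriv f x) :=
  mfderiv_comp x hg hf

lemma modelDeriv_id (x : G) : modelDeriv (d := d) (fun y : G => y) x = ContinuousLinearMap.id ℝ _ :=
  mfderiv_id

lemma smulRight_one_comp {E F : Type*} [NormedAddCommGroup E] [NormedSpace ℝ E]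
    [NormedAddCommGroup F] [NormedSpace ℝ F] (L : E →L[ℝ] F) (v : E) :
    L.comp ((1 : ℝ →L[ℝ] ℝ).smulRight v) = (1 : ℝ →L[ℝ] ℝ).smulRight (L v) := by
  ext; simp

lemma HasVelocityAt.comp {e : ℝ → G} {v : EuclideanSpace ℝ (Fin d)} {t : ℝ}
    (he : HasVelocityAt e v t) {f : G → G} (hf : MDifferentiableAt (𝓡 d) (𝓡 d) f (e t)) :
    HasVelocityAt (f ∘ e) (modelDeriv f (e t) v) t := by
  exact (congrArg (fun L : ℝ →L[ℝ] EuclideanSpace ℝ (Fin d) =>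
    HasMFDerivAt 𝓘(ℝ, ℝ) (𝓡 d) (f ∘ e) t L) (smulRight_one_comp (modelDeriv f (e t)) v)).mp
    (hf.hasMFDerivAt.comp t he)

variable [Group G]

lemma isMIntegralCurve_iff_hasVelocityAt {v : GroupLieAlgebra (𝓡 d) G} {e : ℝ → G} :
    IsMIntegralCurve (I := 𝓡 d) e (mulInvariantVectorField v) ↔
      ∀ t, HasVelocityAt e (modelDeriv (d := d) (fun x : G => e t * x) 1 v) t := Iff.rfl

variable [LieGroup (𝓡 d) ∞ G]

lemma lieGroup_three : LieGroup (𝓡 d) (minSmoothness ℝ 3) G :=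
  LieGroup.of_le (n := ∞) (by simp only [minSmoothness_of_isRCLikeNormedField]; exact ENat.LEInfty.out)

lemma isManifold_one_of_lieGroup : IsManifold (𝓡 d) 1 G :=
  IsManifold.of_le (n := ∞) (by norm_cast)

lemma contMDiff_one_mulInvariantVectorField (v : GroupLieAlgebra (𝓡 d) G) :
    ContMDiff (𝓡 d) (𝓡 d).tangent 1
      (fun g : G => (⟨g, mulInvariantVectorField v g⟩ : TangentBundle (𝓡 d) G)) := by
  have := lieGroup_three (d := d) (G := G)
  exact (contMDiff_mulInvariantVectorField v).of_le (by simp)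

lemma mdifferentiable_mul_left' (g : G) : MDifferentiable (𝓡 d) (𝓡 d) (fun x : G => g * x) :=
  (contMDiff_mul_left (I := 𝓡 d) (n := ∞)).mdifferentiable (by simp)

lemma mdifferentiable_mul_right' (g : G) : MDifferentiable (𝓡 d) (𝓡 d) (fun x : G => x * g) :=
  (contMDiff_mul_right (I := 𝓡 d) (n := ∞)).mdifferentiable (by simp)

/-- The chain rule for `L_g ∘ L_h = L_{gh}` at `1`: left translations preserve left-invariant
fields. -/
lemma modelDeriv_mul_left_mul (g h : G) :
    (modelDeriv (d := d) (fun x : G => g * x) h).comp (modelDeriv (fun x : G => h * x) 1)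
      = modelDeriv (fun x : G => g * h * x) 1 := by
  have h1 := modelDeriv_comp (d := d) (x := (1 : G)) (f := fun x : G => h * x)
    (g := fun x : G => g * x) (mdifferentiable_mul_left' g _) (mdifferentiable_mul_left' h _)
  have h2 : (fun x : G => g * x) ∘ (fun x : G => h * x) = fun x => g * h * x := by
    ext x; simp [mul_assoc]
  rw [h2, mul_one] at h1
  exact h1.symm

variable [T2Space G]

/-- The one-parameter subgroup generated by `v` exists. -/
lemma exists_isMIntegralCurve_mulInvariantVectorField (v : GroupLieAlgebra (𝓡 d) G) :
    ∃ e : ℝ → G, e 0 = 1 ∧ IsMIntegralCurve (I := 𝓡 d) e (mulInvariantVectorField v) := by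
  have := isManifold_one_of_lieGroup (d := d) (G := G)
  have hv := contMDiff_one_mulInvariantVectorField (d := d) (G := G) v
  obtain ⟨γ, hγ0, hγ⟩ := exists_isMIntegralCurveAt_of_contMDiffAt_boundaryless (t₀ := 0)
    (hv.contMDiffAt (x := (1 : G)))
  obtain ⟨ε, hε, hγ⟩ := isMIntegralCurveAt_iff'.1 hγ
  -- The left translate by `g` of the local curve at `1` is an integral curve at `g` with the same
  -- lifetime `ε`, and a uniform lifetime makes the field complete.
  refine exists_isMIntegralCurve_of_isMIntegralCurveOn hv hε (fun g => ?_) 1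
  refine ⟨fun t => g * γ t, by simp [hγ0], ?_⟩
  rw [Real.ball_eq_Ioo, zero_sub, zero_add] at hγ
  intro t ht
  have h1 : HasVelocityAt γ (modelDeriv (d := d) (fun x : G => γ t * x) 1 v) t :=
    (hγ t ht).hasMFDerivAt (Ioo_mem_nhds ht.1 ht.2)
  have h2 := h1.comp (f := fun x => g * x) (mdifferentiable_mul_left' g _)
  exact HasMFDerivAt.hasMFDerivWithinAt ((congrArg
    (fun L : EuclideanSpace ℝ (Fin d) →L[ℝ] EuclideanSpace ℝ (Fin d) =>
      HasVelocityAt (fun t => g * γ t) (L v) t) (modelDeriv_mul_left_mul g (γ t))).mp h2)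

/-- Uniqueness of integral curves makes the choice inside `lieExp` immaterial. -/
lemma lieExp_eq_of_isMIntegralCurve {v : GroupLieAlgebra (𝓡 d) G} {e : ℝ → G} (h0 : e 0 = 1)
    (he : IsMIntegralCurve (I := 𝓡 d) e (mulInvariantVectorField v)) : lieExp v = e 1 := by
  have := isManifold_one_of_lieGroup (d := d) (G := G)
  have hex : ∃ e : ℝ → G, e 0 = 1 ∧
      IsMIntegralCurve (I := 𝓡 d) e (mulInvariantVectorField (I := 𝓡 d) v) := ⟨e, h0, he⟩
  rw [lieExp, dif_pos hex]
  have := isMIntegralCurve_Ioo_eq_of_contMDiff_boundaryless (t₀ := 0)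
    (contMDiff_one_mulInvariantVectorField (d := d) (G := G) v) hex.choose_spec.2 he
    (hex.choose_spec.1.trans h0.symm)
  rw [this]

lemma lieExp_smul_eq_of_isMIntegralCurve {v : GroupLieAlgebra (𝓡 d) G} {e : ℝ → G} (h0 : e 0 = 1)
    (he : IsMIntegralCurve (I := 𝓡 d) e (mulInvariantVectorField v)) (t : ℝ) :
    lieExp (t • v) = e t := by
  have h := he.comp_mul t
  have h2 : t • mulInvariantVectorField (I := 𝓡 d) (G := G) v = mulInvariantVectorField (t • v) :=
    (mulInvariantVectorField_smul t v).symm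
  rw [h2] at h
  rw [lieExp_eq_of_isMIntegralCurve (e := e ∘ (· * t)) (by simp [h0]) h]
  simp

lemma lieExp_zero_smul (v : GroupLieAlgebra (𝓡 d) G) : lieExp ((0 : ℝ) • v) = (1 : G) := by
  obtain ⟨e, h0, he⟩ := exists_isMIntegralCurve_mulInvariantVectorField v
  rw [lieExp_smul_eq_of_isMIntegralCurve h0 he, h0]

lemma hasVelocityAt_lieExp_smul (v : GroupLieAlgebra (𝓡 d) G) :
    HasVelocityAt (d := d) (fun t : ℝ => (lieExp (t • v) : G)) v 0 := by
  obtain ⟨e, h0, he⟩ := exists_isMIntegralCurve_mulInvariantVectorField v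
  have h1 : (fun t : ℝ => (lieExp (t • v) : G)) = e :=
    funext fun t => lieExp_smul_eq_of_isMIntegralCurve h0 he t
  have h2 := isMIntegralCurve_iff_hasVelocityAt.1 he 0
  rw [h0] at h2
  simp only [one_mul] at h2
  rw [modelDeriv_id] at h2
  rw [h1]
  exact h2

/-- Conjugation intertwines the exponential map with the adjoint action. -/
lemma conj_lieExp (g : G) (v : GroupLieAlgebra (𝓡 d) G) :
    g * lieExp v * g⁻¹ = lieExp (lieAd g v) := by
  obtain ⟨e, h0, he⟩ := exists_isMIntegralCurve_mulInvariantVectorField v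
  rw [lieExp_eq_of_isMIntegralCurve h0 he]
  have hc : MDifferentiable (𝓡 d) (𝓡 d) (fun x : G => g * x * g⁻¹) :=
    (mdifferentiable_mul_right' g⁻¹).comp (mdifferentiable_mul_left' g)
  refine (lieExp_eq_of_isMIntegralCurve (e := fun t => g * e t * g⁻¹) (by simp [h0]) ?_).symm
  rw [isMIntegralCurve_iff_hasVelocityAt] at he ⊢
  intro t
  have h1 := (he t).comp (hc (e t))
  have h2 := modelDeriv_comp (d := d) (x := (1 : G))
    (f := fun x : G => e t * x) (g := fun x : G => g * x * g⁻¹) (hc _)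
    (mdifferentiable_mul_left' (e t) _)
  have h3 := modelDeriv_comp (d := d) (x := (1 : G))
    (f := fun x : G => g * x * g⁻¹) (g := fun x : G => g * e t * g⁻¹ * x)
    (mdifferentiable_mul_left' _ _) (hc _)
  -- Conjugation after `L_{e t}` is `L_{g (e t) g⁻¹}` after conjugation. Differentiated at `1`, this
  -- says that the conjugated curve integrates the field of `lieAd g v`.
  have h4 : (fun x : G => g * x * g⁻¹) ∘ (fun x : G => e t * x)
      = (fun x : G => g * e t * g⁻¹ * x) ∘ (fun x : G => g * x * g⁻¹) := by
    ext x; simp [mul_assoc]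
  rw [h4, h3] at h2
  simp only [mul_one, mul_inv_cancel] at h2
  exact (congrArg (fun L : EuclideanSpace ℝ (Fin d) →L[ℝ] EuclideanSpace ℝ (Fin d) =>
    HasVelocityAt (fun t => g * e t * g⁻¹) (L v) t) h2.symm).mp h1

end LieExp


/-! ### Smooth functions on the quotient and their derivatives. -/

section SmoothQuot

set_option linter.unusedSectionVars false

variable {d : ℕ} {G : Type*} [TopologicalSpace G] [ChartedSpace (EuclideanSpace ℝ (Fin d)) G]

/-- The derivative of a real function on a manifold modelled on `ℝ^d`, as a linear form on the model
space. -/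
noncomputable def modelGrad (f : G → ℝ) (x : G) : EuclideanSpace ℝ (Fin d) →L[ℝ] ℝ :=
  mfderiv (𝓡 d) 𝓘(ℝ, ℝ) f x

lemma HasVelocityAt.hasDerivAt_comp {e : ℝ → G} {v : EuclideanSpace ℝ (Fin d)} {t : ℝ}
    (he : HasVelocityAt e v t) {f : G → ℝ} (hf : MDifferentiableAt (𝓡 d) 𝓘(ℝ, ℝ) f (e t)) :
    HasDerivAt (f ∘ e) (modelGrad f (e t) v) t := by
  have h : HasMFDerivAt 𝓘(ℝ, ℝ) 𝓘(ℝ, ℝ) (f ∘ e) t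
      ((1 : ℝ →L[ℝ] ℝ).smulRight (modelGrad f (e t) v)) :=
    (congrArg (fun L : ℝ →L[ℝ] ℝ => HasMFDerivAt 𝓘(ℝ, ℝ) 𝓘(ℝ, ℝ) (f ∘ e) t L)
      (smulRight_one_comp (modelGrad f (e t)) v)).mp (hf.hasMFDerivAt.comp t he)
  rw [hasDerivAt_iff_hasFDerivAt, ← ContinuousLinearMap.smulRight_one_eq_toSpanSingleton]
  exact hasMFDerivAt_iff_hasFDerivAt.1 h

variable [Group G] [LieGroup (𝓡 d) ∞ G]

/-- The derivatives of a smooth function along the right-invariant vector fields are smooth. -/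
lemma contMDiff_modelGrad_mul_right {F : G → ℝ} (hF : ContMDiff (𝓡 d) 𝓘(ℝ, ℝ) ∞ F)
    (v : EuclideanSpace ℝ (Fin d)) :
    ContMDiff (𝓡 d) 𝓘(ℝ, ℝ) ∞ (fun g : G => modelGrad (fun x : G => F (x * g)) 1 v) := by
  have := isManifold_one_of_lieGroup (d := d) (G := G)
  intro g₀
  have h1 : ContMDiffAt ((𝓡 d).prod (𝓡 d)) 𝓘(ℝ, ℝ) ∞
      (Function.uncurry fun g x : G => F (x * g)) (g₀, 1) :=
    (hF.comp ((contMDiff_snd (I := 𝓡 d) (J := 𝓡 d)).mul (contMDiff_fst))).contMDiffAt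
  have h2 := ContMDiffAt.mfderiv (m := ∞) (fun g x : G => F (x * g)) (fun _ => (1 : G)) h1
    contMDiffAt_const (by simp)
  -- The source base point stays at `1` and the target is a vector space, so both coordinate changes
  -- are trivial.
  have h3 : ∀ g, inTangentCoordinates (𝓡 d) 𝓘(ℝ, ℝ) (fun _ : G => (1 : G))
      (fun g : G => F (1 * g)) (fun g : G => modelGrad (fun x : G => F (x * g)) 1) g₀ g
        = modelGrad (fun x : G => F (x * g)) 1 := by
    intro g
    rw [inTangentCoordinates_eq (x₀ := g₀) (x := g) _ _ _ (mem_chart_source _ (1 : G))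
      (by rw [chartAt_self_eq]; exact mem_univ _)]
    rw [tangentBundleCore_coordChange_model_space]
    ext v
    have h4 : ((tangentBundleCore (𝓡 d) G).coordChange
        (achart (EuclideanSpace ℝ (Fin d)) 1) (achart (EuclideanSpace ℝ (Fin d)) 1) 1) v = v :=
      (tangentBundleCore (𝓡 d) G).coordChange_self _ _ (by simp) _
    exact congrArg (modelGrad (fun x : G => F (x * g)) 1) h4
  have h5 : ContMDiffAt (𝓡 d) 𝓘(ℝ, EuclideanSpace ℝ (Fin d) →L[ℝ] ℝ) ∞
      (fun g : G => modelGrad (d := d) (fun x : G => F (x * g)) 1) g₀ := by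
    refine h2.congr_of_eventuallyEq (Eventually.of_forall fun g => ?_)
    exact (h3 g).symm
  exact h5.clm_apply contMDiffAt_const

variable (d) in
/-- Smooth functions on `G ⧸ Γ`: those with a smooth lift to `G`. -/
def IsSmoothQuot {Γ : Subgroup G} (f : G ⧸ Γ → ℝ) : Prop :=
  ContMDiff (𝓡 d) 𝓘(ℝ, ℝ) ∞ (fun g : G => f (g : G ⧸ Γ))

variable {Γ : Subgroup G} {f f₁ f₂ : G ⧸ Γ → ℝ}

lemma isSmoothQuot_const (c : ℝ) : IsSmoothQuot d (fun _ : G ⧸ Γ => c) := contMDiff_const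

lemma IsSmoothQuot.add (h₁ : IsSmoothQuot d f₁) (h₂ : IsSmoothQuot d f₂) :
    IsSmoothQuot d (fun x => f₁ x + f₂ x) := ContMDiff.add h₁ h₂

lemma IsSmoothQuot.mul (h₁ : IsSmoothQuot d f₁) (h₂ : IsSmoothQuot d f₂) :
    IsSmoothQuot d (fun x => f₁ x * f₂ x) := ContMDiff.mul h₁ h₂

lemma IsSmoothQuot.const_mul (h : IsSmoothQuot d f) (c : ℝ) :
    IsSmoothQuot d (fun x => c * f x) := (isSmoothQuot_const c).mul h

lemma IsSmoothQuot.sum {ι : Type*} (s : Finset ι) {f : ι → G ⧸ Γ → ℝ}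
    (h : ∀ i, IsSmoothQuot d (f i)) : IsSmoothQuot d (fun x => ∑ i ∈ s, f i x) := by
  classical
  induction s using Finset.induction_on with
  | empty => simpa using isSmoothQuot_const 0
  | insert i s hi ih => simpa only [Finset.sum_insert hi] using (h i).add ih

lemma IsSmoothQuot.comp_contDiff {E : Type*} [NormedAddCommGroup E] [NormedSpace ℝ E]
    {Y : G ⧸ Γ → E} (hY : ContMDiff (𝓡 d) 𝓘(ℝ, E) ∞ (fun g : G => Y (g : G ⧸ Γ)))
    {χ : E → ℝ} (hχ : ContDiff ℝ ∞ χ) : IsSmoothQuot d (fun x => χ (Y x)) :=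
  hχ.contMDiff.comp hY

lemma IsSmoothQuot.comp_smul (h : IsSmoothQuot d f) (g : G) :
    IsSmoothQuot d (fun x => f (g • x)) :=
  ContMDiff.comp (g := fun g : G => f (g : G ⧸ Γ)) h (contMDiff_mul_left (I := 𝓡 d) (a := g))

lemma IsSmoothQuot.continuous (h : IsSmoothQuot d f) : Continuous f :=
  continuous_quot_lift (r := QuotientGroup.leftRel Γ) (f := fun g : G => f (g : G ⧸ Γ))
    (fun a b hab => congrArg f (Quotient.sound hab)) (ContMDiff.continuous h) |>.congr fun x => by
      induction x using QuotientGroup.induction_on with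
      | H g => rfl

variable [T2Space G]

lemma IsSmoothQuot.hasDerivAt_coe (h : IsSmoothQuot d f) (v : GroupLieAlgebra (𝓡 d) G) (g : G) :
    HasDerivAt (fun t : ℝ => f (lieExp (t • v) • (g : G ⧸ Γ)))
      (modelGrad (d := d) (fun x : G => f ((x * g : G) : G ⧸ Γ)) 1 v) 0 := by
  have h1 : ContMDiff (𝓡 d) 𝓘(ℝ, ℝ) ∞ (fun x : G => f ((x * g : G) : G ⧸ Γ)) :=
    ContMDiff.comp (g := fun g : G => f (g : G ⧸ Γ)) h (contMDiff_mul_right (I := 𝓡 d) (a := g))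
  have h2 := (hasVelocityAt_lieExp_smul v).hasDerivAt_comp
    ((h1.mdifferentiable (by simp)) (lieExp ((0 : ℝ) • v)))
  rw [lieExp_zero_smul] at h2
  exact h2

lemma IsSmoothQuot.lieDeriv_coe (h : IsSmoothQuot d f) (v : GroupLieAlgebra (𝓡 d) G) (g : G) :
    lieDeriv v f (g : G ⧸ Γ) = modelGrad (d := d) (fun x : G => f ((x * g : G) : G ⧸ Γ)) 1 v :=
  (h.hasDerivAt_coe v g).deriv

lemma IsSmoothQuot.hasDerivAt (h : IsSmoothQuot d f) (v : GroupLieAlgebra (𝓡 d) G) (x : G ⧸ Γ) :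
    HasDerivAt (fun t : ℝ => f (lieExp (t • v) • x)) (lieDeriv v f x) 0 := by
  induction x using QuotientGroup.induction_on with
  | H g =>
    rw [h.lieDeriv_coe]
    exact h.hasDerivAt_coe v g

lemma IsSmoothQuot.hasLieDeriv (h : IsSmoothQuot d f) (v : GroupLieAlgebra (𝓡 d) G) :
    HasLieDeriv v f := fun x => (h.hasDerivAt v x).differentiableAt

lemma IsSmoothQuot.lieDeriv (h : IsSmoothQuot d f) (v : GroupLieAlgebra (𝓡 d) G) :
    IsSmoothQuot d (lieDeriv v f) := by
  have h1 := contMDiff_modelGrad_mul_right h v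
  refine h1.congr fun g => ?_
  exact h.lieDeriv_coe v g

lemma IsSmoothQuot.iterLieDeriv (h : IsSmoothQuot d f) (ζ : Fin d → GroupLieAlgebra (𝓡 d) G)
    (w : List (Fin d)) : IsSmoothQuot d (iterLieDeriv ζ f w) := by
  induction w with
  | nil => exact h
  | cons n w ih => exact ih.lieDeriv (ζ n)

lemma lieDeriv_add (h₁ : IsSmoothQuot d f₁) (h₂ : IsSmoothQuot d f₂)
    (v : GroupLieAlgebra (𝓡 d) G) :
    lieDeriv v (fun x => f₁ x + f₂ x) = fun x => lieDeriv v f₁ x + lieDeriv v f₂ x :=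
  funext fun x => ((h₁.hasDerivAt v x).add (h₂.hasDerivAt v x)).deriv

lemma lieDeriv_mul (h₁ : IsSmoothQuot d f₁) (h₂ : IsSmoothQuot d f₂)
    (v : GroupLieAlgebra (𝓡 d) G) :
    lieDeriv v (fun x => f₁ x * f₂ x)
      = fun x => lieDeriv v f₁ x * f₂ x + f₁ x * lieDeriv v f₂ x := by
  funext x
  have := ((h₁.hasDerivAt v x).mul (h₂.hasDerivAt v x)).deriv
  rw [lieExp_zero_smul, one_smul] at this
  exact this

omit [LieGroup (𝓡 d) ∞ G] [T2Space G] in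
lemma lieDeriv_const (c : ℝ) (v : GroupLieAlgebra (𝓡 d) G) :
    lieDeriv v (fun _ : G ⧸ Γ => c) = fun _ => 0 :=
  funext fun _ => deriv_const _ _

lemma lieDeriv_const_mul (h : IsSmoothQuot d f) (c : ℝ) (v : GroupLieAlgebra (𝓡 d) G) :
    lieDeriv v (fun x => c * f x) = fun x => c * lieDeriv v f x :=
  funext fun x => ((h.hasDerivAt v x).const_mul c).deriv

/-- Derivative of the composition of a function with the translation by `g`, along an eigenvector
of `Ad g`. -/
lemma lieDeriv_comp_smul {g : G} {v : GroupLieAlgebra (𝓡 d) G} {c : ℝ}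
    (hv : lieAd g v = c • v) (f : G ⧸ Γ → ℝ) :
    lieDeriv v (fun x => f (g • x)) = fun x => c * lieDeriv v f (g • x) := by
  funext x
  -- This is `g exp(tv) = exp(t Ad(g) v) g` with `Ad(g) v = c v`.
  have h : ∀ t : ℝ, g • lieExp (t • v) • x = lieExp ((c * t) • v) • g • x := by
    intro t
    have h1 := conj_lieExp (d := d) g (t • v)
    rw [map_smul, hv, smul_smul, mul_comm t c] at h1
    rw [← h1, smul_smul, smul_smul]
    simp [mul_assoc]
  change deriv (fun t : ℝ => f (g • lieExp (t • v) • x)) 0 = _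
  simp only [h]
  rw [deriv_comp_mul_left c (fun t : ℝ => f (lieExp (t • v) • g • x)) 0]
  simp [_root_.lieDeriv]

omit [LieGroup (𝓡 d) ∞ G] [T2Space G] in
-- The recursion of `iterLieDeriv` strips the outermost derivative. Stripping the innermost one
-- instead lets inductions on the length replace `f` by its derivative, where the product and chain
-- rules apply directly.
lemma iterLieDeriv_append_singleton (ζ : Fin d → GroupLieAlgebra (𝓡 d) G) (f : G ⧸ Γ → ℝ)
    (w : List (Fin d)) (n : Fin d) :
    iterLieDeriv ζ f (w ++ [n]) = iterLieDeriv ζ (lieDeriv (ζ n) f) w := by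
  induction w with
  | nil => rfl
  | cons m w ih => simp only [List.cons_append, iterLieDeriv, ih]

lemma iterLieDeriv_add (h₁ : IsSmoothQuot d f₁) (h₂ : IsSmoothQuot d f₂)
    (ζ : Fin d → GroupLieAlgebra (𝓡 d) G) (w : List (Fin d)) :
    iterLieDeriv ζ (fun x => f₁ x + f₂ x) w
      = fun x => iterLieDeriv ζ f₁ w x + iterLieDeriv ζ f₂ w x := by
  induction w with
  | nil => rfl
  | cons n w ih =>
    simp only [iterLieDeriv, ih]
    exact lieDeriv_add (h₁.iterLieDeriv ζ w) (h₂.iterLieDeriv ζ w) _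

lemma iterLieDeriv_const_mul (h : IsSmoothQuot d f) (c : ℝ)
    (ζ : Fin d → GroupLieAlgebra (𝓡 d) G) (w : List (Fin d)) :
    iterLieDeriv ζ (fun x => c * f x) w = fun x => c * iterLieDeriv ζ f w x := by
  induction w with
  | nil => rfl
  | cons n w ih =>
    simp only [iterLieDeriv, ih]
    exact lieDeriv_const_mul (h.iterLieDeriv ζ w) c _

lemma iterLieDeriv_sum {ι : Type*} (s : Finset ι) {f : ι → G ⧸ Γ → ℝ}
    (h : ∀ i, IsSmoothQuot d (f i)) (ζ : Fin d → GroupLieAlgebra (𝓡 d) G) (w : List (Fin d)) :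
    iterLieDeriv ζ (fun x => ∑ i ∈ s, f i x) w = fun x => ∑ i ∈ s, iterLieDeriv ζ (f i) w x := by
  classical
  induction s using Finset.induction_on with
  | empty =>
    simp only [Finset.sum_empty]
    induction w with
    | nil => rfl
    | cons n w ih => simp only [iterLieDeriv, ih, lieDeriv_const]
  | insert i s hi ih =>
    simp only [Finset.sum_insert hi]
    rw [iterLieDeriv_add (h i) (IsSmoothQuot.sum s h), ih]

end SmoothQuot


/-! ### Derivative bounds, Sobolev norms and mixing of all orders. -/

section SobolevBounds

set_option linter.unusedSectionVars false

variable {d : ℕ} {G : Type*} [TopologicalSpace G] [ChartedSpace (EuclideanSpace ℝ (Fin d)) G]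
  [Group G] [LieGroup (𝓡 d) ∞ G] [T2Space G] {Γ : Subgroup G}
  {ζ : Fin d → GroupLieAlgebra (𝓡 d) G} {f f₁ f₂ : G ⧸ Γ → ℝ} {k : ℕ}

/-- A smooth function on `G ⧸ Γ` bounded by `1` whose derivatives of order `q ≤ k` are bounded by
`Λ ^ q`. -/
structure HasDerivBound (ζ : Fin d → GroupLieAlgebra (𝓡 d) G) (k : ℕ) (Λ : ℝ) (f : G ⧸ Γ → ℝ) :
    Prop where
  smooth : IsSmoothQuot d f
  bound : ∀ w : List (Fin d), w.length ≤ k → ∀ x, |iterLieDeriv ζ f w x| ≤ Λ ^ w.length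

/-- The Leibniz rule and the binomial theorem: rates add, with no combinatorial constant. The
amplitudes `M₁`, `M₂` must be general because one derivative turns `M` into `M Λ` in the induction.
-/
lemma abs_iterLieDeriv_mul_le {Λ₁ Λ₂ : ℝ} (h1 : 0 ≤ Λ₁) (h2 : 0 ≤ Λ₂) (n : ℕ) :
    ∀ {f₁ f₂ : G ⧸ Γ → ℝ} {M₁ M₂ : ℝ}, 0 ≤ M₁ → 0 ≤ M₂ →
      IsSmoothQuot d f₁ → IsSmoothQuot d f₂ →
      (∀ w : List (Fin d), w.length ≤ n → ∀ x, |iterLieDeriv ζ f₁ w x| ≤ M₁ * Λ₁ ^ w.length) →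
      (∀ w : List (Fin d), w.length ≤ n → ∀ x, |iterLieDeriv ζ f₂ w x| ≤ M₂ * Λ₂ ^ w.length) →
      ∀ w : List (Fin d), w.length = n → ∀ x,
        |iterLieDeriv ζ (fun x => f₁ x * f₂ x) w x| ≤ M₁ * M₂ * (Λ₁ + Λ₂) ^ n := by
  induction n with
  | zero =>
    intro f₁ f₂ M₁ M₂ hM₁ hM₂ hf₁ hf₂ hb₁ hb₂ w hw x
    obtain rfl := List.length_eq_zero_iff.1 hw
    have e1 := hb₁ [] (by simp) x
    have e2 := hb₂ [] (by simp) x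
    simp only [iterLieDeriv, List.length_nil, pow_zero, mul_one] at e1 e2 ⊢
    rw [abs_mul]
    exact mul_le_mul e1 e2 (abs_nonneg _) hM₁
  | succ n ih =>
    intro f₁ f₂ M₁ M₂ hM₁ hM₂ hf₁ hf₂ hb₁ hb₂ w hw x
    obtain ⟨w, i, rfl⟩ : ∃ w' i, w = w' ++ [i] := by
      rcases List.eq_nil_or_concat w with h | ⟨w', i, h⟩
      · simp [h] at hw
      · exact ⟨w', i, by simpa using h⟩
    have hw' : w.length = n := by simpa using hw
    rw [iterLieDeriv_append_singleton, lieDeriv_mul hf₁ hf₂,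
      iterLieDeriv_add ((hf₁.lieDeriv _).mul hf₂) (hf₁.mul (hf₂.lieDeriv _))]
    have key : ∀ {f : G ⧸ Γ → ℝ} {M Λ : ℝ},
        (∀ w : List (Fin d), w.length ≤ n + 1 → ∀ x, |iterLieDeriv ζ f w x| ≤ M * Λ ^ w.length) →
        (∀ w : List (Fin d), w.length ≤ n → ∀ x,
          |iterLieDeriv ζ (lieDeriv (ζ i) f) w x| ≤ M * Λ * Λ ^ w.length) := by
      intro f M Λ h v hv x
      have := h (v ++ [i]) (by simpa using hv) x
      rw [iterLieDeriv_append_singleton] at this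
      simpa [pow_succ', mul_assoc] using this
    have e1 := ih (mul_nonneg hM₁ h1) hM₂ (hf₁.lieDeriv (ζ i)) hf₂ (key hb₁)
      (fun v hv => hb₂ v (by omega)) w hw' x
    have e2 := ih hM₁ (mul_nonneg hM₂ h2) hf₁ (hf₂.lieDeriv (ζ i))
      (fun v hv => hb₁ v (by omega)) (key hb₂) w hw' x
    calc _ ≤ _ := abs_add_le _ _
      _ ≤ _ := add_le_add e1 e2
      _ = M₁ * M₂ * (Λ₁ + Λ₂) ^ (n + 1) := by ring

lemma HasDerivBound.mul {Λ₁ Λ₂ : ℝ} (h1 : 0 ≤ Λ₁) (h2 : 0 ≤ Λ₂) (hf₁ : HasDerivBound ζ k Λ₁ f₁)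
    (hf₂ : HasDerivBound ζ k Λ₂ f₂) : HasDerivBound ζ k (Λ₁ + Λ₂) (fun x => f₁ x * f₂ x) := by
  refine ⟨hf₁.smooth.mul hf₂.smooth, fun w hw x => ?_⟩
  have := abs_iterLieDeriv_mul_le (ζ := ζ) h1 h2 w.length zero_le_one zero_le_one hf₁.smooth
    hf₂.smooth (fun v hv x => by rw [one_mul]; exact hf₁.bound v (by omega) x)
    (fun v hv x => by rw [one_mul]; exact hf₂.bound v (by omega) x) w rfl x
  simpa using this

lemma iterLieDeriv_const_of_ne_nil (c : ℝ) {w : List (Fin d)} (hw : w ≠ []) :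
    iterLieDeriv ζ (fun _ : G ⧸ Γ => c) w = fun _ => 0 := by
  induction w with
  | nil => exact absurd rfl hw
  | cons n w ih =>
    rcases eq_or_ne w [] with rfl | hne
    · simp only [iterLieDeriv, lieDeriv_const]
    · simp only [iterLieDeriv, ih hne, lieDeriv_const]

lemma hasDerivBound_one : HasDerivBound ζ k 0 (fun _ : G ⧸ Γ => (1 : ℝ)) := by
  refine ⟨isSmoothQuot_const 1, fun w _ x => ?_⟩
  rcases eq_or_ne w [] with rfl | hw
  · simp [iterLieDeriv]
  · rw [iterLieDeriv_const_of_ne_nil 1 hw]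
    simp [hw]

lemma HasDerivBound.prod {ι : Type*} (s : Finset ι) {f : ι → G ⧸ Γ → ℝ} {Λ : ι → ℝ}
    (hΛ : ∀ i, 0 ≤ Λ i) (hf : ∀ i, HasDerivBound ζ k (Λ i) (f i)) :
    HasDerivBound ζ k (∑ i ∈ s, Λ i) (fun x => ∏ i ∈ s, f i x) := by
  classical
  induction s using Finset.induction_on with
  | empty => simpa using hasDerivBound_one
  | insert i s hi ih =>
    simp only [Finset.sum_insert hi, Finset.prod_insert hi]
    exact (hf i).mul (hΛ i) (Finset.sum_nonneg fun j _ => hΛ j) ih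

lemma HasDerivBound.mono {Λ Λ' : ℝ} (h0 : 0 ≤ Λ) (h : Λ ≤ Λ') (hf : HasDerivBound ζ k Λ f) :
    HasDerivBound ζ k Λ' f :=
  ⟨hf.smooth, fun w hw x => (hf.bound w hw x).trans (pow_le_pow_left₀ h0 h _)⟩

/-- The constant disappears under every derivative; positivity of `f` matters only at order zero,
where `0 ≤ s f ≤ 1`. -/
lemma HasDerivBound.one_sub_mul {Λ s : ℝ} (hs0 : 0 ≤ s) (hs1 : s ≤ 1)
    (h0 : ∀ x, 0 ≤ f x) (hf : HasDerivBound ζ k Λ f) :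
    HasDerivBound ζ k Λ (fun x => 1 - s * f x) := by
  have hsm : IsSmoothQuot d (fun x => (-s) * f x) := hf.smooth.const_mul _
  have e : (fun x => 1 - s * f x) = fun x => 1 + (-s) * f x := by ext x; ring
  rw [e]
  refine ⟨(isSmoothQuot_const 1).add hsm, fun w hw x => ?_⟩
  rcases eq_or_ne w [] with rfl | hne
  · have h1 : |f x| ≤ 1 := by simpa [iterLieDeriv] using hf.bound [] (by simp) x
    have h2 := (abs_le.1 h1).2
    simp only [iterLieDeriv, List.length_nil, pow_zero]
    rw [abs_le]
    constructor <;> nlinarith [h0 x, mul_le_mul hs1 h2 (h0 x) zero_le_one]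
  · rw [iterLieDeriv_add (isSmoothQuot_const 1) hsm, iterLieDeriv_const_of_ne_nil 1 hne,
      iterLieDeriv_const_mul hf.smooth]
    simp only [zero_add, abs_mul, abs_neg, abs_of_nonneg hs0]
    calc s * |iterLieDeriv ζ f w x| ≤ 1 * Λ ^ w.length :=
          mul_le_mul hs1 (hf.bound w hw x) (abs_nonneg _) zero_le_one
      _ = _ := one_mul _

lemma iterLieDeriv_comp_smul {g : G} {c : Fin d → ℝ} (hc : ∀ i, lieAd g (ζ i) = c i • ζ i)
    (hf : IsSmoothQuot d f) (w : List (Fin d)) :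
    iterLieDeriv ζ (fun x => f (g • x)) w
      = fun x => (w.map c).prod * iterLieDeriv ζ f w (g • x) := by
  induction w with
  | nil => ext x; simp [iterLieDeriv]
  | cons n w ih =>
    simp only [iterLieDeriv, ih]
    rw [lieDeriv_const_mul ((hf.iterLieDeriv ζ w).comp_smul g), lieDeriv_comp_smul (hc n)]
    ext x
    simp only [List.map_cons, List.prod_cons]
    ring

/-- Each derivative along an eigenvector picks up its eigenvalue, so the rate is multiplied by at
most the largest one. -/
lemma HasDerivBound.comp_smul {Λ C : ℝ} {g : G} {c : Fin d → ℝ}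
    (hc : ∀ i, lieAd g (ζ i) = c i • ζ i) (hc0 : ∀ i, 0 ≤ c i) (hcC : ∀ i, c i ≤ C)
    (hf : HasDerivBound ζ k Λ f) : HasDerivBound ζ k (C * Λ) (fun x => f (g • x)) := by
  refine ⟨hf.smooth.comp_smul g, fun w hw x => ?_⟩
  have h1 : 0 ≤ (w.map c).prod ∧ (w.map c).prod ≤ C ^ w.length := by
    clear hw
    induction w with
    | nil => simp
    | cons n w ih =>
      simp only [List.map_cons, List.prod_cons, List.length_cons, pow_succ']
      exact ⟨mul_nonneg (hc0 n) ih.1, mul_le_mul (hcC n) ih.2 ih.1 ((hc0 n).trans (hcC n))⟩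
  rw [iterLieDeriv_comp_smul hc hf.smooth, abs_mul, abs_of_nonneg h1.1, mul_pow]
  exact mul_le_mul h1.2 (hf.bound w hw _) (abs_nonneg _) (h1.1.trans h1.2)

variable [MeasurableSpace (G ⧸ Γ)] [BorelSpace (G ⧸ Γ)] (μ : Measure (G ⧸ Γ))
  [IsProbabilityMeasure μ]

lemma HasDerivBound.isSobolev {Λ : ℝ} (hf : HasDerivBound ζ k Λ f) : IsSobolev ζ μ k f :=
  ⟨fun n w _ => (hf.smooth.iterLieDeriv ζ w).hasLieDeriv (ζ n), fun w hw =>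
    MemLp.of_bound (hf.smooth.iterLieDeriv ζ w).continuous.aestronglyMeasurable _
      (Eventually.of_forall fun x => hf.bound w hw x)⟩

/-- There are `d ^ q` words of length `q`, each contributing at most `Λ ^ (2k)` because `1 ≤ Λ` and
`μ` has mass one. -/
lemma HasDerivBound.sobolevNorm_le {Λ : ℝ} (hΛ : 1 ≤ Λ) (hf : HasDerivBound ζ k Λ f) :
    sobolevNorm ζ μ k f ≤ √(∑ q ∈ Finset.range (k + 1), (d : ℝ) ^ q) * Λ ^ k := by
  have h0 : 0 ≤ Λ := zero_le_one.trans hΛ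
  have h1 : √(∑ q ∈ Finset.range (k + 1), (d : ℝ) ^ q) * Λ ^ k
      = √((∑ q ∈ Finset.range (k + 1), (d : ℝ) ^ q) * (Λ ^ k) ^ 2) := by
    rw [Real.sqrt_mul (Finset.sum_nonneg fun q _ => by positivity),
      Real.sqrt_sq (by positivity)]
  rw [h1, sobolevNorm]
  refine Real.sqrt_le_sqrt ?_
  rw [Finset.sum_mul]
  refine Finset.sum_le_sum fun q hq => ?_
  have hqk : q ≤ k := by simpa [Nat.lt_succ_iff] using hq
  calc ∑ w : Fin q → Fin d, ∫ x, (iterLieDeriv ζ f (List.ofFn w) x) ^ 2 ∂μ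
      ≤ ∑ w : Fin q → Fin d, (Λ ^ k) ^ 2 := by
        refine Finset.sum_le_sum fun w _ => ?_
        calc ∫ x, (iterLieDeriv ζ f (List.ofFn w) x) ^ 2 ∂μ ≤ ∫ x, (Λ ^ k) ^ 2 ∂μ := by
              refine integral_mono_of_nonneg (Eventually.of_forall fun x => sq_nonneg _)
                (integrable_const _) (Eventually.of_forall fun x => ?_)
              refine sq_le_sq' ?_ ?_
              all_goals
                have h2 := hf.bound (List.ofFn w) (by simpa using hqk) x
                have h3 : Λ ^ (List.ofFn w).length ≤ Λ ^ k := by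
                  simpa using pow_le_pow_right₀ hΛ hqk
                have h4 := abs_le.1 (h2.trans h3)
                linarith [h4.1, h4.2]
          _ = (Λ ^ k) ^ 2 := by simp
    _ = (d : ℝ) ^ q * (Λ ^ k) ^ 2 := by simp

lemma HasDerivBound.integrable {Λ : ℝ} (hf : HasDerivBound ζ k Λ f) : Integrable f μ :=
  (MemLp.of_bound (p := 1) hf.smooth.continuous.aestronglyMeasurable 1
    (Eventually.of_forall fun x => by simpa [iterLieDeriv] using hf.bound [] (by simp) x)).integrable
    le_rfl

variable [IsTopologicalGroup G] [SMulInvariantMeasure G (G ⧸ Γ) μ]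

/-- Mixing of all orders along a sparse sequence of times, for products `∏ (1 - s f (a_{m_j} x))`.
-/
lemma abs_integral_prod_sub_le {a : ℝ → G} {γ : Fin d → ℝ} {γmax δ c c₁ : ℝ}
    (hAd : ∀ (t : ℝ) (i : Fin d), lieAd (a t) (ζ i) = Real.exp (γ i * t) • ζ i)
    (hγ : ∀ i, γ i ≤ γmax) (hγ0 : 0 ≤ γmax) (hk : k ≠ 0) (hc : 0 < c)
    (hmix : ∀ f g : G ⧸ Γ → ℝ, IsSobolev ζ μ k f → IsSobolev ζ μ k g → ∀ t : ℝ, 0 ≤ t →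
      |(∫ x, f x * g (a t • x) ∂μ) - (∫ x, f x ∂μ) * (∫ x, g x ∂μ)|
        ≤ c * Real.exp (-δ * t) * sobolevNorm ζ μ k f * sobolevNorm ζ μ k g)
    {m : ℕ → ℝ} (hm : ∀ j, 0 < m j) (hmono : Monotone m)
    (hgap : ∀ j, k * γmax * m j ≤ (δ - c₁) * m (j + 1))
    {Λ s : ℝ} (hs0 : 0 ≤ s) (hs1 : s ≤ 1) (hΛ : 1 ≤ Λ) (h0 : ∀ x, 0 ≤ f x)
    (hf : HasDerivBound ζ k Λ f) (n : ℕ) :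
    |∫ x, ∏ j ∈ Finset.range n, (1 - s * f (a (m j) • x)) ∂μ - (1 - s * ∫ x, f x ∂μ) ^ n|
      ≤ ∑ i ∈ Finset.range n, (c * (∑ q ∈ Finset.range (k + 1), (d : ℝ) ^ q) * Λ ^ (2 * k)) *
          ((i : ℝ) ^ k * Real.exp (-c₁ * m i)) := by
  have hΛ0 : 0 ≤ Λ := zero_le_one.trans hΛ
  set D : ℝ := ∑ q ∈ Finset.range (k + 1), (d : ℝ) ^ q with hD
  have hD0 : 0 ≤ D := Finset.sum_nonneg fun q _ => by positivity
  have hfle : ∀ x, f x ≤ 1 := fun x => by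
    have := hf.bound [] (by simp) x
    simp only [iterLieDeriv, List.length_nil, pow_zero] at this
    exact (abs_le.1 this).2
  have hfj : ∀ j, HasDerivBound ζ k (Real.exp (γmax * m j) * Λ)
      (fun x => 1 - s * f (a (m j) • x)) := fun j => by
    refine HasDerivBound.one_sub_mul (f := fun x => f (a (m j) • x)) hs0 hs1 (fun x => h0 _)
      ?_
    refine hf.comp_smul (hAd (m j)) (fun i => (Real.exp_pos _).le) fun i => ?_
    exact Real.exp_le_exp.2 (mul_le_mul_of_nonneg_right (hγ i) (hm j).le)
  have hP : ∀ n, HasDerivBound ζ k (∑ j ∈ Finset.range n, Real.exp (γmax * m j) * Λ)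
      (fun x => ∏ j ∈ Finset.range n, (1 - s * f (a (m j) • x))) := fun n =>
    HasDerivBound.prod _ (fun j => by positivity) hfj
  have hp1 : ∫ x, f x ∂μ ≤ 1 := by
    calc ∫ x, f x ∂μ ≤ ∫ _, (1 : ℝ) ∂μ :=
          integral_mono (hf.integrable μ) (integrable_const _) hfle
      _ = 1 := by simp
  have hp0 : 0 ≤ ∫ x, f x ∂μ := integral_nonneg h0
  set p := ∫ x, f x ∂μ with hp
  have hsp0 : 0 ≤ 1 - s * p := by nlinarith [mul_le_mul hs1 hp1 hp0 zero_le_one]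
  have hsp1 : 1 - s * p ≤ 1 := by nlinarith [mul_nonneg hs0 hp0]
  induction n with
  | zero => simp
  | succ n ih =>
    rw [Finset.sum_range_succ]
    set P : G ⧸ Γ → ℝ := fun x => ∏ j ∈ Finset.range n, (1 - s * f (a (m j) • x)) with hPdef
    have hPn : HasDerivBound ζ k (∑ j ∈ Finset.range n, Real.exp (γmax * m j) * Λ) P := hP n
    have hcomp : Continuous fun x : G ⧸ Γ => f (a (m n) • x) :=
      (hf.smooth.comp_smul (a (m n))).continuous
    have hint : Integrable (fun x => P x * f (a (m n) • x)) μ := by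
      refine (hPn.integrable μ).mul_bdd (c := 1) hcomp.aestronglyMeasurable
        (Eventually.of_forall fun x => ?_)
      rw [Real.norm_of_nonneg (h0 _)]; exact hfle _
    have hsplit : ∫ x, ∏ j ∈ Finset.range (n + 1), (1 - s * f (a (m j) • x)) ∂μ
        = ∫ x, P x ∂μ - s * ∫ x, P x * f (a (m n) • x) ∂μ := by
      rw [← integral_const_mul, ← integral_sub (hPn.integrable μ) (hint.const_mul s)]
      refine integral_congr_ae (Eventually.of_forall fun x => ?_)
      simp only [Finset.prod_range_succ, hPdef]; ring
    -- All earlier factors together form the single observable `P`, tested against `f` at time `m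
    -- n`; only two-fold mixing is used.
    have hstep : |(∫ x, P x * f (a (m n) • x) ∂μ) - (∫ x, P x ∂μ) * p|
        ≤ c * D * Λ ^ (2 * k) * ((n : ℝ) ^ k * Real.exp (-c₁ * m n)) := by
      -- The first factor costs nothing, since `P = 1` and `μ` is invariant. This agrees with the
      -- weight `0 ^ k = 0`, which needs `k ≠ 0`.
      rcases Nat.eq_zero_or_pos n with hn | hn
      · subst hn
        have : ∫ x, f (a (m 0) • x) ∂μ = p := integral_smul_eq_self f
        simp [hPdef, this, hk]
      · obtain ⟨n', rfl⟩ := Nat.exists_eq_add_of_le' hn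
        set Λ' : ℝ := ((n' + 1 : ℕ) : ℝ) * (Real.exp (γmax * m n') * Λ) with hΛ'
        have hle : ∑ j ∈ Finset.range (n' + 1), Real.exp (γmax * m j) * Λ ≤ Λ' := by
          rw [hΛ', ← nsmul_eq_mul]
          refine (Finset.sum_le_card_nsmul _ _ (Real.exp (γmax * m n') * Λ) fun j hj => ?_).trans
            (by rw [Finset.card_range])
          refine mul_le_mul_of_nonneg_right (Real.exp_le_exp.2 ?_) hΛ0
          exact mul_le_mul_of_nonneg_left
            (hmono (by have := Finset.mem_range.1 hj; omega)) hγ0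
        have h1Λ' : 1 ≤ Λ' := by
          have e1 : 1 ≤ Real.exp (γmax * m n') :=
            Real.one_le_exp (mul_nonneg hγ0 (hm n').le)
          have e2 : (1 : ℝ) ≤ ((n' + 1 : ℕ) : ℝ) := by exact_mod_cast Nat.le_add_left 1 n'
          exact one_le_mul_of_one_le_of_one_le e2 (one_le_mul_of_one_le_of_one_le e1 hΛ)
        have hP' : HasDerivBound ζ k Λ' P :=
          hPn.mono (Finset.sum_nonneg fun j _ => by positivity) hle
        refine (hmix P f (hP'.isSobolev μ) (hf.isSobolev μ) _ (hm _).le).trans ?_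
        have s1 := hP'.sobolevNorm_le μ h1Λ'
        have s2 := hf.sobolevNorm_le μ hΛ
        calc c * Real.exp (-δ * m (n' + 1)) * sobolevNorm ζ μ k P * sobolevNorm ζ μ k f
            ≤ c * Real.exp (-δ * m (n' + 1)) * (√D * Λ' ^ k) * (√D * Λ ^ k) := by
              have : 0 ≤ sobolevNorm ζ μ k P := Real.sqrt_nonneg _
              have : 0 ≤ sobolevNorm ζ μ k f := Real.sqrt_nonneg _
              gcongr
          _ = c * D * Λ ^ (2 * k) * (((n' + 1 : ℕ) : ℝ) ^ k *
                (Real.exp (-δ * m (n' + 1)) * Real.exp (γmax * m n') ^ k)) := by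
              rw [hΛ', mul_pow, mul_pow]
              have : √D * √D = D := Real.mul_self_sqrt hD0
              rw [two_mul, pow_add]
              linear_combination (c * Real.exp (-δ * m (n' + 1)) * (((n' + 1 : ℕ) : ℝ) ^ k *
                (Real.exp (γmax * m n') ^ k * Λ ^ k)) * Λ ^ k) * this
          _ ≤ c * D * Λ ^ (2 * k) * (((n' + 1 : ℕ) : ℝ) ^ k * Real.exp (-c₁ * m (n' + 1))) := by
              gcongr
              -- The growth `exp (k γmax m_{n'})` of the Sobolev norm is absorbed by part of the
              -- decay at time `m_{n'+1}`, by `hgap`; the rate `c₁` survives.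
              rw [← Real.exp_nat_mul, ← Real.exp_add]
              refine Real.exp_le_exp.2 ?_
              have := hgap n'
              linarith
    rw [hsplit]
    -- The previous error is multiplied by `1 - s p ∈ [0, 1]`, so errors add up without
    -- amplification.
    have e1 : ∫ x, P x ∂μ - s * ∫ x, P x * f (a (m n) • x) ∂μ - (1 - s * p) ^ (n + 1)
        = (1 - s * p) * (∫ x, P x ∂μ - (1 - s * p) ^ n)
          - s * ((∫ x, P x * f (a (m n) • x) ∂μ) - (∫ x, P x ∂μ) * p) := by ring
    rw [e1]
    refine (abs_sub _ _).trans (add_le_add ?_ ?_)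
    · rw [abs_mul, abs_of_nonneg hsp0]
      exact (mul_le_of_le_one_left (abs_nonneg _) hsp1).trans ih
    · rw [abs_mul, abs_of_nonneg hs0]
      exact (mul_le_of_le_one_left (abs_nonneg _) hs1).trans hstep

end SobolevBounds


/-! ### The Riemannian distance is Euclidean to first order in a chart. -/

section RiemannianChart

set_option linter.unusedSectionVars false

open Manifold

variable {d : ℕ} {M : Type*} [TopologicalSpace M] [ChartedSpace (EuclideanSpace ℝ (Fin d)) M]
  [IsManifold (𝓡 d) 1 M]
  [RiemannianBundle (fun x : M => TangentSpace (𝓡 d) x)]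
  [IsContinuousRiemannianBundle (EuclideanSpace ℝ (Fin d)) (fun x : M => TangentSpace (𝓡 d) x)]

/-- The model space, with the norm of the tangent space at `x`, is isometric to a Euclidean space.
-/
lemma exists_linear_isometry_tangentSpace (x : M) :
    ∃ T : EuclideanSpace ℝ (Fin d) ≃L[ℝ] EuclideanSpace ℝ (Fin d),
      ∀ w, ‖T w‖ = ‖(trivializationAt (EuclideanSpace ℝ (Fin d))
        (fun x : M => TangentSpace (𝓡 d) x) x).symmL ℝ x w‖ := by
  have hfin : FiniteDimensional ℝ (TangentSpace (𝓡 d) x) :=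
    inferInstanceAs (FiniteDimensional ℝ (EuclideanSpace ℝ (Fin d)))
  have hrank : Module.finrank ℝ (TangentSpace (𝓡 d) x) = d :=
    (finrank_euclideanSpace_fin : Module.finrank ℝ (EuclideanSpace ℝ (Fin d)) = d)
  let b := (stdOrthonormalBasis ℝ (TangentSpace (𝓡 d) x)).reindex (finCongr hrank)
  let S := (trivializationAt (EuclideanSpace ℝ (Fin d))
        (fun x : M => TangentSpace (𝓡 d) x) x).continuousLinearEquivAt ℝ x
          (FiberBundle.mem_baseSet_trivializationAt' x)
  refine ⟨S.symm.trans b.repr.toContinuousLinearEquiv, fun w => ?_⟩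
  have h1 : ‖b.repr (S.symm w)‖ = ‖S.symm w‖ := b.repr.norm_map _
  refine Eq.trans h1 ?_
  rw [Trivialization.symm_continuousLinearEquivAt_eq]

/-- Continuity of the metric: norms of nearby tangent spaces, read in the chart, agree with the norm
at `x` up to a factor close to `1`. This direction bounds the derivative of the chart;
`eventually_norm_symmL_le` serves the inverse chart. -/
lemma eventually_norm_symmL_mfderiv_le (x : M) {r : ℝ} (hr : 1 < r) :
    ∀ᶠ y in 𝓝 x, ∀ v : TangentSpace (𝓡 d) y,
      ‖(trivializationAt (EuclideanSpace ℝ (Fin d))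
        (fun x : M => TangentSpace (𝓡 d) x) x).symmL ℝ x
          (mfderiv (𝓡 d) 𝓘(ℝ, EuclideanSpace ℝ (Fin d)) (extChartAt (𝓡 d) x) y v)‖ ≤ r * ‖v‖ := by
  filter_upwards [eventually_norm_symmL_trivializationAt_self_comp_lt (EuclideanSpace ℝ (Fin d))
    (fun x : M => TangentSpace (𝓡 d) x) x hr,
    chart_source_mem_nhds (EuclideanSpace ℝ (Fin d)) x] with y hy h'y v
  rw [← TangentBundle.continuousLinearMapAt_trivializationAt h'y]
  refine le_trans (ContinuousLinearMap.le_opNorm (((trivializationAt (EuclideanSpace ℝ (Fin d))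
    (fun x : M => TangentSpace (𝓡 d) x) x).symmL ℝ x).comp
    ((trivializationAt (EuclideanSpace ℝ (Fin d))
        (fun x : M => TangentSpace (𝓡 d) x) x).continuousLinearMapAt ℝ y)) v) ?_
  gcongr

lemma eventually_norm_symmL_le (x : M) {r : ℝ} (hr : 1 < r) :
    ∀ᶠ y in 𝓝 x, ∀ w : EuclideanSpace ℝ (Fin d),
      ‖(trivializationAt (EuclideanSpace ℝ (Fin d))
        (fun x : M => TangentSpace (𝓡 d) x) x).symmL ℝ y w‖ ≤
      r * ‖(trivializationAt (EuclideanSpace ℝ (Fin d))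
        (fun x : M => TangentSpace (𝓡 d) x) x).symmL ℝ x w‖ := by
  filter_upwards [eventually_norm_symmL_trivializationAt_comp_self_lt (EuclideanSpace ℝ (Fin d))
    (fun x : M => TangentSpace (𝓡 d) x) x hr] with y hy w
  set S := trivializationAt (EuclideanSpace ℝ (Fin d)) (fun x : M => TangentSpace (𝓡 d) x) x
  have h1 : S.continuousLinearMapAt ℝ x (S.symmL ℝ x w) = w :=
    S.continuousLinearMapAt_symmL (FiberBundle.mem_baseSet_trivializationAt' x) w
  have h2 := ContinuousLinearMap.le_opNorm ((S.symmL ℝ y).comp (S.continuousLinearMapAt ℝ x))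
    (S.symmL ℝ x w)
  rw [ContinuousLinearMap.comp_apply, h1] at h2
  refine h2.trans ?_
  gcongr


/-- In the chart at `x`, with the norm of the tangent space at `x`, the distance to `x` is at most
`r` times the norm, for every `r > 1`. -/
lemma eventually_riemannianEDist_le_mul_norm (x : M)
    {T : EuclideanSpace ℝ (Fin d) →L[ℝ] EuclideanSpace ℝ (Fin d)}
    (hT : ∀ w, ‖T w‖ = ‖(trivializationAt (EuclideanSpace ℝ (Fin d))
        (fun x : M => TangentSpace (𝓡 d) x) x).symmL ℝ x w‖) {r : ℝ} (hr : 1 < r) :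
    ∀ᶠ y in 𝓝 x, riemannianEDist (𝓡 d) x y ≤
      ENNReal.ofReal (r * ‖T (extChartAt (𝓡 d) x y - extChartAt (𝓡 d) x x)‖) := by
  set φ := extChartAt (𝓡 d) x with hφ
  have hC : ∀ᶠ z in 𝓝 (φ x), ∀ w : EuclideanSpace ℝ (Fin d),
      ‖mfderivWithin 𝓘(ℝ, EuclideanSpace ℝ (Fin d)) (𝓡 d) φ.symm (range (𝓡 d)) z w‖
        ≤ r * ‖T w‖ := by
    have h1 : ∀ᶠ z in 𝓝 (φ x), φ.symm z ∈ {y | ∀ w : EuclideanSpace ℝ (Fin d),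
      ‖(trivializationAt (EuclideanSpace ℝ (Fin d))
        (fun x : M => TangentSpace (𝓡 d) x) x).symmL ℝ y w‖ ≤
      r * ‖(trivializationAt (EuclideanSpace ℝ (Fin d))
        (fun x : M => TangentSpace (𝓡 d) x) x).symmL ℝ x w‖} := by
      refine (continuousAt_extChartAt_symm (I := 𝓡 d) x).eventually_mem ?_
      rw [extChartAt_to_inv]
      exact eventually_norm_symmL_le x hr
    filter_upwards [h1, extChartAt_target_mem_nhds (I := 𝓡 d) x] with z hz hzt w
    have h2 : φ.symm z ∈ (chartAt (EuclideanSpace ℝ (Fin d)) x).source := by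
      rw [← extChartAt_source (𝓡 d)]; exact φ.map_target hzt
    have h3 := hz w
    rw [TangentBundle.symmL_trivializationAt h2, ← hT, ← hφ, φ.right_inv hzt] at h3
    exact h3
  obtain ⟨ε, hε, hball⟩ := Metric.mem_nhds_iff.1
    (inter_mem (extChartAt_target_mem_nhds (I := 𝓡 d) x) hC)
  have hA : φ ⁻¹' (Metric.ball (φ x) ε) ∈ 𝓝 x :=
    (continuousAt_extChartAt (I := 𝓡 d) x).preimage_mem_nhds (Metric.ball_mem_nhds _ hε)
  filter_upwards [hA, extChartAt_source_mem_nhds (I := 𝓡 d) x] with y hy hys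
  -- The straight segment of the chart competes in the infimum of lengths.
  let η := ContinuousAffineMap.lineMap (R := ℝ) (φ x) (φ y)
  set γ := φ.symm ∘ η
  have hη : Icc 0 1 ⊆ ⇑η ⁻¹' Metric.ball (φ x) ε := by
    simp only [← image_subset_iff, ContinuousAffineMap.coe_lineMap_eq,
     ← segment_eq_image_lineMap, η]
    exact (convex_ball _ _).segment_subset (Metric.mem_ball_self hε) hy
  have η_smooth : ContMDiffOn 𝓘(ℝ, ℝ) 𝓘(ℝ, EuclideanSpace ℝ (Fin d)) 1 η (Icc 0 1) := by
    apply ContMDiff.contMDiffOn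
    rw [contMDiff_iff_contDiff]
    exact ContinuousAffineMap.contDiff _
  have h1 : riemannianEDist (𝓡 d) x y ≤ pathELength (𝓡 d) γ 0 1 := by
    apply riemannianEDist_le_pathELength _ _ _ zero_le_one
    · exact (contMDiffOn_extChartAt_symm x).comp η_smooth (fun t ht => (hball (hη ht)).1)
    · simp [γ, η, ContinuousAffineMap.coe_lineMap_eq, φ]
    · simp only [γ, η, ContinuousAffineMap.coe_lineMap_eq, Function.comp_apply,
        AffineMap.lineMap_apply_one]
      exact φ.left_inv hys
  refine h1.trans ?_
  rw [pathELength_eq_lintegral_mfderivWithin_Icc]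
  have h2 : ∀ t ∈ Icc (0 : ℝ) 1, ‖mfderivWithin 𝓘(ℝ, ℝ) (𝓡 d) γ (Icc 0 1) t 1‖ₑ
      ≤ ENNReal.ofReal (r * ‖T (φ y - φ x)‖) := by
    intro t ht
    have h3 : mfderivWithin 𝓘(ℝ, ℝ) (𝓡 d) γ (Icc 0 1) t 1 =
        (mfderivWithin 𝓘(ℝ, EuclideanSpace ℝ (Fin d)) (𝓡 d) φ.symm (range (𝓡 d)) (η t))
          (mfderivWithin 𝓘(ℝ, ℝ) 𝓘(ℝ, EuclideanSpace ℝ (Fin d)) η (Icc 0 1) t 1) := by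
      have h4 : mfderivWithin 𝓘(ℝ, ℝ) (𝓡 d) γ (Icc 0 1) t =
        (mfderivWithin 𝓘(ℝ, EuclideanSpace ℝ (Fin d)) (𝓡 d) φ.symm (range (𝓡 d)) (η t)) ∘L
          (mfderivWithin 𝓘(ℝ, ℝ) 𝓘(ℝ, EuclideanSpace ℝ (Fin d)) η (Icc 0 1) t) := by
        apply mfderivWithin_comp
        · exact mdifferentiableWithinAt_extChartAt_symm (hball (hη ht)).1
        · exact η_smooth.mdifferentiableOn one_ne_zero t ht
        · exact fun z _ => mem_range_self (f := (𝓡 d)) (η z)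
        · rw [uniqueMDiffWithinAt_iff_uniqueDiffWithinAt]
          exact uniqueDiffOn_Icc zero_lt_one t ht
      exact congr($h4 1)
    have h5 : (mfderivWithin 𝓘(ℝ, ℝ) 𝓘(ℝ, EuclideanSpace ℝ (Fin d)) η (Icc 0 1) t 1 :
        EuclideanSpace ℝ (Fin d)) = φ y - φ x := by
      rw [mfderivWithin_eq_fderivWithin]
      have h6 : HasDerivWithinAt (fun t : ℝ => AffineMap.lineMap (φ x) (φ y) t)
          (φ y - φ x) (Icc 0 1) t := AffineMap.hasDerivWithinAt_lineMap
      have h7 := h6.derivWithin (uniqueDiffOn_Icc zero_lt_one t ht)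
      exact h7
    rw [h3, ← ofReal_norm]
    refine ENNReal.ofReal_le_ofReal ?_
    refine ((hball (hη ht)).2 _).trans ?_
    exact (congrArg (fun v => r * ‖T v‖) h5).le
  calc ∫⁻ t in Icc 0 1, ‖mfderivWithin 𝓘(ℝ, ℝ) (𝓡 d) γ (Icc 0 1) t 1‖ₑ
      ≤ ∫⁻ t in Icc (0 : ℝ) 1, ENNReal.ofReal (r * ‖T (φ y - φ x)‖) :=
        setLIntegral_mono' measurableSet_Icc h2
    _ = _ := by simp

/-- In the chart at `x`, with the norm of the tangent space at `x`, the norm is at most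
`r` times the distance to `x`, for every `r > 1`. -/
lemma exists_norm_lt_mul_of_riemannianEDist_lt [T3Space M] (x : M)
    {T : EuclideanSpace ℝ (Fin d) →L[ℝ] EuclideanSpace ℝ (Fin d)}
    (hT : ∀ w, ‖T w‖ = ‖(trivializationAt (EuclideanSpace ℝ (Fin d))
        (fun x : M => TangentSpace (𝓡 d) x) x).symmL ℝ x w‖) {r : ℝ} (hr : 1 < r) :
    ∃ R₀ > (0 : ℝ), ∀ R, 0 < R → R ≤ R₀ → ∀ y, riemannianEDist (𝓡 d) x y < ENNReal.ofReal R →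
      y ∈ (extChartAt (𝓡 d) x).source ∧
      ‖T (extChartAt (𝓡 d) x y - extChartAt (𝓡 d) x x)‖ < r * R := by
  set φ := extChartAt (𝓡 d) x with hφ
  have hr0 : 0 < r := one_pos.trans hr
  have hs : φ.source ∩ {y | ∀ v : TangentSpace (𝓡 d) y,
      ‖T (mfderiv (𝓡 d) 𝓘(ℝ, EuclideanSpace ℝ (Fin d)) φ y v)‖ ≤ r * ‖v‖} ∈ 𝓝 x := by
    refine inter_mem (extChartAt_source_mem_nhds (I := 𝓡 d) x) ?_
    filter_upwards [eventually_norm_symmL_mfderiv_le (d := d) x hr] with y hy v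
    exact (hT _).trans_le (hy v)
  obtain ⟨c, hc, hcs⟩ := setOfPred_riemannianEDist_lt_subset_nhds (𝓡 d) hs
  refine ⟨c, by exact_mod_cast hc, fun R hR hRc y hy => ?_⟩
  have hRc' : ENNReal.ofReal R ≤ c := by
    rw [← ENNReal.ofReal_coe_nnreal]; exact ENNReal.ofReal_le_ofReal hRc
  refine ⟨(hcs (hy.trans_le hRc')).1, ?_⟩
  rw [ENNReal.ofReal] at hy
  obtain ⟨γ, hγx, hγy, γ_smooth, hγ⟩ := exists_lt_of_riemannianEDist_lt hy
  -- A path shorter than `c` cannot leave the good neighbourhood, since its initial pieces are no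
  -- longer than the whole. There the chart stretches speeds by at most `r`.
  have hγs : ∀ t ∈ Icc (0 : ℝ) 1, γ t ∈ φ.source ∩ {y | ∀ v : TangentSpace (𝓡 d) y,
      ‖T (mfderiv (𝓡 d) 𝓘(ℝ, EuclideanSpace ℝ (Fin d)) φ y v)‖ ≤ r * ‖v‖} := by
    intro t ht
    refine hcs (lt_of_le_of_lt ?_ (hγ.trans_le hRc'))
    calc riemannianEDist (𝓡 d) x (γ t) ≤ pathELength (𝓡 d) γ 0 t :=
          riemannianEDist_le_pathELength (γ_smooth.mono (Icc_subset_Icc_right ht.2)) hγx rfl ht.1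
      _ ≤ pathELength (𝓡 d) γ 0 1 := pathELength_mono le_rfl ht.2
  let c₁ : ℝ → EuclideanSpace ℝ (Fin d) := φ ∘ γ
  have hc₁ : ContMDiffOn 𝓘(ℝ, ℝ) 𝓘(ℝ, EuclideanSpace ℝ (Fin d)) 1 c₁ (Icc 0 1) :=
    contMDiffOn_extChartAt.comp (I' := 𝓡 d)
      (t := (chartAt (EuclideanSpace ℝ (Fin d)) x).source) γ_smooth
      (fun t ht => by rw [← extChartAt_source (𝓡 d)]; exact (hγs t ht).1)
  have hc₂ : ContDiffOn ℝ 1 (T ∘ c₁) (Icc 0 1) :=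
    T.contDiff.comp_contDiffOn (contMDiffOn_iff_contDiffOn.1 hc₁)
  have hmain : ‖T (φ y - φ x)‖ₑ ≤ ENNReal.ofReal r * pathELength (𝓡 d) γ 0 1 := by
    have e1 : T (φ y - φ x) = (T ∘ c₁) 1 - (T ∘ c₁) 0 := by
      simp [c₁, hγx, hγy]
    rw [e1, pathELength_eq_lintegral_mfderivWithin_Icc,
      ← lintegral_const_mul' _ _ ENNReal.ofReal_ne_top]
    refine (enorm_sub_le_lintegral_derivWithin_Icc_of_contDiffOn_Icc hc₂ zero_le_one).trans ?_
    refine setLIntegral_mono' measurableSet_Icc fun t ht => ?_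
    have hu := uniqueDiffOn_Icc (zero_lt_one (α := ℝ)) t ht
    have h4 : mfderivWithin 𝓘(ℝ, ℝ) 𝓘(ℝ, EuclideanSpace ℝ (Fin d)) c₁ (Icc 0 1) t =
        (mfderiv (𝓡 d) 𝓘(ℝ, EuclideanSpace ℝ (Fin d)) φ (γ t)) ∘L
          (mfderivWithin 𝓘(ℝ, ℝ) (𝓡 d) γ (Icc 0 1) t) := by
      apply mfderiv_comp_mfderivWithin
      · refine mdifferentiableAt_extChartAt ?_
        rw [← extChartAt_source (𝓡 d)]; exact (hγs t ht).1
      · exact γ_smooth.mdifferentiableOn one_ne_zero _ ht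
      · rw [uniqueMDiffWithinAt_iff_uniqueDiffWithinAt]
        exact hu
    have h5 : derivWithin c₁ (Icc 0 1) t = mfderiv (𝓡 d) 𝓘(ℝ, EuclideanSpace ℝ (Fin d)) φ (γ t)
        (mfderivWithin 𝓘(ℝ, ℝ) (𝓡 d) γ (Icc 0 1) t 1) := by
      rw [← fderivWithin_derivWithin, ← mfderivWithin_eq_fderivWithin]
      exact congr($h4 1)
    have h6 : derivWithin (T ∘ c₁) (Icc 0 1) t = T (derivWithin c₁ (Icc 0 1) t) := by
      have h7 : HasDerivWithinAt c₁ (derivWithin c₁ (Icc 0 1) t) (Icc 0 1) t :=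
        ((contMDiffOn_iff_contDiffOn.1 hc₁).differentiableOn one_ne_zero t ht).hasDerivWithinAt
      exact (T.hasFDerivAt.comp_hasDerivWithinAt t h7).derivWithin hu
    rw [h6, h5, ← ofReal_norm, ← ofReal_norm, ← ENNReal.ofReal_mul hr0.le]
    exact ENNReal.ofReal_le_ofReal ((hγs t ht).2 _)
  have hlt : ENNReal.ofReal r * pathELength (𝓡 d) γ 0 1 < ENNReal.ofReal (r * R) := by
    rw [ENNReal.ofReal_mul hr0.le]
    exact ENNReal.mul_lt_mul_right (by simpa using hr0) ENNReal.ofReal_ne_top hγ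
  have := hmain.trans_lt hlt
  rw [← ofReal_norm] at this
  exact (ENNReal.ofReal_lt_ofReal_iff (mul_pos hr0 hR)).1 this

end RiemannianChart


/-! ### Right-invariant metrics and balls of the quotient. -/

section InvariantMetric

set_option linter.unusedSectionVars false

open Manifold

variable {d : ℕ} {G : Type*} [TopologicalSpace G] [ChartedSpace (EuclideanSpace ℝ (Fin d)) G]
  [Group G] [LieGroup (𝓡 d) ∞ G] {B : LieRiemannianMetric d G}

/-- Right translation carries a path to one of the same length. Equality follows by translating back
with `h⁻¹`. -/
lemma LieRiemannianMetric.IsRightInvariant.distG_mul_right_le (hB : B.IsRightInvariant)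
    (g g' h : G) : B.distG (g * h) (g' * h) ≤ B.distG g g' := by
  unfold LieRiemannianMetric.distG
  let : RiemannianBundle (fun x : G => TangentSpace (𝓡 d) x) := ⟨B.toRiemannianMetric⟩
  refine le_of_forall_gt fun r hr => ?_
  obtain ⟨r', hr', hlt⟩ := ENNReal.lt_iff_exists_nnreal_btwn.1 hr
  refine LT.lt.trans ?_ hlt
  obtain ⟨γ, hγx, hγy, γ_smooth, hγ⟩ := exists_lt_of_riemannianEDist_lt hr'
  have hR : ContMDiff (𝓡 d) (𝓡 d) 1 (fun y : G => y * h) :=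
    (contMDiff_mul_right (I := 𝓡 d) (n := ∞)).of_le (by simp)
  have hle : riemannianEDist (𝓡 d) (g * h) (g' * h)
      ≤ pathELength (𝓡 d) ((fun y : G => y * h) ∘ γ) 0 1 :=
    riemannianEDist_le_pathELength (hR.comp_contMDiffOn γ_smooth) (by simp [hγx]) (by simp [hγy])
      zero_le_one
  refine lt_of_le_of_lt (hle.trans (le_of_eq ?_)) hγ
  rw [pathELength_eq_lintegral_mfderivWithin_Icc, pathELength_eq_lintegral_mfderivWithin_Icc]
  refine setLIntegral_congr_fun measurableSet_Icc fun t ht => ?_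
  have h4 : mfderivWithin 𝓘(ℝ, ℝ) (𝓡 d) ((fun y : G => y * h) ∘ γ) (Icc 0 1) t =
      (mfderiv (𝓡 d) (𝓡 d) (fun y : G => y * h) (γ t)) ∘L
        (mfderivWithin 𝓘(ℝ, ℝ) (𝓡 d) γ (Icc 0 1) t) := by
    apply mfderiv_comp_mfderivWithin
    · exact hR.mdifferentiable one_ne_zero _
    · exact γ_smooth.mdifferentiableOn one_ne_zero _ ht
    · rw [uniqueMDiffWithinAt_iff_uniqueDiffWithinAt]
      exact uniqueDiffOn_Icc zero_lt_one t ht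
  have h5 : mfderivWithin 𝓘(ℝ, ℝ) (𝓡 d) ((fun y : G => y * h) ∘ γ) (Icc 0 1) t 1 =
      (mfderiv (𝓡 d) (𝓡 d) (fun y : G => y * h) (γ t))
        (mfderivWithin 𝓘(ℝ, ℝ) (𝓡 d) γ (Icc 0 1) t 1) := congr($h4 1)
  have h6 : ∀ v : TangentSpace (𝓡 d) (γ t),
      ‖mfderiv (𝓡 d) (𝓡 d) (fun y : G => y * h) (γ t) v‖ = ‖v‖ := by
    intro v
    rw [norm_eq_sqrt_real_inner, norm_eq_sqrt_real_inner]
    exact congrArg Real.sqrt (hB h (γ t) v v)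
  change ‖mfderivWithin 𝓘(ℝ, ℝ) (𝓡 d) ((fun y : G => y * h) ∘ γ) (Icc 0 1) t 1‖ₑ = _
  rw [h5, ← ofReal_norm, ← ofReal_norm]
  exact congrArg ENNReal.ofReal (h6 _)

lemma LieRiemannianMetric.IsRightInvariant.distG_mul_right (hB : B.IsRightInvariant)
    (g g' h : G) : B.distG (g * h) (g' * h) = B.distG g g' := by
  refine le_antisymm (hB.distG_mul_right_le g g' h) ?_
  simpa using hB.distG_mul_right_le (g * h) (g' * h) h⁻¹

lemma LieRiemannianMetric.distG_comm (B : LieRiemannianMetric d G) (g h : G) :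
    B.distG g h = B.distG h g := by
  unfold LieRiemannianMetric.distG
  let : RiemannianBundle (fun x : G => TangentSpace (𝓡 d) x) := ⟨B.toRiemannianMetric⟩
  exact riemannianEDist_comm

/-- The ball of radius `R` about the identity. -/
def LieRiemannianMetric.ballG (B : LieRiemannianMetric d G) (R : ℝ) : Set G :=
  {g | B.distG g 1 < ENNReal.ofReal R}

/-- Balls of `G ⧸ Γ` are translates of balls of `G` about the identity. -/
lemma LieRiemannianMetric.IsRightInvariant.dist_lt_iff (hB : B.IsRightInvariant) (Γ : Subgroup G)
    (x x₀ : G ⧸ Γ) (R : ℝ) :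
    B.dist Γ x x₀ < ENNReal.ofReal R ↔ ∃ u ∈ B.ballG R, x = u • x₀ := by
  simp only [LieRiemannianMetric.dist, iInf_lt_iff]
  constructor
  · rintro ⟨g, h, rfl, rfl, hlt⟩
    refine ⟨g * h⁻¹, ?_, ?_⟩
    · have := hB.distG_mul_right g h h⁻¹
      rw [mul_inv_cancel] at this
      rwa [LieRiemannianMetric.ballG, mem_ofPred_eq, this]
    · rw [MulAction.Quotient.smul_coe]; simp
  · rintro ⟨u, hu, rfl⟩
    induction x₀ using QuotientGroup.induction_on with
    | H h =>
      refine ⟨u * h, h, rfl, rfl, ?_⟩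
      have := hB.distG_mul_right u 1 h
      rw [one_mul] at this
      rw [this]; exact hu

lemma LieRiemannianMetric.lt_closeness_iff (Γ : Subgroup G) (x x₀ : G ⧸ Γ) (z : ℝ) :
    (z : EReal) < B.closeness Γ x₀ x ↔ B.dist Γ x x₀ < ENNReal.ofReal (Real.exp (-z)) := by
  rw [LieRiemannianMetric.closeness, EReal.lt_neg_comm]
  have h1 : -(z : EReal) = ENNReal.log (ENNReal.ofReal (Real.exp (-z))) := by
    rw [ENNReal.log_ofReal_of_pos (Real.exp_pos _), Real.log_exp]
    simp
  rw [h1, ENNReal.log_lt_log_iff]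

/-- A chart at the identity in which the metric is asymptotically Euclidean. -/
lemma LieRiemannianMetric.exists_chart [T3Space G] (B : LieRiemannianMetric d G) :
    ∃ Ψ : OpenPartialHomeomorph G (EuclideanSpace ℝ (Fin d)), (1 : G) ∈ Ψ.source ∧ Ψ 1 = 0 ∧
      ContMDiffOn (𝓡 d) 𝓘(ℝ, EuclideanSpace ℝ (Fin d)) ∞ Ψ Ψ.source ∧
      ContMDiffOn 𝓘(ℝ, EuclideanSpace ℝ (Fin d)) (𝓡 d) ∞ Ψ.symm Ψ.target ∧
      ∀ r : ℝ, 1 < r → ∃ R₀ > (0 : ℝ), ∀ R, 0 < R → R ≤ R₀ →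
        (∀ u ∈ Ψ.source, r * ‖Ψ u‖ < R → u ∈ B.ballG R) ∧
        (∀ u ∈ B.ballG R, u ∈ Ψ.source ∧ ‖Ψ u‖ < r * R) := by
  let : RiemannianBundle (fun x : G => TangentSpace (𝓡 d) x) := ⟨B.toRiemannianMetric⟩
  have : IsManifold (𝓡 d) 1 G := isManifold_one_of_lieGroup
  have : IsContinuousRiemannianBundle (EuclideanSpace ℝ (Fin d))
      (fun x : G => TangentSpace (𝓡 d) x) := ⟨⟨B.inner, B.contMDiff.continuous, fun b v w => rfl⟩⟩
  -- `T` straightens the inner product at `1` to the standard one, so the chart `Ψ = T (φ - φ 1)`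
  -- measures distances from `1` up to any factor `r > 1`.
  obtain ⟨T, hT⟩ := exists_linear_isometry_tangentSpace (d := d) (1 : G)
  have hT' : ∀ w, ‖(T : EuclideanSpace ℝ (Fin d) →L[ℝ] EuclideanSpace ℝ (Fin d)) w‖ = _ := hT
  let φ := chartAt (EuclideanSpace ℝ (Fin d)) (1 : G)
  let A : EuclideanSpace ℝ (Fin d) ≃ₜ EuclideanSpace ℝ (Fin d) :=
    (Homeomorph.addRight (-(φ 1))).trans T.toHomeomorph
  have hA : ∀ w, A w = T (w - φ 1) := fun w => by simp [A, sub_eq_add_neg]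
  have hAs : ∀ w, A.symm w = T.symm w + φ 1 := fun w => by
    rw [Homeomorph.symm_apply_eq, hA]; simp
  let Ψ := φ.trans A.toOpenPartialHomeomorph
  have hsrc : Ψ.source = φ.source := by simp [Ψ]
  have hΨ : ∀ u, Ψ u = T (φ u - φ 1) := fun u => by simp [Ψ, hA]
  have h1 : (1 : G) ∈ Ψ.source := by rw [hsrc]; exact mem_chart_source _ _
  refine ⟨Ψ, h1, by simp [hΨ], ?_, ?_, fun r hr => ?_⟩
  · have e : ContMDiffOn (𝓡 d) 𝓘(ℝ, EuclideanSpace ℝ (Fin d)) ∞ φ φ.source :=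
      contMDiffOn_chart
    rw [hsrc]
    refine ContMDiffOn.congr (f := (fun w => T (w - φ 1)) ∘ φ) ?_ fun u _ => hΨ u
    refine ContMDiff.comp_contMDiffOn ?_ e
    rw [contMDiff_iff_contDiff]
    exact T.contDiff.comp (contDiff_id.sub contDiff_const)
  · have e : ContMDiffOn 𝓘(ℝ, EuclideanSpace ℝ (Fin d)) (𝓡 d) ∞ φ.symm φ.target :=
      contMDiffOn_chart_symm
    refine ContMDiffOn.congr (f := φ.symm ∘ fun w => T.symm w + φ 1) ?_
      fun w _ => by simp [Ψ, hAs]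
    refine e.comp (s := Ψ.target) ?_ fun w hw => ?_
    · refine ContMDiff.contMDiffOn ?_
      rw [contMDiff_iff_contDiff]
      exact T.symm.contDiff.add contDiff_const
    · simpa [Ψ, hAs] using hw
  · have hlow := eventually_riemannianEDist_le_mul_norm (1 : G) hT' hr
    obtain ⟨R₁, hR₁, hup⟩ := exists_norm_lt_mul_of_riemannianEDist_lt (1 : G) hT' hr
    have hlow' : ∀ᶠ w in 𝓝 (0 : EuclideanSpace ℝ (Fin d)), B.distG 1 (Ψ.symm w) ≤
        ENNReal.ofReal (r * ‖w‖) := by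
      have h2 : Tendsto Ψ.symm (𝓝 0) (𝓝 1) := by
        have := Ψ.symm.continuousAt (x := Ψ 1) (Ψ.map_source h1)
        rw [ContinuousAt, Ψ.left_inv h1] at this
        simpa [hΨ] using this
      have h3 : Ψ.target ∈ 𝓝 (0 : EuclideanSpace ℝ (Fin d)) :=
        Ψ.open_target.mem_nhds (by have := Ψ.map_source h1; simpa [hΨ] using this)
      filter_upwards [h2.eventually hlow, h3] with w hw hwt
      have h4 : T (φ (Ψ.symm w) - φ 1) = w := by rw [← hΨ, Ψ.right_inv hwt]
      have h5 : ‖(T : EuclideanSpace ℝ (Fin d) →L[ℝ] EuclideanSpace ℝ (Fin d))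
          (extChartAt (𝓡 d) (1 : G) (Ψ.symm w) - extChartAt (𝓡 d) (1 : G) 1)‖ = ‖w‖ :=
        congrArg norm h4
      rw [h5] at hw
      exact hw
    obtain ⟨ε, hε, hball⟩ := Metric.eventually_nhds_iff.1 hlow'
    have hr0 : 0 < r := one_pos.trans hr
    refine ⟨min R₁ ε, lt_min hR₁ hε, fun R hR hRle => ⟨fun u hu hlt => ?_, fun u hu => ?_⟩⟩
    · have h6 : ‖Ψ u‖ < ε := by
        have : ‖Ψ u‖ ≤ r * ‖Ψ u‖ := le_mul_of_one_le_left (norm_nonneg _) hr.le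
        exact (this.trans_lt hlt).trans_le (hRle.trans (min_le_right _ _))
      have h7 := hball (y := Ψ u) (by simpa using h6)
      rw [Ψ.left_inv hu, B.distG_comm] at h7
      exact h7.trans_lt ((ENNReal.ofReal_lt_ofReal_iff hR).2 hlt)
    · have hu' : riemannianEDist (𝓡 d) 1 u < ENNReal.ofReal R := by
        have : B.distG 1 u < ENNReal.ofReal R := by rw [B.distG_comm]; exact hu
        exact this
      obtain ⟨h8, h9⟩ := hup R hR (hRle.trans (min_le_left _ _)) u hu'
      rw [extChartAt_source] at h8
      refine ⟨by rw [hsrc]; exact h8, ?_⟩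
      rw [hΨ]
      exact h9

end InvariantMetric


/-! ### Differentiating a measure along images of small balls. -/

section Density

open Metric

variable {d : ℕ}

lemma eventually_approximatesLinearOn_closedBall {h : EuclideanSpace ℝ (Fin d) → EuclideanSpace ℝ (Fin d)} {A : EuclideanSpace ℝ (Fin d) →L[ℝ] EuclideanSpace ℝ (Fin d)}
    (hh : HasStrictFDerivAt h A 0) {c : NNReal} (hc : 0 < c) :
    ∀ᶠ r in 𝓝[>] (0 : ℝ), ApproximatesLinearOn h A (closedBall 0 r) c := by
  obtain ⟨s, hs, h1⟩ := hh.approximates_deriv_on_nhds (Or.inr hc)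
  obtain ⟨ε, hε, h2⟩ := Metric.nhds_basis_closedBall.mem_iff.1 hs
  filter_upwards [Ioc_mem_nhdsGT hε] with r hr
  exact h1.mono_set ((closedBall_subset_closedBall hr.2).trans h2)

lemma volume_closedBall_ne_zero {r : ℝ} (hr : 0 < r) : volume (closedBall (0 : EuclideanSpace ℝ (Fin d)) r) ≠ 0 :=
  (measure_closedBall_pos volume 0 hr).ne'

lemma volume_closedBall_ne_top (r : ℝ) : volume (closedBall (0 : EuclideanSpace ℝ (Fin d)) r) ≠ ⊤ :=
  measure_closedBall_lt_top.ne

/-- On small balls `h` differs from its linear part by an arbitrarily small Lipschitz error, and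
such maps scale volume by nearly `|det A|`. -/
lemma tendsto_volume_image_div {h : EuclideanSpace ℝ (Fin d) → EuclideanSpace ℝ (Fin d)} {A : EuclideanSpace ℝ (Fin d) →L[ℝ] EuclideanSpace ℝ (Fin d)} (hh : HasStrictFDerivAt h A 0) :
    Tendsto (fun r => volume (h '' closedBall 0 r) / volume (closedBall (0 : EuclideanSpace ℝ (Fin d)) r)) (𝓝[>] 0)
      (𝓝 (ENNReal.ofReal |A.det|)) := by
  refine tendsto_order.2 ⟨fun m hm => ?_, fun m hm => ?_⟩
  · obtain ⟨m', hm', hlt⟩ := ENNReal.lt_iff_exists_nnreal_btwn.1 hm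
    have h1 := (mul_le_addHaar_image_of_lt_det volume A hlt).and self_mem_nhdsWithin
    obtain ⟨c, h2, hc⟩ := h1.exists
    filter_upwards [eventually_approximatesLinearOn_closedBall hh hc, self_mem_nhdsWithin]
      with r hr hr0
    refine hm'.trans_le ?_
    rw [ENNReal.le_div_iff_mul_le (Or.inl (volume_closedBall_ne_zero hr0))
      (Or.inl (volume_closedBall_ne_top r))]
    exact h2 _ _ hr
  · obtain ⟨m', hm', hlt⟩ := ENNReal.lt_iff_exists_nnreal_btwn.1 hm
    have h1 := (addHaar_image_le_mul_of_det_lt volume A hm').and self_mem_nhdsWithin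
    obtain ⟨c, h2, hc⟩ := h1.exists
    filter_upwards [eventually_approximatesLinearOn_closedBall hh hc, self_mem_nhdsWithin]
      with r hr hr0
    refine lt_of_le_of_lt ?_ hlt
    rw [ENNReal.div_le_iff (volume_closedBall_ne_zero hr0) (volume_closedBall_ne_top r)]
    exact h2 _ _ hr

lemma volume_closedBall_mul (x : EuclideanSpace ℝ (Fin d)) {r : ℝ} (hr : 0 < r) (c : ℝ) (hc : 0 ≤ c) :
    volume (closedBall x (c * r)) = ENNReal.ofReal (c ^ d) * volume (closedBall (0 : EuclideanSpace ℝ (Fin d)) r) := by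
  rw [Measure.addHaar_closedBall _ _ (by positivity), Measure.addHaar_closedBall _ _ hr.le,
    finrank_euclideanSpace_fin, mul_pow, ENNReal.ofReal_mul (by positivity), mul_assoc]

/-- Almost everywhere differentiation of a measure along the images of small balls under local
diffeomorphisms. -/
lemma ae_tendsto_measure_image_div (ν : Measure (EuclideanSpace ℝ (Fin d))) [IsLocallyFiniteMeasure ν] :
    ∀ᵐ y, ∀ (h : EuclideanSpace ℝ (Fin d) → EuclideanSpace ℝ (Fin d)) (A : EuclideanSpace ℝ (Fin d) ≃L[ℝ] EuclideanSpace ℝ (Fin d)), HasStrictFDerivAt h (A : EuclideanSpace ℝ (Fin d) →L[ℝ] EuclideanSpace ℝ (Fin d)) 0 → h 0 = y →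
      Tendsto (fun r => ν (h '' closedBall 0 r) / volume (closedBall (0 : EuclideanSpace ℝ (Fin d)) r)) (𝓝[>] 0)
        (𝓝 (ν.rnDeriv volume y * ENNReal.ofReal |(A : EuclideanSpace ℝ (Fin d) →L[ℝ] EuclideanSpace ℝ (Fin d)).det|)) := by
  have hV : ∀ n : ℕ, ∀ x : EuclideanSpace ℝ (Fin d), ∃ᶠ r in 𝓝[>] 0, volume (closedBall x (3 * r)) ≤
      ((n + 3 ^ d : NNReal) : ℝ≥0∞) * volume (closedBall x r) := by
    intro n x
    refine Eventually.frequently ?_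
    filter_upwards [self_mem_nhdsWithin] with r hr
    have := volume_closedBall_mul x (r := r) hr 1 zero_le_one
    rw [one_mul] at this
    rw [volume_closedBall_mul x hr 3 (by norm_num), this]
    have e1 : ENNReal.ofReal (3 ^ d) = ((3 ^ d : NNReal) : ℝ≥0∞) := by
      rw [ENNReal.ofReal_pow (by norm_num)]; simp
    simp only [one_pow, ENNReal.ofReal_one, one_mul, e1]
    gcongr
    simp
  -- Intersecting over countably many constants gives one null set valid for all `h` and `A`, hence
  -- later for all group elements at once.
  have hae := ae_all_iff.2 fun n : ℕ =>
    (Vitali.vitaliFamily volume (n + 3 ^ d) (hV n)).ae_tendsto_rnDeriv ν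
  filter_upwards [hae, Measure.rnDeriv_lt_top ν volume] with y hy hfin h A hh hhy
  have hvol := tendsto_volume_image_div hh
  have hdet : (A : EuclideanSpace ℝ (Fin d) →L[ℝ] EuclideanSpace ℝ (Fin d)).det ≠ 0 :=
    (LinearEquiv.isUnit_det' A.toLinearEquiv).ne_zero
  set D := |(A : EuclideanSpace ℝ (Fin d) →L[ℝ] EuclideanSpace ℝ (Fin d)).det| with hD
  have hDpos : 0 < D := abs_pos.2 hdet
  set C : ℝ := ‖(A : EuclideanSpace ℝ (Fin d) →L[ℝ] EuclideanSpace ℝ (Fin d))‖ + 1 with hC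
  have hCpos : 0 < C := by positivity
  -- The image of the ball of radius `r` lies in a ball of radius `C r` and has at least `D / 2`
  -- times the volume of the original ball, so this `n` makes it admissible in the `n`-th Vitali
  -- family.
  obtain ⟨n, hn⟩ := exists_nat_ge ((3 * C) ^ d / (D / 2))
  have hsub : ∀ᶠ r in 𝓝[>] (0 : ℝ), ContinuousOn h (closedBall 0 r) ∧
      h '' closedBall 0 r ⊆ closedBall y (C * r) := by
    filter_upwards [eventually_approximatesLinearOn_closedBall hh one_pos, self_mem_nhdsWithin]
      with r hr hr0
    refine ⟨hr.continuousOn, ?_⟩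
    rintro _ ⟨z, hz, rfl⟩
    have h1 := hr z hz 0 (mem_closedBall_self hr0.le)
    rw [sub_zero, hhy] at h1
    rw [mem_closedBall, dist_eq_norm] at hz ⊢
    rw [sub_zero] at hz
    calc ‖h z - y‖ ≤ ‖h z - y - A z‖ + ‖A z‖ := norm_le_norm_sub_add _ _
      _ ≤ 1 * ‖z‖ + ‖(A : EuclideanSpace ℝ (Fin d) →L[ℝ] EuclideanSpace ℝ (Fin d))‖ * ‖z‖ :=
        add_le_add (by simpa using h1) ((A : EuclideanSpace ℝ (Fin d) →L[ℝ] EuclideanSpace ℝ (Fin d)).le_opNorm z)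
      _ = C * ‖z‖ := by rw [hC]; ring
      _ ≤ C * r := by gcongr
  have hlow : ∀ᶠ r in 𝓝[>] (0 : ℝ), ENNReal.ofReal (D / 2) * volume (closedBall (0 : EuclideanSpace ℝ (Fin d)) r) ≤
      volume (h '' closedBall 0 r) := by
    have h1 : ENNReal.ofReal (D / 2) < ENNReal.ofReal D :=
      (ENNReal.ofReal_lt_ofReal_iff hDpos).2 (by linarith)
    filter_upwards [hvol.eventually (lt_mem_nhds h1), self_mem_nhdsWithin] with r hr hr0
    exact (ENNReal.le_div_iff_mul_le (Or.inl (volume_closedBall_ne_zero hr0))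
      (Or.inl (volume_closedBall_ne_top r))).1 hr.le
  have hmem : Tendsto (fun r => h '' closedBall 0 r) (𝓝[>] 0)
      ((Vitali.vitaliFamily volume (n + 3 ^ d) (hV n)).filterAt y) := by
    refine (VitaliFamily.tendsto_filterAt_iff _).2 ⟨?_, fun ε hε => ?_⟩
    · filter_upwards [hsub, hlow, self_mem_nhdsWithin] with r hr hr2 hr0
      refine ⟨((isCompact_closedBall _ _).image_of_continuousOn hr.1).isClosed, ?_, C * r, hr.2, ?_⟩
      · refine ⟨y, ?_⟩
        rw [mem_interior_iff_mem_nhds, ← hhy, ← hh.map_nhds_eq_of_equiv]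
        exact image_mem_map (closedBall_mem_nhds _ hr0)
      · rw [← mul_assoc, volume_closedBall_mul y hr0 _ (by positivity)]
        refine le_trans ?_ (mul_le_mul_right hr2 _)
        rw [← mul_assoc]
        gcongr
        rw [← ENNReal.ofReal_coe_nnreal, ← ENNReal.ofReal_mul (by positivity)]
        refine ENNReal.ofReal_le_ofReal ?_
        rw [div_le_iff₀ (by positivity)] at hn
        refine hn.trans ?_
        gcongr
        push_cast
        have : (0 : ℝ) ≤ 3 ^ d := by positivity
        linarith
    · have : Tendsto (fun r => C * r) (𝓝[>] 0) (𝓝 0) := by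
        have : Tendsto (fun r => C * r) (𝓝 0) (𝓝 (C * 0)) := (continuous_const_mul C).tendsto 0
        rw [mul_zero] at this
        exact this.mono_left nhdsWithin_le_nhds
      filter_upwards [hsub, this.eventually (gt_mem_nhds hε)] with r hr hr2
      exact hr.2.trans (closedBall_subset_closedBall hr2.le)
  have hlim := ENNReal.Tendsto.mul ((hy n).comp hmem)
    (Or.inr ENNReal.ofReal_ne_top) hvol (Or.inr hfin.ne)
  refine hlim.congr' ?_
  filter_upwards [hlow, self_mem_nhdsWithin, hsub] with r hr hr0 hr3
  have h0 : volume (h '' closedBall 0 r) ≠ 0 := by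
    refine (lt_of_lt_of_le ?_ hr).ne'
    exact ENNReal.mul_pos (by simpa using hDpos) (volume_closedBall_ne_zero hr0)
  have ht : volume (h '' closedBall 0 r) ≠ ⊤ :=
    ((measure_mono hr3.2).trans_lt measure_closedBall_lt_top).ne
  simp only [Function.comp]
  rw [ENNReal.div_eq_inv_mul, ENNReal.div_eq_inv_mul, ENNReal.div_eq_inv_mul,
    mul_comm _ (ν _), mul_assoc, ← mul_assoc _ _ (volume (h '' _)), mul_comm _ (volume (closedBall _ _))⁻¹,
    mul_assoc, ENNReal.inv_mul_cancel h0 ht, mul_one, mul_comm]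

end Density


/-! ### Translations and conjugations in a chart at the identity. -/

section ChartAtOne

set_option linter.unusedSectionVars false

variable {d : ℕ}

/-- A smooth local left inverse makes the derivative injective, hence invertible in finite
dimension. -/
lemma exists_equiv_hasStrictFDerivAt {f k : EuclideanSpace ℝ (Fin d) → EuclideanSpace ℝ (Fin d)} {z : EuclideanSpace ℝ (Fin d)} (hf : ContDiffAt ℝ ∞ f z)
    (hk : ContDiffAt ℝ ∞ k (f z)) (h : ∀ᶠ x in 𝓝 z, k (f x) = x) :
    ∃ A : EuclideanSpace ℝ (Fin d) ≃L[ℝ] EuclideanSpace ℝ (Fin d), HasStrictFDerivAt f (A : _ →L[ℝ] EuclideanSpace ℝ (Fin d)) z := by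
  have h1 := hf.hasStrictFDerivAt (by simp)
  have h2 := hk.hasStrictFDerivAt (by simp)
  have h3 : (fderiv ℝ k (f z)).comp (fderiv ℝ f z) = ContinuousLinearMap.id ℝ (EuclideanSpace ℝ (Fin d)) :=
    HasFDerivAt.unique (h2.hasFDerivAt.comp z h1.hasFDerivAt)
      ((hasFDerivAt_id z).congr_of_eventuallyEq h)
  have hinj : Function.Injective (fderiv ℝ f z : EuclideanSpace ℝ (Fin d) →ₗ[ℝ] EuclideanSpace ℝ (Fin d)) := fun a b hab => by
    have := congr($h3 a)
    have h4 := congr($h3 b)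
    simp only [ContinuousLinearMap.comp_apply, ContinuousLinearMap.id_apply] at this h4
    rw [← this, ← h4]
    exact congrArg _ hab
  refine ⟨(LinearEquiv.ofInjectiveEndo _ hinj).toContinuousLinearEquiv, ?_⟩
  have h4 : ((LinearEquiv.ofInjectiveEndo _ hinj).toContinuousLinearEquiv :
      EuclideanSpace ℝ (Fin d) →L[ℝ] EuclideanSpace ℝ (Fin d)) = fderiv ℝ f z := by
    ext1 x; rfl
  rw [h4]; exact h1

variable {G : Type*} [TopologicalSpace G] [ChartedSpace (EuclideanSpace ℝ (Fin d)) G]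
  [Group G]

/-- A smooth chart of a Lie group, sending the identity to `0`. -/
structure IsSmoothChartAtOne (Ψ : OpenPartialHomeomorph G (EuclideanSpace ℝ (Fin d))) : Prop where
  one_mem : (1 : G) ∈ Ψ.source
  map_one : Ψ 1 = 0
  smooth : ContMDiffOn (𝓡 d) 𝓘(ℝ, EuclideanSpace ℝ (Fin d)) ∞ Ψ Ψ.source
  smooth_symm : ContMDiffOn 𝓘(ℝ, EuclideanSpace ℝ (Fin d)) (𝓡 d) ∞ Ψ.symm Ψ.target

namespace IsSmoothChartAtOne

variable {Ψ : OpenPartialHomeomorph G (EuclideanSpace ℝ (Fin d))}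

lemma zero_mem (hΨ : IsSmoothChartAtOne Ψ) : (0 : EuclideanSpace ℝ (Fin d)) ∈ Ψ.target := hΨ.map_one ▸ Ψ.map_source hΨ.one_mem

lemma symm_zero (hΨ : IsSmoothChartAtOne Ψ) : Ψ.symm 0 = 1 := by rw [← hΨ.map_one, Ψ.left_inv hΨ.one_mem]

variable [LieGroup (𝓡 d) ∞ G]

lemma contDiffAt_mul (hΨ : IsSmoothChartAtOne Ψ) (g u : G) {z : EuclideanSpace ℝ (Fin d)} (hz : z ∈ Ψ.target) (h : g * Ψ.symm z * u ∈ Ψ.source) :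
    ContDiffAt ℝ ∞ (fun z => Ψ (g * Ψ.symm z * u)) z := by
  have h1 := hΨ.smooth_symm.contMDiffAt (Ψ.open_target.mem_nhds hz)
  have h2 := hΨ.smooth.contMDiffAt (Ψ.open_source.mem_nhds h)
  have h3 : ContMDiffAt (𝓡 d) (𝓡 d) ∞ (fun x : G => g * x * u) (Ψ.symm z) :=
    ((contMDiff_mul_right (I := 𝓡 d) (a := u)).comp
      (contMDiff_mul_left (I := 𝓡 d) (a := g))).contMDiffAt
  rw [← contMDiffAt_iff_contDiffAt]
  exact ContMDiffAt.comp z h2 (h3.comp z h1)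

lemma eventually_mul_mem (g u : G) {z : EuclideanSpace ℝ (Fin d)} (hz : z ∈ Ψ.target)
    (h : g * Ψ.symm z * u ∈ Ψ.source) : ∀ᶠ x in 𝓝 z, g * Ψ.symm x * u ∈ Ψ.source := by
  have := topologicalGroup_of_lieGroup (𝓡 d) ∞ (G := G)
  have h1 : ContinuousAt (fun x => g * Ψ.symm x * u) z :=
    (continuousAt_const.mul (Ψ.symm.continuousAt hz)).mul continuousAt_const
  exact h1.eventually (Ψ.open_source.mem_nhds h)

lemma exists_equiv_mul (hΨ : IsSmoothChartAtOne Ψ) (g u : G) {z : EuclideanSpace ℝ (Fin d)} (hz : z ∈ Ψ.target) (h : g * Ψ.symm z * u ∈ Ψ.source) :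
    ∃ A : EuclideanSpace ℝ (Fin d) ≃L[ℝ] EuclideanSpace ℝ (Fin d), HasStrictFDerivAt (fun z => Ψ (g * Ψ.symm z * u)) (A : _ →L[ℝ] EuclideanSpace ℝ (Fin d)) z := by
  refine exists_equiv_hasStrictFDerivAt (k := fun y => Ψ (g⁻¹ * Ψ.symm y * u⁻¹))
    (hΨ.contDiffAt_mul g u hz h) (hΨ.contDiffAt_mul _ _ (Ψ.map_source h) ?_) ?_
  · rw [Ψ.left_inv h]
    simpa [mul_assoc] using Ψ.map_target hz
  · filter_upwards [eventually_mul_mem g u hz h, Ψ.open_target.mem_nhds hz] with x hx hxt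
    rw [Ψ.left_inv hx]
    simpa [mul_assoc] using Ψ.right_inv hxt

end IsSmoothChartAtOne

/-- The absolute value of the determinant of `Ad g⁻¹`, computed in a chart. -/
noncomputable def conjJacobian (Ψ : OpenPartialHomeomorph G (EuclideanSpace ℝ (Fin d))) (g : G) : ℝ :=
  |(fderiv ℝ (fun z : EuclideanSpace ℝ (Fin d) => Ψ (g⁻¹ * Ψ.symm z * g)) 0).det|

namespace IsSmoothChartAtOne

variable {Ψ : OpenPartialHomeomorph G (EuclideanSpace ℝ (Fin d))} [LieGroup (𝓡 d) ∞ G]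

lemma exists_equiv_conj (hΨ : IsSmoothChartAtOne Ψ) (g : G) :
    ∃ A : EuclideanSpace ℝ (Fin d) ≃L[ℝ] EuclideanSpace ℝ (Fin d), HasStrictFDerivAt (fun z => Ψ (g⁻¹ * Ψ.symm z * g)) (A : _ →L[ℝ] EuclideanSpace ℝ (Fin d)) 0 :=
  hΨ.exists_equiv_mul _ _ hΨ.zero_mem (by simpa [hΨ.symm_zero] using hΨ.one_mem)

lemma conjJacobian_pos (hΨ : IsSmoothChartAtOne Ψ) (g : G) : 0 < conjJacobian Ψ g := by
  obtain ⟨A, hA⟩ := hΨ.exists_equiv_conj g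
  rw [conjJacobian, hA.hasFDerivAt.fderiv]
  exact abs_pos.2 (LinearEquiv.isUnit_det' A.toLinearEquiv).ne_zero

/-- The chain rule for `z ↦ g⁻¹ z g u` in a chart. -/
lemma fderiv_conj_mul (hΨ : IsSmoothChartAtOne Ψ) (g u : G) (hu : u ∈ Ψ.source):
    fderiv ℝ (fun z => Ψ (g⁻¹ * Ψ.symm z * (g * u))) 0 =
      (fderiv ℝ (fun z => Ψ (1 * Ψ.symm z * u)) 0).comp
        (fderiv ℝ (fun z => Ψ (g⁻¹ * Ψ.symm z * g)) 0) := by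
  have h0 : Ψ (g⁻¹ * Ψ.symm 0 * g) = 0 := by simp [hΨ.symm_zero, hΨ.map_one]
  have h1 : DifferentiableAt ℝ (fun z => Ψ (1 * Ψ.symm z * u)) (Ψ (g⁻¹ * Ψ.symm 0 * g)) := by
    rw [h0]
    exact (hΨ.contDiffAt_mul _ _ hΨ.zero_mem (by simpa [hΨ.symm_zero] using hu)).differentiableAt
      (by simp)
  have hm : g⁻¹ * Ψ.symm 0 * g ∈ Ψ.source := by simpa [hΨ.symm_zero] using hΨ.one_mem
  have h2 : DifferentiableAt ℝ (fun z => Ψ (g⁻¹ * Ψ.symm z * g)) 0 :=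
    (hΨ.contDiffAt_mul _ _ hΨ.zero_mem hm).differentiableAt (by simp)
  have h3 := fderiv_comp 0 h1 h2
  rw [h0] at h3
  rw [← h3]
  refine Filter.EventuallyEq.fderiv_eq ?_
  filter_upwards [eventually_mul_mem _ _ hΨ.zero_mem hm] with z hz
  simp only [Function.comp]
  rw [Ψ.left_inv hz]
  simp [mul_assoc]

/-- Chain rule at the common fixed point `0` of the conjugations. Together with positivity it makes
`conjJacobian` a character of `G`. -/
lemma conjJacobian_mul (hΨ : IsSmoothChartAtOne Ψ) (g h : G) :
    conjJacobian Ψ (g * h) = conjJacobian Ψ g * conjJacobian Ψ h := by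
  have hm : ∀ g : G, g⁻¹ * Ψ.symm 0 * g ∈ Ψ.source := fun g => by
    simpa [hΨ.symm_zero] using hΨ.one_mem
  have hd : ∀ g : G, DifferentiableAt ℝ (fun z => Ψ (g⁻¹ * Ψ.symm z * g)) 0 := fun g =>
    (hΨ.contDiffAt_mul _ _ hΨ.zero_mem (hm g)).differentiableAt (by simp)
  have h0 : Ψ (g⁻¹ * Ψ.symm 0 * g) = 0 := by simp [hΨ.symm_zero, hΨ.map_one]
  have h3 := fderiv_comp (g := fun z => Ψ (h⁻¹ * Ψ.symm z * h)) 0 (by rw [h0]; exact hd h) (hd g)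
  rw [h0] at h3
  have h4 : fderiv ℝ (fun z => Ψ ((g * h)⁻¹ * Ψ.symm z * (g * h))) 0 = _ :=
    Eq.trans (Filter.EventuallyEq.fderiv_eq ?_) h3
  · rw [conjJacobian, h4, ContinuousLinearMap.det, ContinuousLinearMap.toLinearMap_comp,
      LinearMap.det_comp, abs_mul, mul_comm]
    rfl
  · filter_upwards [eventually_mul_mem _ _ hΨ.zero_mem (hm g)] with z hz
    simp only [Function.comp]
    rw [Ψ.left_inv hz]
    simp [mul_assoc]

end IsSmoothChartAtOne

end ChartAtOne


/-! ### Local injectivity of orbits, measurability, and invariance. -/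

section QuotientTopology

variable {G : Type*} [TopologicalSpace G] [Group G] [IsTopologicalGroup G] {Γ : Subgroup G}

/-- If `u g₀` and `v g₀` have the same class then `g₀⁻¹ u⁻¹ v g₀ ∈ Γ`; for `u, v` near `1` this
element is near `1`, hence equal to `1` by discreteness. -/
lemma exists_isOpen_injOn_smul [DiscreteTopology Γ] (x₀ : G ⧸ Γ) :
    ∃ U : Set G, IsOpen U ∧ 1 ∈ U ∧ InjOn (fun u : G => u • x₀) U := by
  induction x₀ using QuotientGroup.induction_on with
  | H g₀ =>
    obtain ⟨V, hV, hVΓ⟩ : ∃ V ∈ 𝓝 (1 : G), ∀ g ∈ V, g ∈ Γ → g = 1 := by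
      have h1 : ({1} : Set Γ) ∈ 𝓝 (1 : Γ) := (isOpen_discrete _).mem_nhds rfl
      rw [nhds_induced, mem_comap] at h1
      obtain ⟨V, hV, h2⟩ := h1
      exact ⟨V, hV, fun g hg hgΓ => congrArg Subtype.val (h2 (show (⟨g, hgΓ⟩ : Γ) ∈ _ from hg))⟩
    have hc : Continuous fun p : G × G => g₀⁻¹ * p.1⁻¹ * p.2 * g₀ := by fun_prop
    have h2 : (fun p : G × G => g₀⁻¹ * p.1⁻¹ * p.2 * g₀) ⁻¹' V ∈ 𝓝 ((1 : G), (1 : G)) := by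
      refine hc.continuousAt ?_
      simpa using hV
    rw [nhds_prod_eq, mem_prod_same_iff] at h2
    obtain ⟨W, hW, hWV⟩ := h2
    obtain ⟨U, hUW, hU, h1U⟩ := mem_nhds_iff.1 hW
    refine ⟨U, hU, h1U, fun u hu v hv huv => ?_⟩
    have h3 : ((u * g₀ : G) : G ⧸ Γ) = ((v * g₀ : G) : G ⧸ Γ) := huv
    rw [QuotientGroup.eq] at h3
    have h4 := hVΓ _ (hWV (mk_mem_prod (hUW hu) (hUW hv)))
      (by simpa [mul_assoc] using h3)
    have h5 : u⁻¹ * v = 1 := by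
      have := congrArg (fun t => g₀ * t * g₀⁻¹) h4
      simpa [mul_assoc] using this
    exact inv_mul_eq_one.1 h5

lemma isOpenMap_smul_quotient (x₀ : G ⧸ Γ) : IsOpenMap fun u : G => u • x₀ := by
  induction x₀ using QuotientGroup.induction_on with
  | H g₀ => exact QuotientGroup.isOpenMap_coe.comp (isOpenMap_mul_right g₀)

/-- Upstairs this is the union over `γ ∈ Γ` of the open sets `h γ g⁻¹ ∈ S`, and the quotient map is
open. Its sections are the sets `S • x`, whose measures are therefore measurable in `x`. -/
lemma isOpen_setOf_mem_smul {S : Set G} (hS : IsOpen S) :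
    IsOpen {p : (G ⧸ Γ) × (G ⧸ Γ) | ∃ s ∈ S, p.2 = s • p.1} := by
  have h1 : IsOpen {p : G × G | ∃ s ∈ S, ((p.2 : G) : G ⧸ Γ) = s • ((p.1 : G) : G ⧸ Γ)} := by
    have : {p : G × G | ∃ s ∈ S, ((p.2 : G) : G ⧸ Γ) = s • ((p.1 : G) : G ⧸ Γ)} =
        ⋃ γ : Γ, (fun p : G × G => p.2 * (γ : G) * p.1⁻¹) ⁻¹' S := by
      ext ⟨g, h⟩
      simp only [mem_ofPred_eq, mem_iUnion, mem_preimage]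
      constructor
      · rintro ⟨s, hs, he⟩
        have he' : ((h : G) : G ⧸ Γ) = ((s * g : G) : G ⧸ Γ) := he
        rw [QuotientGroup.eq] at he'
        exact ⟨⟨_, he'⟩, by simpa [mul_assoc] using hs⟩
      · rintro ⟨γ, hγ⟩
        refine ⟨_, hγ, ?_⟩
        rw [MulAction.Quotient.smul_coe, smul_eq_mul, QuotientGroup.eq]
        simp [mul_assoc]
    rw [this]
    exact isOpen_iUnion fun γ => hS.preimage (by fun_prop)
  have h2 := ((QuotientGroup.isOpenMap_coe (N := Γ)).prodMap
    (QuotientGroup.isOpenMap_coe (N := Γ))) _ h1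
  convert h2 using 1
  ext ⟨x, y⟩
  induction x using QuotientGroup.induction_on with
  | H g =>
    induction y using QuotientGroup.induction_on with
    | H h =>
      constructor
      · rintro ⟨s, hs, he⟩
        exact ⟨(g, h), ⟨s, hs, he⟩, rfl⟩
      · rintro ⟨⟨g', h'⟩, ⟨s, hs, he⟩, heq⟩
        obtain ⟨h1, h2⟩ := Prod.mk.inj heq
        refine ⟨s, hs, ?_⟩
        simp only at he h1 h2 ⊢
        rw [← h1, ← h2]
        exact he

lemma measurable_measure_smul [SecondCountableTopology G] [MeasurableSpace (G ⧸ Γ)]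
    [BorelSpace (G ⧸ Γ)] (μ : Measure (G ⧸ Γ)) [IsProbabilityMeasure μ] {S : Set G}
    (hS : IsOpen S) : Measurable fun x : G ⧸ Γ => μ ((fun s : G => s • x) '' S) := by
  have h1 : MeasurableSet {p : (G ⧸ Γ) × (G ⧸ Γ) | ∃ s ∈ S, p.2 = s • p.1} :=
    (isOpen_setOf_mem_smul hS).measurableSet
  have h2 := measurable_measure_prodMk_left (ν := μ) h1
  convert h2 using 4 with x
  ext y
  simp [eq_comm]

/-- A probability measure which is invariant under `g` gives no room to a positive function which
`g` multiplies by a constant, unless the constant is `1`. -/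
lemma one_le_of_comp_eq_mul {X : Type*} [MeasurableSpace X] {μ : Measure X}
    [IsProbabilityMeasure μ] {T : X → X} (hT : MeasurePreserving T μ μ) {w : X → ℝ}
    (hw : Measurable w) (hpos : ∀ x, 0 < w x) {κ : ℝ} (hκ : 0 < κ) (h : ∀ x, w (T x) = κ * w x) :
    1 ≤ κ := by
  by_contra! hlt
  -- Since `w` need not be integrable, the bounded, strictly increasing transform `w / (1 + w)` is
  -- used: its integral is invariant, but would strictly decrease if `κ < 1`.
  have hint : ∀ v : X → ℝ, Measurable v → (∀ x, 0 < v x) → Integrable (fun x => v x / (1 + v x)) μ := by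
    intro v hv hv0
    refine Integrable.of_bound (C := 1) ((hv.div (measurable_const.add hv)).aestronglyMeasurable) ?_
    refine Eventually.of_forall fun x => ?_
    have := hv0 x
    rw [Real.norm_of_nonneg (by positivity), div_le_one (by positivity)]
    linarith
  have hint1 := hint w hw hpos
  have hκw : ∀ x, 0 < κ * w x := fun x => mul_pos hκ (hpos x)
  have hint2 := hint (fun x => κ * w x) (hw.const_mul κ) hκw
  have h1 : ∫ x, w (T x) / (1 + w (T x)) ∂μ = ∫ x, w x / (1 + w x) ∂μ := by
    rw [← integral_map (f := fun x => w x / (1 + w x)) hT.aemeasurable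
      (by rw [hT.map_eq]; exact hint1.aestronglyMeasurable), hT.map_eq]
  simp_rw [h] at h1
  have hlt' : ∀ x, 0 < w x / (1 + w x) - κ * w x / (1 + κ * w x) := by
    intro x
    have h2 := hpos x
    have h3 := hκw x
    rw [sub_pos, div_lt_div_iff₀ (by positivity) (by positivity)]
    nlinarith
  have h4 : 0 < ∫ x, (w x / (1 + w x) - κ * w x / (1 + κ * w x)) ∂μ := by
    rw [integral_pos_iff_support_of_nonneg (fun x => (hlt' x).le) (hint1.sub hint2)]
    have : Function.support (fun x => w x / (1 + w x) - κ * w x / (1 + κ * w x)) = univ :=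
      eq_univ_of_forall fun x => (hlt' x).ne'
    rw [this]
    simp
  rw [integral_sub hint1 hint2, h1, sub_self] at h4
  exact lt_irrefl _ h4

end QuotientTopology

/-- Dilating the argument by `c` multiplies the limit by `c ^ d`, and `c` can be taken arbitrarily
close to `1`. -/
lemma tendsto_div_pow_of_sandwich {d : ℕ} {f m : ℝ → ℝ} {w : ℝ}
    (hf : Tendsto (fun R => f R / R ^ d) (𝓝[>] 0) (𝓝 w))
    (h : ∀ r : ℝ, 1 < r → ∀ᶠ R in 𝓝[>] (0 : ℝ), f (R / r) ≤ m R ∧ m R ≤ f (r * R)) :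
    Tendsto (fun R => m R / R ^ d) (𝓝[>] 0) (𝓝 w) := by
  have hscale : ∀ c : ℝ, 0 < c →
      Tendsto (fun R => f (c * R) / R ^ d) (𝓝[>] 0) (𝓝 (c ^ d * w)) := by
    intro c hc
    have h1 : Tendsto (fun R => c * R) (𝓝[>] 0) (𝓝[>] 0) := by
      refine tendsto_nhdsWithin_iff.2 ⟨?_, ?_⟩
      · have : Tendsto (fun R => c * R) (𝓝 0) (𝓝 (c * 0)) := (continuous_const_mul c).tendsto 0
        rw [mul_zero] at this
        exact this.mono_left nhdsWithin_le_nhds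
      · filter_upwards [self_mem_nhdsWithin] with R hR using mul_pos hc hR
    refine ((hf.comp h1).const_mul (c ^ d)).congr' ?_
    filter_upwards [self_mem_nhdsWithin] with R hR
    have hR0 : R ≠ 0 := ne_of_gt hR
    simp only [Function.comp]
    rw [mul_pow]
    field_simp
  have hlim : Tendsto (fun r : ℝ => r ^ d * w) (𝓝 1) (𝓝 w) := by
    have : Continuous fun r : ℝ => r ^ d * w := by fun_prop
    simpa using this.tendsto 1
  refine tendsto_order.2 ⟨fun a ha => ?_, fun a ha => ?_⟩
  · obtain ⟨c, hc1, hc0, hc⟩ : ∃ c : ℝ, a < c ^ d * w ∧ 0 < c ∧ c < 1 := by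
      have h1 := (hlim.mono_left (nhdsWithin_le_nhds (s := Iio 1))).eventually (lt_mem_nhds ha)
      have h2 : ∀ᶠ c : ℝ in 𝓝[<] 1, 0 < c :=
        nhdsWithin_le_nhds (lt_mem_nhds one_pos)
      obtain ⟨c, hc⟩ := (h1.and (h2.and self_mem_nhdsWithin)).exists
      exact ⟨c, hc.1, hc.2.1, hc.2.2⟩
    filter_upwards [(hscale c hc0).eventually (lt_mem_nhds hc1), h c⁻¹ ((one_lt_inv₀ hc0).2 hc),
      self_mem_nhdsWithin] with R h1 h2 hR
    have hR0 : (0 : ℝ) < R := hR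
    refine h1.trans_le ?_
    have := h2.1
    rw [div_inv_eq_mul, mul_comm R c] at this
    gcongr
  · obtain ⟨c, hc1, hc⟩ : ∃ c : ℝ, c ^ d * w < a ∧ 1 < c := by
      have h1 := (hlim.mono_left (nhdsWithin_le_nhds (s := Ioi 1))).eventually (gt_mem_nhds ha)
      obtain ⟨c, hc⟩ := (h1.and self_mem_nhdsWithin).exists
      exact ⟨c, hc.1, hc.2⟩
    filter_upwards [(hscale c (one_pos.trans hc)).eventually (gt_mem_nhds hc1), h c hc,
      self_mem_nhdsWithin] with R h1 h2 hR
    have hR0 : (0 : ℝ) < R := hR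
    refine lt_of_le_of_lt ?_ h1
    have := h2.2
    gcongr

/-! ### An invariant probability measure has the same density everywhere. -/

section InvariantDensity

set_option linter.unusedSectionVars false

open Metric
open scoped Pointwise

variable {d : ℕ} {G : Type*} [TopologicalSpace G] [ChartedSpace (EuclideanSpace ℝ (Fin d)) G]
  [Group G] {Ψ : OpenPartialHomeomorph G (EuclideanSpace ℝ (Fin d))} {Γ : Subgroup G}

/-- The pullback of a measure on `G ⧸ Γ` to a chart. -/
lemma exists_measure_chart [IsTopologicalGroup G] [MeasurableSpace (G ⧸ Γ)] [BorelSpace (G ⧸ Γ)]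
    (μ : Measure (G ⧸ Γ)) [IsProbabilityMeasure μ] (x₀ : G ⧸ Γ)
    {O : Set (EuclideanSpace ℝ (Fin d))} (hO : IsOpen O) (hOt : O ⊆ Ψ.target)
    (hinj : InjOn (fun y => Ψ.symm y • x₀) O) :
    ∃ ν : Measure (EuclideanSpace ℝ (Fin d)), IsFiniteMeasure ν ∧ ∀ A ⊆ O, MeasurableSet A →
      ν A = μ ((fun y => Ψ.symm y • x₀) '' A) := by
  let j : O → G ⧸ Γ := fun y => Ψ.symm y • x₀
  have hcont : Continuous j := by
    have h1 : ContinuousOn Ψ.symm O := Ψ.symm.continuousOn.mono hOt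
    have h2 : Continuous fun y : O => Ψ.symm y := continuousOn_iff_continuous_domRestrict.1 h1
    exact h2.smul continuous_const
  have hopen : IsOpenMap j := by
    intro A hA
    have h1 : IsOpen (Ψ.symm '' (Subtype.val '' A)) :=
      Ψ.symm.isOpen_image_of_subset_source (hO.isOpenMap_subtype_val A hA)
        (by rintro _ ⟨y, _, rfl⟩; exact hOt y.2)
    have h2 := isOpenMap_smul_quotient x₀ _ h1
    rwa [image_image, image_image] at h2
  have hj : MeasurableEmbedding j :=
    (IsOpenEmbedding.of_continuous_injective_isOpenMap hcont
      (fun a b hab => Subtype.ext (hinj a.2 b.2 hab)) hopen).measurableEmbedding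
  refine ⟨(μ.comap j).map Subtype.val, ?_, fun A hA hAm => ?_⟩
  · have : IsFiniteMeasure (μ.comap j) := ⟨by
      rw [hj.comap_apply]; exact measure_lt_top _ _⟩
    infer_instance
  · rw [Measure.map_apply measurable_subtype_coe hAm, hj.comap_apply]
    congr 1
    ext x
    constructor
    · rintro ⟨y, hy, rfl⟩
      exact ⟨y, hy, rfl⟩
    · rintro ⟨y, hy, rfl⟩
      exact ⟨⟨y, hA hy⟩, hy, rfl⟩

variable [LieGroup (𝓡 d) ∞ G] [DiscreteTopology Γ]

lemma IsSmoothChartAtOne.exists_isOpen_injOn (hΨ : IsSmoothChartAtOne Ψ) (x₀ : G ⧸ Γ) :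
    ∃ O : Set (EuclideanSpace ℝ (Fin d)), IsOpen O ∧ 0 ∈ O ∧ O ⊆ Ψ.target ∧
      InjOn (fun y => Ψ.symm y • x₀) O := by
  have := topologicalGroup_of_lieGroup (𝓡 d) ∞ (G := G)
  obtain ⟨U, hU, h1U, hinj⟩ := exists_isOpen_injOn_smul x₀
  refine ⟨Ψ.target ∩ Ψ.symm ⁻¹' U, Ψ.symm.isOpen_inter_preimage hU,
    ⟨hΨ.zero_mem, by simpa [hΨ.symm_zero] using h1U⟩, inter_subset_left, ?_⟩
  intro y hy z hz hyz
  have := hinj hy.2 hz.2 hyz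
  exact Ψ.symm.injOn hy.1 hz.1 this

variable [MeasurableSpace (G ⧸ Γ)] [BorelSpace (G ⧸ Γ)]
  {μ : Measure (G ⧸ Γ)} [IsProbabilityMeasure μ] [SMulInvariantMeasure G (G ⧸ Γ) μ]

/-- Take `x₁ = u • x₀` at a differentiation point of the pulled-back measure. Translating a chart
ball about `g • x₁` by `g⁻¹` keeps its measure and turns it into the image of a Euclidean ball under
`z ↦ Ψ (g⁻¹ Ψ⁻¹(z) g u)`, whose Jacobian at `0` is a constant times `conjJacobian Ψ g`. One point
serves all `g` because the null set does not depend on the map. -/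
lemma IsSmoothChartAtOne.exists_tendsto_measure_closedBall (hΨ : IsSmoothChartAtOne Ψ)
    (x₀ : G ⧸ Γ) : ∃ x₁ : G ⧸ Γ, ∃ c : ℝ≥0∞, c ≠ ⊤ ∧ ∀ g : G,
      Tendsto (fun r => μ ((fun z => Ψ.symm z • g • x₁) '' closedBall 0 r) /
        volume (closedBall (0 : EuclideanSpace ℝ (Fin d)) r)) (𝓝[>] 0)
        (𝓝 (c * ENNReal.ofReal (conjJacobian Ψ g))) := by
  have := topologicalGroup_of_lieGroup (𝓡 d) ∞ (G := G)
  obtain ⟨O, hO, h0O, hOt, hinj⟩ := hΨ.exists_isOpen_injOn x₀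
  obtain ⟨ν, hν, hνμ⟩ := exists_measure_chart μ x₀ hO hOt hinj
  have hne : (ae (volume.restrict O)).NeBot :=
    ae_restrict_neBot.2 (hO.measure_pos volume ⟨0, h0O⟩).ne'
  obtain ⟨y, ⟨hy, hfin⟩, hyO⟩ := ((ae_restrict_of_ae ((ae_tendsto_measure_image_div ν).and
    (Measure.rnDeriv_lt_top ν volume))).and (ae_restrict_mem hO.measurableSet)).exists
  set u := Ψ.symm y with hu
  have hus : u ∈ Ψ.source := Ψ.map_target (hOt hyO)
  refine ⟨u • x₀, ν.rnDeriv volume y *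
    ENNReal.ofReal |(fderiv ℝ (fun z => Ψ (1 * Ψ.symm z * u)) 0).det|,
    ENNReal.mul_ne_top hfin.ne ENNReal.ofReal_ne_top, fun g => ?_⟩
  set h : EuclideanSpace ℝ (Fin d) → EuclideanSpace ℝ (Fin d) :=
    fun z => Ψ (g⁻¹ * Ψ.symm z * (g * u)) with hh
  have hm : g⁻¹ * Ψ.symm 0 * (g * u) ∈ Ψ.source := by simpa [hΨ.symm_zero] using hus
  have h0 : h 0 = y := by simp [hh, hΨ.symm_zero, hu, Ψ.right_inv (hOt hyO)]
  obtain ⟨A, hA⟩ := hΨ.exists_equiv_mul g⁻¹ (g * u) hΨ.zero_mem hm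
  have hlim := hy h A hA h0
  have hdet : |(A : EuclideanSpace ℝ (Fin d) →L[ℝ] EuclideanSpace ℝ (Fin d)).det| =
      |(fderiv ℝ (fun z => Ψ (1 * Ψ.symm z * u)) 0).det| * conjJacobian Ψ g := by
    rw [← hA.hasFDerivAt.fderiv, hΨ.fderiv_conj_mul g u hus, ContinuousLinearMap.det,
      ContinuousLinearMap.toLinearMap_comp, LinearMap.det_comp, abs_mul]
    rfl
  rw [hdet, ENNReal.ofReal_mul (abs_nonneg _), ← mul_assoc] at hlim
  refine hlim.congr' ?_
  have hev : ∀ᶠ z in 𝓝 0, (g⁻¹ * Ψ.symm z * (g * u) ∈ Ψ.source ∧ z ∈ Ψ.target) ∧ h z ∈ O :=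
    ((eventually_mul_mem _ _ hΨ.zero_mem hm).and (Ψ.open_target.mem_nhds hΨ.zero_mem)).and
      (hA.continuousAt.eventually (show O ∈ 𝓝 (h 0) by rw [h0]; exact hO.mem_nhds hyO))
  obtain ⟨ε, hε, hball⟩ := nhds_basis_closedBall.mem_iff.1 hev
  filter_upwards [Ioc_mem_nhdsGT hε] with r hr
  have hsub := (closedBall_subset_closedBall (x := (0 : EuclideanSpace ℝ (Fin d))) hr.2).trans hball
  have hcont : ContinuousOn h (closedBall 0 r) := fun z hz =>
    (hΨ.contDiffAt_mul _ _ (hsub hz).1.2 (hsub hz).1.1).continuousAt.continuousWithinAt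
  rw [hνμ _ (by rintro _ ⟨z, hz, rfl⟩; exact (hsub hz).2)
    ((isCompact_closedBall _ _).image_of_continuousOn hcont).measurableSet, image_image]
  congr 1
  rw [← measure_smul μ g⁻¹ ((fun z => Ψ.symm z • g • u • x₀) '' closedBall 0 r), ← image_smul,
    image_image]
  congr 1
  refine image_congr fun z hz => ?_
  simp only [hh]
  rw [Ψ.left_inv (hsub hz).1.1]
  simp only [smul_smul, mul_assoc]

/-- With zero density everywhere, a Besicovitch comparison bounds the pulled-back measure by every
multiple of Lebesgue measure on a ball. Then a nonempty open set is null, its translates cover the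
quotient, and `μ = 0`. -/
lemma IsSmoothChartAtOne.not_tendsto_zero (hΨ : IsSmoothChartAtOne Ψ) (x₀ : G ⧸ Γ)
    [SecondCountableTopology G] :
    ¬ ∀ x : G ⧸ Γ, Tendsto (fun r => μ ((fun z => Ψ.symm z • x) '' closedBall 0 r) /
        volume (closedBall (0 : EuclideanSpace ℝ (Fin d)) r)) (𝓝[>] 0) (𝓝 0) := by
  intro H
  have := topologicalGroup_of_lieGroup (𝓡 d) ∞ (G := G)
  obtain ⟨O', hO', h0O', hOt', hinj'⟩ := hΨ.exists_isOpen_injOn x₀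
  obtain ⟨R, hR, hRO⟩ := Metric.isOpen_iff.1 hO' 0 h0O'
  set O := ball (0 : EuclideanSpace ℝ (Fin d)) R with hOdef
  have hO : IsOpen O := isOpen_ball
  have hOt : O ⊆ Ψ.target := hRO.trans hOt'
  have hinj := hinj'.mono hRO
  obtain ⟨ν, hν, hνμ⟩ := exists_measure_chart μ x₀ hO hOt hinj
  have key : ∀ y ∈ O, ∀ ε : NNReal, 0 < ε →
      ∀ᶠ r in 𝓝[>] (0 : ℝ), ν (closedBall y r) ≤ (ε • volume) (closedBall y r) := by
    intro y hy ε hε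
    set u := Ψ.symm y with hu
    have hus : u ∈ Ψ.source := Ψ.map_target (hOt hy)
    have hm : 1 * Ψ.symm y * u⁻¹ ∈ Ψ.source := by simpa [hu] using hΨ.one_mem
    -- `k` recentres the chart: it sends a ball of radius `r` about `y` into the ball of radius `C
    -- r` about `0`, where the hypothesis at `u • x₀` applies.
    set k : EuclideanSpace ℝ (Fin d) → EuclideanSpace ℝ (Fin d) :=
      fun w => Ψ (1 * Ψ.symm w * u⁻¹) with hk
    have hk0 : k y = 0 := by simp [hk, hu, hΨ.map_one]
    obtain ⟨A, hA⟩ := hΨ.exists_equiv_mul 1 u⁻¹ (hOt hy) hm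
    obtain ⟨C, hC, hCk⟩ := hA.hasFDerivAt.isBigO_sub.exists_pos
    have hev := (eventually_mul_mem (Ψ := Ψ) 1 u⁻¹ (hOt hy) hm).and (hCk.bound.and (hO.mem_nhds hy))
    obtain ⟨r₀, hr₀, hball⟩ := nhds_basis_closedBall.mem_iff.1 hev
    have hCr : Tendsto (fun r => C * r) (𝓝[>] 0) (𝓝[>] 0) := by
      refine tendsto_nhdsWithin_iff.2 ⟨?_, ?_⟩
      · have : Tendsto (fun R => C * R) (𝓝 0) (𝓝 (C * 0)) := (continuous_const_mul C).tendsto 0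
        rw [mul_zero] at this
        exact this.mono_left nhdsWithin_le_nhds
      · filter_upwards [self_mem_nhdsWithin] with R hR using mul_pos hC hR
    have hε' : 0 < ENNReal.ofReal (ε / C ^ d) := by
      rw [ENNReal.ofReal_pos]; positivity
    filter_upwards [(((H (u • x₀)).comp hCr).eventually (gt_mem_nhds hε')), Ioc_mem_nhdsGT hr₀]
      with r h1 hr
    have hsub := (closedBall_subset_closedBall (x := y) hr.2).trans hball
    have hle : ν (closedBall y r) ≤ μ ((fun z => Ψ.symm z • u • x₀) '' closedBall 0 (C * r)) := by
      rw [hνμ _ (fun w hw => (hsub hw).2.2) measurableSet_closedBall]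
      refine measure_mono ?_
      rintro _ ⟨w, hw, rfl⟩
      refine ⟨k w, ?_, ?_⟩
      · have h2 := (hsub hw).2.1
        change ‖k w - k y‖ ≤ C * ‖w - y‖ at h2
        rw [hk0, sub_zero] at h2
        rw [mem_closedBall_zero_iff]
        refine h2.trans ?_
        rw [mem_closedBall, dist_eq_norm] at hw
        gcongr
      · simp only [hk]
        rw [Ψ.left_inv (hsub hw).1]
        simp [smul_smul]
    refine hle.trans ?_
    simp only [Function.comp] at h1
    have hCr0 : 0 < C * r := mul_pos hC hr.1
    have h3 := (ENNReal.div_le_iff (volume_closedBall_ne_zero hCr0)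
      (volume_closedBall_ne_top _)).1 h1.le
    refine h3.trans (le_of_eq ?_)
    rw [volume_closedBall_mul 0 hr.1 C hC.le, ← mul_assoc, ← ENNReal.ofReal_mul (by positivity),
      div_mul_cancel₀ _ (by positivity), Measure.smul_apply, Measure.addHaar_closedBall_center volume y,
      ENNReal.ofReal_coe_nnreal]
    rfl
  have hle : ∀ ε : NNReal, 0 < ε → ν O ≤ ε * volume O := by
    intro ε hε
    have := VitaliFamily.measure_le_of_frequently_le (Besicovitch.vitaliFamily ν) (ρ := ν)
      (ε • volume) Measure.AbsolutelyContinuous.rfl O fun y hy =>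
        (Besicovitch.tendsto_filterAt ν y).frequently (key y hy ε hε).frequently
    exact this
  have hzero : ν O = 0 := by
    have hvol : volume O ≠ ⊤ := measure_ball_lt_top.ne
    refine le_antisymm (ENNReal.le_of_forall_pos_le_add fun ε hε _ => ?_) bot_le
    have hpos : 0 < ε / ((volume O).toNNReal + 1) := by positivity
    refine (hle _ hpos).trans ?_
    rw [zero_add, ← ENNReal.coe_toNNReal hvol, ← ENNReal.coe_mul]
    refine ENNReal.coe_le_coe.2 ?_
    rw [div_mul_eq_mul_div, ENNReal.toNNReal_coe]
    exact div_le_of_le_mul₀ (by positivity) (by positivity) (by gcongr; exact le_self_add)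
  rw [hνμ O subset_rfl hO.measurableSet] at hzero
  have hopen : IsOpen ((fun y => Ψ.symm y • x₀) '' O) := by
    have h1 : IsOpen (Ψ.symm '' O) := Ψ.symm.isOpen_image_of_subset_source hO hOt
    have h2 := isOpenMap_smul_quotient x₀ _ h1
    rwa [image_image] at h2
  have hmem : x₀ ∈ (fun y => Ψ.symm y • x₀) '' O :=
    ⟨0, mem_ball_self hR, by simp [hΨ.symm_zero]⟩
  have huniv : μ univ = 0 := by
    refine measure_null_of_locally_null _ fun x _ => ?_
    obtain ⟨g, rfl⟩ := MulAction.exists_smul_eq G x₀ x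
    refine ⟨g • ((fun y => Ψ.symm y • x₀) '' O), ?_, by rw [measure_smul, hzero]⟩
    rw [nhdsWithin_univ]
    exact (hopen.smul g).mem_nhds (smul_mem_smul_set hmem)
  simp at huniv

/-- An invariant probability measure on `G ⧸ Γ` has the same density at all points: the measure of
a small ball (in a chart of `G` at the identity) is asymptotically proportional to `r ^ d`. -/
lemma IsSmoothChartAtOne.exists_tendsto_measureReal_closedBall (hΨ : IsSmoothChartAtOne Ψ)
    [SecondCountableTopology G] : ∃ w : ℝ, 0 < w ∧ ∀ x : G ⧸ Γ,
      Tendsto (fun r => μ.real ((fun z => Ψ.symm z • x) '' closedBall 0 r) / r ^ d) (𝓝[>] 0)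
        (𝓝 w) := by
  have := topologicalGroup_of_lieGroup (𝓡 d) ∞ (G := G)
  obtain ⟨x₁, c, hc, hlim⟩ := hΨ.exists_tendsto_measure_closedBall (μ := μ) ((1 : G) : G ⧸ Γ)
  have hc0 : c ≠ 0 := by
    rintro rfl
    refine hΨ.not_tendsto_zero (μ := μ) x₁ fun x => ?_
    obtain ⟨g, rfl⟩ := MulAction.exists_smul_eq G x₁ x
    simpa using hlim g
  set v := c.toReal * volume.real (closedBall (0 : EuclideanSpace ℝ (Fin d)) 1) with hv
  have hvpos : 0 < v := by
    refine mul_pos (ENNReal.toReal_pos hc0 hc) (ENNReal.toReal_pos ?_ ?_)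
    · exact volume_closedBall_ne_zero one_pos
    · exact volume_closedBall_ne_top _
  have hreal : ∀ g : G, Tendsto
      (fun r => μ.real ((fun z => Ψ.symm z • g • x₁) '' closedBall 0 r) / r ^ d) (𝓝[>] 0)
      (𝓝 (v * conjJacobian Ψ g)) := by
    intro g
    have h1 := (ENNReal.tendsto_toReal (ENNReal.mul_ne_top hc ENNReal.ofReal_ne_top)).comp (hlim g)
    rw [ENNReal.toReal_mul, ENNReal.toReal_ofReal (hΨ.conjJacobian_pos g).le] at h1
    have h2 := h1.mul_const (volume.real (closedBall (0 : EuclideanSpace ℝ (Fin d)) 1))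
    rw [mul_right_comm] at h2
    refine h2.congr' ?_
    filter_upwards [self_mem_nhdsWithin] with r hr
    have hr0 : (0 : ℝ) < r := hr
    have h3 : volume (closedBall (0 : EuclideanSpace ℝ (Fin d)) r) =
        ENNReal.ofReal (r ^ d) * volume (closedBall (0 : EuclideanSpace ℝ (Fin d)) 1) := by
      have := volume_closedBall_mul (0 : EuclideanSpace ℝ (Fin d)) one_pos r hr0.le
      rwa [mul_one] at this
    have h4 : volume.real (closedBall (0 : EuclideanSpace ℝ (Fin d)) 1) ≠ 0 :=
      (ENNReal.toReal_pos (volume_closedBall_ne_zero one_pos) (volume_closedBall_ne_top _)).ne'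
    simp only [Function.comp]
    rw [h3, ENNReal.toReal_div, ENNReal.toReal_mul, ENNReal.toReal_ofReal (by positivity)]
    change μ.real _ / (r ^ d * volume.real _) * volume.real _ = _
    field_simp
  -- Open balls are needed for `measurable_measure_smul`.
  have hopen : ∀ g : G, Tendsto
      (fun r => μ.real ((fun z => Ψ.symm z • g • x₁) '' ball 0 r) / r ^ d) (𝓝[>] 0)
      (𝓝 (v * conjJacobian Ψ g)) := by
    intro g
    refine tendsto_div_pow_of_sandwich (hreal g) fun r hr => ?_
    filter_upwards [self_mem_nhdsWithin] with R hR
    have hR0 : (0 : ℝ) < R := hR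
    refine ⟨measureReal_mono (image_mono (closedBall_subset_ball (div_lt_self hR0 hr))),
      measureReal_mono (image_mono (ball_subset_closedBall.trans (closedBall_subset_closedBall ?_)))⟩
    exact le_mul_of_one_le_left hR0.le hr.le
  -- As a limit of measures of balls about `g • x₁`, the number `v * conjJacobian Ψ g` depends on `g
  -- • x₁` alone and so descends to a measurable density. Radii are capped at `r₀` to stay in the
  -- chart.
  have hw : ∃ w : G ⧸ Γ → ℝ, Measurable w ∧ ∀ g : G, w (g • x₁) = v * conjJacobian Ψ g := by
    have hseq : Tendsto (fun n : ℕ => 1 / ((n : ℝ) + 1)) atTop (𝓝[>] 0) :=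
      tendsto_nhdsWithin_iff.2 ⟨tendsto_one_div_add_atTop_nhds_zero_nat,
        Eventually.of_forall fun n => by
          have : (0 : ℝ) < 1 / ((n : ℝ) + 1) := by positivity
          exact this⟩
    obtain ⟨r₀, hr₀, hball⟩ := Metric.isOpen_iff.1 Ψ.open_target 0 hΨ.zero_mem
    have hex : ∀ x : G ⧸ Γ, ∃ g : G, g • x₁ = x := MulAction.exists_smul_eq G x₁
    choose s hs using hex
    have hmeas : ∀ n : ℕ, Measurable fun x : G ⧸ Γ =>
        μ.real ((fun z => Ψ.symm z • x) '' ball 0 (min r₀ (1 / ((n : ℝ) + 1)))) /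
          (1 / ((n : ℝ) + 1)) ^ d := by
      intro n
      have h1 : IsOpen (Ψ.symm '' ball 0 (min r₀ (1 / ((n : ℝ) + 1)))) :=
        Ψ.symm.isOpen_image_of_subset_source isOpen_ball
          ((ball_subset_ball (min_le_left _ _)).trans hball)
      have h2 := (measurable_measure_smul (Γ := Γ) μ h1).ennreal_toReal
      simp only [image_image] at h2
      exact h2.div_const _
    have hlimw : ∀ g : G, Tendsto (fun n : ℕ =>
        μ.real ((fun z => Ψ.symm z • g • x₁) '' ball 0 (min r₀ (1 / ((n : ℝ) + 1)))) /
          (1 / ((n : ℝ) + 1)) ^ d) atTop (𝓝 (v * conjJacobian Ψ g)) := by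
      intro g
      refine ((hopen g).comp hseq).congr' ?_
      filter_upwards [hseq.eventually (Ioc_mem_nhdsGT hr₀)] with n hn
      simp only [Function.comp]
      rw [min_eq_right hn.2]
    refine ⟨fun x => v * conjJacobian Ψ (s x), ?_, fun g => ?_⟩
    · refine measurable_of_tendsto_metrizable hmeas (tendsto_pi_nhds.2 fun x => ?_)
      have := hlimw (s x)
      rwa [hs x] at this
    · have h1 := hlimw (s (g • x₁))
      rw [hs] at h1
      exact tendsto_nhds_unique h1 (hlimw g)
  obtain ⟨w, hwm, hw⟩ := hw
  -- The density satisfies `w (g • x) = J(g) w(x)`, so invariance gives `J(g) ≥ 1`; used for `g` and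
  -- `g⁻¹` it gives `J = 1`.
  have hge : ∀ g : G, 1 ≤ conjJacobian Ψ g := by
    intro g
    refine one_le_of_comp_eq_mul (measurePreserving_smul g μ) hwm (fun x => ?_)
      (hΨ.conjJacobian_pos g) fun x => ?_
    · obtain ⟨h, rfl⟩ := MulAction.exists_smul_eq G x₁ x
      rw [hw]
      exact mul_pos hvpos (hΨ.conjJacobian_pos h)
    · obtain ⟨h, rfl⟩ := MulAction.exists_smul_eq G x₁ x
      rw [smul_smul, hw, hw, hΨ.conjJacobian_mul]
      ring
  have hone : ∀ g : G, conjJacobian Ψ g = 1 := by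
    intro g
    have h1 := hΨ.conjJacobian_mul g g⁻¹
    have h2 := hΨ.conjJacobian_mul 1 1
    rw [one_mul, left_eq_mul₀ (hΨ.conjJacobian_pos 1).ne'] at h2
    rw [mul_inv_cancel, h2] at h1
    nlinarith [hge g, hge g⁻¹]
  refine ⟨v, hvpos, fun x => ?_⟩
  obtain ⟨g, rfl⟩ := MulAction.exists_smul_eq G x₁ x
  simpa [hone] using hreal g

/-- The measure of a small ball of `G ⧸ Γ`. -/
lemma LieRiemannianMetric.exists_tendsto_measureReal_ball [T3Space G] [SecondCountableTopology G]
    (B : LieRiemannianMetric d G) (μ : Measure (G ⧸ Γ)) [IsProbabilityMeasure μ]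
    [SMulInvariantMeasure G (G ⧸ Γ) μ] : ∃ w : ℝ, 0 < w ∧ ∀ x : G ⧸ Γ,
      Tendsto (fun R => μ.real ((fun u : G => u • x) '' B.ballG R) / R ^ d) (𝓝[>] 0) (𝓝 w) := by
  obtain ⟨Ψ, h1, h0, hs, hs', hB⟩ := B.exists_chart
  have hΨ : IsSmoothChartAtOne Ψ := ⟨h1, h0, hs, hs'⟩
  obtain ⟨w, hw, hlim⟩ := hΨ.exists_tendsto_measureReal_closedBall (μ := μ)
  refine ⟨w, hw, fun x => tendsto_div_pow_of_sandwich (hlim x) fun r hr => ?_⟩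
  -- The room between `s` and `r` turns the weak inequality of closed balls into the strict one
  -- asked by the chart.
  obtain ⟨s, hs1, hsr⟩ := exists_between hr
  obtain ⟨R₀, hR₀, hR⟩ := hB s hs1
  obtain ⟨r₀, hr₀, hball⟩ := Metric.isOpen_iff.1 Ψ.open_target 0 hΨ.zero_mem
  filter_upwards [Ioc_mem_nhdsGT hR₀, Ioo_mem_nhdsGT hr₀] with R hR1 hR2
  have hs0 : 0 < s := one_pos.trans hs1
  have hr0 : 0 < r := one_pos.trans hr
  obtain ⟨h3, h4⟩ := hR R hR1.1 hR1.2
  constructor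
  · refine measureReal_mono ?_
    rintro _ ⟨z, hz, rfl⟩
    rw [mem_closedBall_zero_iff] at hz
    have hlt : R / r < R := div_lt_self hR1.1 hr
    have hzt : z ∈ Ψ.target := hball (mem_ball_zero_iff.2 ((hz.trans_lt hlt).trans hR2.2))
    refine ⟨Ψ.symm z, h3 _ (Ψ.map_target hzt) ?_, rfl⟩
    rw [Ψ.right_inv hzt]
    calc s * ‖z‖ ≤ s * (R / r) := by gcongr
      _ < r * (R / r) := by have := hR1.1; gcongr
      _ = R := by field_simp
  · refine measureReal_mono ?_
    rintro _ ⟨u, hu, rfl⟩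
    obtain ⟨h5, h6⟩ := h4 u hu
    refine ⟨Ψ u, ?_, by simp only [Ψ.left_inv h5]⟩
    rw [mem_closedBall_zero_iff]
    refine h6.le.trans ?_
    have := hR1.1
    gcongr

end InvariantDensity


/-! ### Smooth cutoffs at small scales. -/

section CutoffFunctions

set_option linter.unusedSectionVars false

variable {d : ℕ} {G : Type*} [TopologicalSpace G] [ChartedSpace (EuclideanSpace ℝ (Fin d)) G]
  [Group G] {Γ : Subgroup G} {Ψ : OpenPartialHomeomorph G (EuclideanSpace ℝ (Fin d))}

/-- The function on `G ⧸ Γ` that is `F` in the chart `y ↦ Ψ⁻¹(y) x₀`, `y ∈ O`, and `0` outside. -/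
noncomputable def chartExtend {V : Type*} [Zero V]
    (Ψ : OpenPartialHomeomorph G (EuclideanSpace ℝ (Fin d))) (x₀ : G ⧸ Γ)
    (O : Set (EuclideanSpace ℝ (Fin d))) (F : EuclideanSpace ℝ (Fin d) → V) : G ⧸ Γ → V :=
  Function.extend (fun y : O => Ψ.symm y • x₀) (fun y : O => F y) 0

variable {x₀ : G ⧸ Γ} {O : Set (EuclideanSpace ℝ (Fin d))}

lemma chartExtend_apply {V : Type*} [Zero V] (hinj : InjOn (fun y => Ψ.symm y • x₀) O)
    (F : EuclideanSpace ℝ (Fin d) → V) {y : EuclideanSpace ℝ (Fin d)} (hy : y ∈ O) :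
    chartExtend Ψ x₀ O F (Ψ.symm y • x₀) = F y := by
  have h : Function.Injective fun y : O => Ψ.symm y • x₀ := fun a b hab =>
    Subtype.ext (hinj a.2 b.2 hab)
  exact h.extend_apply (fun y : O => F y) 0 ⟨y, hy⟩

lemma chartExtend_eq_zero {V : Type*} [Zero V] (F : EuclideanSpace ℝ (Fin d) → V) {x : G ⧸ Γ}
    (hx : ∀ y ∈ O, Ψ.symm y • x₀ ≠ x) : chartExtend Ψ x₀ O F x = 0 :=
  Function.extend_apply' _ _ _ fun ⟨y, hy⟩ => hx y y.2 hy

variable [LieGroup (𝓡 d) ∞ G] [T2Space G] [DiscreteTopology Γ]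

/-- The image of the support is closed: its preimage in `G` is `K Γ`, a compact set times a closed
one. The extension vanishes off this image. -/
lemma eventually_chartExtend_eq_zero {V : Type*} [Zero V]
    (hinj : InjOn (fun y => Ψ.symm y • x₀) O) (hOt : O ⊆ Ψ.target)
    {F : EuclideanSpace ℝ (Fin d) → V} (hFc : HasCompactSupport F) (hFO : tsupport F ⊆ O)
    {x : G ⧸ Γ} (hx : x ∉ (fun y => Ψ.symm y • x₀) '' tsupport F) :
    ∀ᶠ x' in 𝓝 x, chartExtend Ψ x₀ O F x' = 0 := by
  have := topologicalGroup_of_lieGroup (𝓡 d) ∞ (G := G)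
  have hΓ : IsClosed (Γ : Set G) := Subgroup.isClosed_of_discrete
  have hclosed : IsClosed ((fun y => Ψ.symm y • x₀) '' tsupport F) := by
    induction x₀ using QuotientGroup.induction_on with
    | H g₀ =>
      rw [← (QuotientGroup.isQuotientMap_mk (N := Γ)).isClosed_preimage]
      have hK : IsCompact ((fun y => Ψ.symm y * g₀) '' tsupport F) :=
        hFc.isCompact.image_of_continuousOn
          ((Ψ.symm.continuousOn.mono (hFO.trans hOt)).mul continuousOn_const)
      convert hΓ.mul_left_of_isCompact hK using 1
      ext g
      constructor
      · rintro ⟨y, hy, he⟩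
        have he' : ((Ψ.symm y * g₀ : G) : G ⧸ Γ) = (g : G ⧸ Γ) := he
        rw [QuotientGroup.eq] at he'
        exact ⟨_, ⟨y, hy, rfl⟩, _, he', mul_inv_cancel_left _ _⟩
      · rintro ⟨_, ⟨y, hy, rfl⟩, γ, hγ, rfl⟩
        refine ⟨y, hy, ?_⟩
        change ((Ψ.symm y * g₀ : G) : G ⧸ Γ) = _
        rw [QuotientGroup.eq]
        exact (inv_mul_cancel_left (Ψ.symm y * g₀) γ).symm ▸ hγ
  filter_upwards [hclosed.isOpen_compl.mem_nhds hx] with x' hx'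
  by_cases h : ∃ y ∈ O, Ψ.symm y • x₀ = x'
  · obtain ⟨y, hy, rfl⟩ := h
    rw [chartExtend_apply hinj F hy]
    by_contra hne
    exact hx' ⟨y, subset_tsupport F hne, rfl⟩
  · push Not at h
    exact chartExtend_eq_zero F h

/-- Near a point `g = Ψ⁻¹(y) g₀ γ` the lift is `g' ↦ F (Ψ (g' γ⁻¹ g₀⁻¹))`; at all other points it is
locally zero. -/
lemma IsSmoothChartAtOne.contMDiff_chartExtend (hΨ : IsSmoothChartAtOne Ψ) {V : Type*}
    [NormedAddCommGroup V] [NormedSpace ℝ V] (hO : IsOpen O) (hOt : O ⊆ Ψ.target)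
    (hinj : InjOn (fun y => Ψ.symm y • x₀) O) {F : EuclideanSpace ℝ (Fin d) → V}
    (hF : ContDiff ℝ ∞ F) (hFc : HasCompactSupport F) (hFO : tsupport F ⊆ O) :
    ContMDiff (𝓡 d) 𝓘(ℝ, V) ∞ (fun g : G => chartExtend Ψ x₀ O F (g : G ⧸ Γ)) := by
  have := topologicalGroup_of_lieGroup (𝓡 d) ∞ (G := G)
  intro g
  by_cases hg : ∃ y ∈ O, Ψ.symm y • x₀ = (g : G ⧸ Γ)
  · obtain ⟨y, hy, he⟩ := hg
    induction x₀ using QuotientGroup.induction_on with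
    | H g₀ =>
      have he' : ((Ψ.symm y * g₀ : G) : G ⧸ Γ) = (g : G ⧸ Γ) := he
      rw [QuotientGroup.eq] at he'
      set γ := (Ψ.symm y * g₀)⁻¹ * g with hγ
      have h1 : g * (γ⁻¹ * g₀⁻¹) = Ψ.symm y := by simp [hγ, mul_assoc]
      have hs : g * (γ⁻¹ * g₀⁻¹) ∈ Ψ.source := by rw [h1]; exact Ψ.map_target (hOt hy)
      have hsm : ContMDiffAt (𝓡 d) 𝓘(ℝ, EuclideanSpace ℝ (Fin d)) ∞
          (fun g' : G => Ψ (g' * (γ⁻¹ * g₀⁻¹))) g :=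
        ContMDiffAt.comp g (hΨ.smooth.contMDiffAt (Ψ.open_source.mem_nhds hs))
          (contMDiff_mul_right (I := 𝓡 d) (a := γ⁻¹ * g₀⁻¹)).contMDiffAt
      refine ContMDiffAt.congr_of_eventuallyEq
        (hF.contMDiff.contMDiffAt.comp g hsm) ?_
      have hc : ContinuousAt (fun g' : G => g' * (γ⁻¹ * g₀⁻¹)) g :=
        (continuous_mul_const _).continuousAt
      filter_upwards [hc.eventually (Ψ.open_source.mem_nhds hs),
        hsm.continuousAt.eventually (hO.mem_nhds
          (show Ψ (g * (γ⁻¹ * g₀⁻¹)) ∈ O by rw [h1, Ψ.right_inv (hOt hy)]; exact hy))]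
        with g' hg1 hg2
      have h2 : (g' : G ⧸ Γ) = Ψ.symm (Ψ (g' * (γ⁻¹ * g₀⁻¹))) • ((g₀ : G) : G ⧸ Γ) := by
        rw [Ψ.left_inv hg1, MulAction.Quotient.smul_coe, smul_eq_mul, QuotientGroup.eq]
        simpa [mul_assoc] using he'
      rw [h2, chartExtend_apply hinj F hg2]
      rfl
  · have h1 : (g : G ⧸ Γ) ∉ (fun y => Ψ.symm y • x₀) '' tsupport F := by
      rintro ⟨y, hy, he⟩
      exact hg ⟨y, hFO hy, he⟩
    have h2 := eventually_chartExtend_eq_zero hinj hOt hFc hFO h1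
    have h3 : Tendsto (fun g : G => (g : G ⧸ Γ)) (𝓝 g) (𝓝 (g : G ⧸ Γ)) :=
      QuotientGroup.continuous_mk.tendsto g
    exact (contMDiffAt_const (c := (0 : V))).congr_of_eventuallyEq (h3.eventually h2)

/-- Smooth functions on `G ⧸ Γ` vanishing outside a compact set. -/
structure IsSmoothCompact (d : ℕ) {G : Type*} [TopologicalSpace G]
    [ChartedSpace (EuclideanSpace ℝ (Fin d)) G] [Group G] {Γ : Subgroup G}
    (f : G ⧸ Γ → ℝ) : Prop where
  smooth : IsSmoothQuot d f
  exists_compact : ∃ K : Set (G ⧸ Γ), IsCompact K ∧ ∀ x ∉ K, ∀ᶠ x' in 𝓝 x, f x' = 0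

lemma IsSmoothCompact.exists_bound {f : G ⧸ Γ → ℝ} (h : IsSmoothCompact d f) :
    ∃ C : ℝ, 0 ≤ C ∧ ∀ x, |f x| ≤ C := by
  obtain ⟨K, hK, h0⟩ := h.exists_compact
  obtain ⟨C, hC⟩ := hK.exists_bound_of_continuousOn h.smooth.continuous.continuousOn
  refine ⟨max C 0, le_max_right _ _, fun x => ?_⟩
  by_cases hx : x ∈ K
  · exact (hC x hx).trans (le_max_left _ _)
  · rw [(h0 x hx).self_of_nhds, abs_zero]
    exact le_max_right _ _

lemma IsSmoothCompact.mul_right {f g : G ⧸ Γ → ℝ} (h : IsSmoothCompact d f)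
    (hg : IsSmoothQuot d g) : IsSmoothCompact d fun x => f x * g x := by
  obtain ⟨K, hK, h0⟩ := h.exists_compact
  refine ⟨h.smooth.mul hg, K, hK, fun x hx => ?_⟩
  filter_upwards [h0 x hx] with y hy
  rw [hy, zero_mul]

lemma IsSmoothCompact.lieDeriv {f : G ⧸ Γ → ℝ} (h : IsSmoothCompact d f)
    (v : GroupLieAlgebra (𝓡 d) G) : IsSmoothCompact d (lieDeriv v f) := by
  obtain ⟨K, hK, h0⟩ := h.exists_compact
  refine ⟨h.smooth.lieDeriv v, K, hK, fun x hx => ?_⟩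
  filter_upwards [(h0 x hx).eventually_nhds] with y hy
  have := topologicalGroup_of_lieGroup (𝓡 d) ∞ (G := G)
  have h1 : ContinuousAt (fun t : ℝ => lieExp (t • v) • y) 0 :=
    (hasVelocityAt_lieExp_smul v).continuousAt.smul continuousAt_const
  have h2 : ∀ᶠ t in 𝓝 (0 : ℝ), f (lieExp (t • v) • y) = 0 := by
    refine h1.eventually (p := fun z => f z = 0) ?_
    beta_reduce
    rwa [lieExp_zero_smul, one_smul]
  exact (EventuallyEq.deriv_eq h2).trans (deriv_const _ _)

lemma lieDeriv_comp_pi {Y : G ⧸ Γ → Fin d → ℝ} (hY : ∀ j, IsSmoothQuot d fun x => Y x j)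
    {χ : (Fin d → ℝ) → ℝ} (hχ : ContDiff ℝ ∞ χ) (c : ℝ) (v : GroupLieAlgebra (𝓡 d) G) :
    lieDeriv v (fun x => χ (c • Y x)) = fun x =>
      c * ∑ j, lieDeriv v (fun x => Y x j) x * fderiv ℝ χ (c • Y x) (Pi.single j 1) := by
  funext x
  have h1 : HasDerivAt (fun t : ℝ => Y (lieExp (t • v) • x))
      (fun j => lieDeriv v (fun x => Y x j) x) 0 :=
    hasDerivAt_pi.2 fun j => (hY j).hasDerivAt v x
  have h2 := (hχ.differentiable (by simp) (c • Y (lieExp ((0 : ℝ) • v) • x))).hasFDerivAt.comp_hasDerivAt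
    (0 : ℝ) (h1.const_smul c)
  rw [lieExp_zero_smul, one_smul] at h2
  refine h2.deriv.trans ?_
  rw [map_smul, smul_eq_mul]
  congr 1
  rw [← ContinuousLinearMap.coe_coe, LinearMap.pi_apply_eq_sum_univ]
  simp only [smul_eq_mul, ContinuousLinearMap.coe_coe]
  refine Finset.sum_congr rfl fun j _ => ?_
  congr 2
  ext i
  simp [Pi.single_apply, eq_comm]

lemma isSmoothQuot_comp_pi {Y : G ⧸ Γ → Fin d → ℝ} (hY : ∀ j, IsSmoothQuot d fun x => Y x j)
    {χ : (Fin d → ℝ) → ℝ} (hχ : ContDiff ℝ ∞ χ) (c : ℝ) :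
    IsSmoothQuot d fun x => χ (c • Y x) := by
  have h1 : ContMDiff (𝓡 d) 𝓘(ℝ, Fin d → ℝ) ∞ (fun g : G => Y (g : G ⧸ Γ)) :=
    contMDiff_pi_space.2 hY
  exact IsSmoothQuot.comp_contDiff h1 (χ := fun y => χ (c • y)) (hχ.comp (contDiff_const_smul c))

/-- The derivatives of order `q` of a cutoff at scale `R` are of order at most `R ^ (-q)`. -/
lemma exists_bound_iterLieDeriv_cutoff (ζ : Fin d → GroupLieAlgebra (𝓡 d) G)
    {Y : G ⧸ Γ → Fin d → ℝ} (hY : ∀ j, IsSmoothQuot d fun x => Y x j) (n : ℕ) :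
    ∀ (w : List (Fin d)), w.length = n → ∀ {a : G ⧸ Γ → ℝ} {χ : (Fin d → ℝ) → ℝ},
      IsSmoothCompact d a → ContDiff ℝ ∞ χ → HasCompactSupport χ →
      ∃ C : ℝ, 0 ≤ C ∧ ∀ R : ℝ, 0 < R → R ≤ 1 → ∀ x,
        |iterLieDeriv ζ (fun x => a x * χ (R⁻¹ • Y x)) w x| ≤ C * R⁻¹ ^ n := by
  induction n with
  | zero =>
    intro w hw a χ ha hχ hχc
    obtain rfl := List.length_eq_zero_iff.1 hw
    obtain ⟨C₁, hC₁, h1⟩ := ha.exists_bound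
    obtain ⟨C₂, h2⟩ := hχ.continuous.bounded_above_of_compact_support hχc
    refine ⟨C₁ * max C₂ 0, by positivity, fun R hR hR1 x => ?_⟩
    simp only [iterLieDeriv, pow_zero, mul_one, abs_mul]
    gcongr
    · exact h1 x
    · exact (h2 _).trans (le_max_left _ _)
  | succ n ih =>
    intro w hw a χ ha hχ hχc
    obtain ⟨w, i, rfl⟩ : ∃ w' i, w = w' ++ [i] := by
      rcases List.eq_nil_or_concat w with h | ⟨w', i, h⟩
      · simp [h] at hw
      · exact ⟨w', i, by simpa using h⟩
    have hw' : w.length = n := by simpa using hw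
    -- The innermost derivative produces `(D a) χ(Y/R)` and `R⁻¹` times terms `(a D Y_j) (∂_j
    -- χ)(Y/R)`. All have the original shape, which is why `a` and `χ` vary in the induction.
    obtain ⟨C₀, hC₀, h0⟩ := ih w hw' (ha.lieDeriv (ζ i)) hχ hχc
    have hχj : ∀ j : Fin d, ContDiff ℝ ∞ fun z => fderiv ℝ χ z (Pi.single j 1) := fun j =>
      (hχ.fderiv_right (m := ∞) (by simp)).clm_apply contDiff_const
    have hDY := fun j => (hY j).lieDeriv (ζ i)
    have hex := fun j => ih w hw' (ha.mul_right (hDY j)) (hχj j) (hχc.fderiv_apply (𝕜 := ℝ) _)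
    choose C hC hCb using hex
    refine ⟨C₀ + ∑ j, C j, add_nonneg hC₀ (Finset.sum_nonneg fun j _ => hC j),
      fun R hR hR1 x => ?_⟩
    have hsm : ∀ j, IsSmoothQuot d fun x =>
        a x * lieDeriv (ζ i) (fun x => Y x j) x * fderiv ℝ χ (R⁻¹ • Y x) (Pi.single j 1) :=
      fun j => (ha.smooth.mul (hDY j)).mul (isSmoothQuot_comp_pi hY (hχj j) R⁻¹)
    have hD : lieDeriv (ζ i) (fun x => a x * χ (R⁻¹ • Y x)) = fun x =>
        lieDeriv (ζ i) a x * χ (R⁻¹ • Y x) + R⁻¹ * ∑ j,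
          a x * lieDeriv (ζ i) (fun x => Y x j) x * fderiv ℝ χ (R⁻¹ • Y x) (Pi.single j 1) := by
      rw [lieDeriv_mul ha.smooth (isSmoothQuot_comp_pi hY hχ _), lieDeriv_comp_pi hY hχ]
      funext x
      congr 1
      rw [mul_left_comm, Finset.mul_sum]
      simp only [mul_assoc]
    rw [iterLieDeriv_append_singleton, hD, iterLieDeriv_add
      (((ha.smooth.lieDeriv _).mul (isSmoothQuot_comp_pi hY hχ _)))
      ((IsSmoothQuot.sum _ hsm).const_mul _), iterLieDeriv_const_mul (IsSmoothQuot.sum _ hsm),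
      iterLieDeriv_sum _ hsm]
    have hR' : 1 ≤ R⁻¹ := (one_le_inv₀ hR).2 hR1
    calc _ ≤ |iterLieDeriv ζ (fun x => lieDeriv (ζ i) a x * χ (R⁻¹ • Y x)) w x| +
          R⁻¹ * ∑ j, |iterLieDeriv ζ (fun x => a x * lieDeriv (ζ i) (fun x => Y x j) x *
            fderiv ℝ χ (R⁻¹ • Y x) (Pi.single j 1)) w x| := by
          refine (abs_add_le _ _).trans (add_le_add le_rfl ?_)
          rw [abs_mul, abs_of_pos (inv_pos.2 hR)]
          gcongr
          exact Finset.abs_sum_le_sum_abs _ _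
      _ ≤ C₀ * R⁻¹ ^ n + R⁻¹ * ∑ j, C j * R⁻¹ ^ n := by
          gcongr with j
          · exact h0 R hR hR1 x
          · exact hCb j R hR hR1 x
      _ = C₀ * R⁻¹ ^ n + (∑ j, C j) * R⁻¹ ^ (n + 1) := by
          rw [← Finset.sum_mul]; ring
      _ ≤ (C₀ + ∑ j, C j) * R⁻¹ ^ (n + 1) := by
          rw [add_mul]
          gcongr
          exact Nat.le_succ n

/-- Smooth approximations of the indicator functions of small balls. -/
lemma LieRiemannianMetric.exists_bump [T3Space G] (B : LieRiemannianMetric d G)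
    (ζ : Fin d → GroupLieAlgebra (𝓡 d) G) (k : ℕ) (x₀ : G ⧸ Γ) {η : ℝ} (h0η : 0 < η)
    (hη1 : η < 1) :
    ∃ C R₀ : ℝ, 0 < C ∧ 0 < R₀ ∧ ∀ R, 0 < R → R ≤ R₀ → ∃ f : G ⧸ Γ → ℝ,
      HasDerivBound ζ k (C / R) f ∧ (∀ x, 0 ≤ f x) ∧
      (∀ x ∈ (fun u : G => u • x₀) '' B.ballG ((1 - η) * R), f x = 1) ∧
      ∀ x ∉ (fun u : G => u • x₀) '' B.ballG R, f x = 0 := by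
  obtain ⟨Ψ, h1, h0, hs, hs', hB⟩ := B.exists_chart
  have hΨ : IsSmoothChartAtOne Ψ := ⟨h1, h0, hs, hs'⟩
  obtain ⟨O, hO, h0O, hOt, hinj⟩ := hΨ.exists_isOpen_injOn x₀
  obtain ⟨ε, hε, hεO⟩ := Metric.nhds_basis_closedBall.mem_iff.1 (hO.mem_nhds h0O)
  -- This choice gives `r ^ 2 (1 - η) < 1`, so both distortions of the chart fit between the radii
  -- `(1 - η) R` and `R`.
  set r : ℝ := 1 + η / 2 with hr
  have hr1 : 1 < r := by linarith
  have hr0 : 0 < r := by linarith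
  have hrη : r * (1 - η) < 1 / r := by
    rw [lt_div_iff₀ hr0, hr]
    nlinarith [mul_pos h0η h0η, mul_pos (mul_pos h0η h0η) h0η]
  obtain ⟨R₁, hR₁, hball⟩ := hB r hr1
  -- `χ₁ = 1` on the support of `χ₂`, so where `χ₂` is nonzero the globally smooth `Y` is the true
  -- coordinate. `χ₂` localizes, and `φ` cuts off at scale `R`: its radii `r (1 - η)` and `1 / r`
  -- are those of the two balls after distortion.
  let χ₁ : ContDiffBump (0 : EuclideanSpace ℝ (Fin d)) := ⟨2 * ε / 3, ε, by linarith, by linarith⟩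
  let χ₂ : ContDiffBump (0 : EuclideanSpace ℝ (Fin d)) :=
    ⟨ε / 3, 2 * ε / 3, by linarith, by linarith⟩
  let φ : ContDiffBump (0 : EuclideanSpace ℝ (Fin d)) :=
    ⟨r * (1 - η), 1 / r, mul_pos hr0 (by linarith), hrη⟩
  have hsub₂ : tsupport χ₂ ⊆ O := by
    rw [χ₂.tsupport_eq]
    exact (Metric.closedBall_subset_closedBall (by change 2 * ε / 3 ≤ ε; linarith)).trans hεO
  have hsub₁ : tsupport χ₁ ⊆ O := by
    rw [χ₁.tsupport_eq]
    exact hεO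
  set a := chartExtend Ψ x₀ O χ₂ with ha
  have haS : IsSmoothCompact d a := by
    refine ⟨hΨ.contMDiff_chartExtend hO hOt hinj χ₂.contDiff χ₂.hasCompactSupport hsub₂,
      (fun y => Ψ.symm y • x₀) '' tsupport χ₂, ?_, fun x hx =>
        eventually_chartExtend_eq_zero hinj hOt χ₂.hasCompactSupport hsub₂ hx⟩
    have := topologicalGroup_of_lieGroup (𝓡 d) ∞ (G := G)
    exact χ₂.hasCompactSupport.isCompact.image_of_continuousOn
      ((Ψ.symm.continuousOn.mono (hsub₂.trans hOt)).smul continuousOn_const)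
  set Y : G ⧸ Γ → Fin d → ℝ := fun x j => chartExtend Ψ x₀ O (fun y => χ₁ y * y j) x with hYdef
  have hY : ∀ j, IsSmoothQuot d fun x => Y x j := by
    intro j
    have hc : ContDiff ℝ ∞ fun y : EuclideanSpace ℝ (Fin d) => χ₁ y * y j :=
      χ₁.contDiff.mul (by fun_prop)
    exact hΨ.contMDiff_chartExtend hO hOt hinj hc χ₁.hasCompactSupport.mul_right
      ((closure_mono (Function.support_mul_subset_left _ _)).trans hsub₁)
  set χ : (Fin d → ℝ) → ℝ := fun z => φ ((EuclideanSpace.equiv (Fin d) ℝ).symm z) with hχdef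
  have hχ : ContDiff ℝ ∞ χ := φ.contDiff.comp (EuclideanSpace.equiv (Fin d) ℝ).symm.contDiff
  have hχc : HasCompactSupport χ :=
    φ.hasCompactSupport.comp_homeomorph (EuclideanSpace.equiv (Fin d) ℝ).symm.toHomeomorph
  have hvalue : ∀ y ∈ O, ∀ R : ℝ,
      a (Ψ.symm y • x₀) * χ (R⁻¹ • Y (Ψ.symm y • x₀)) = χ₂ y * φ (R⁻¹ • χ₁ y • y) := by
    intro y hy R
    have h2 : (EuclideanSpace.equiv (Fin d) ℝ).symm (R⁻¹ • Y (Ψ.symm y • x₀)) =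
        R⁻¹ • χ₁ y • y := by
      rw [map_smul]
      congr 1
      ext j
      simp only [hYdef, chartExtend_apply hinj _ hy]
      rfl
    rw [ha, chartExtend_apply hinj _ hy, hχdef]
    simp only [h2]
  have hbd := fun w : List (Fin d) => exists_bound_iterLieDeriv_cutoff ζ hY w.length w rfl haS hχ hχc
  choose C hC hCb using hbd
  obtain ⟨M, hM⟩ := ((List.finite_length_le (Fin d) k).image C).bddAbove
  -- With the maximum, a constant `C w` is at most its `|w|`-th power when `|w| ≥ 1`; order zero is
  -- bounded by `1` separately. The bound `ε / 3` puts the ball where `χ₂ = 1`.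
  refine ⟨max M 1, min R₁ (min 1 (ε / 3)), by positivity, by positivity, fun R hR hRle =>
    ⟨fun x => a x * χ (R⁻¹ • Y x), ?_, ?_, ?_, ?_⟩⟩
  all_goals have hRR₁ : R ≤ R₁ := hRle.trans (min_le_left _ _)
  all_goals have hR1 : R ≤ 1 := hRle.trans ((min_le_right _ _).trans (min_le_left _ _))
  all_goals have hRε : R ≤ ε / 3 := hRle.trans ((min_le_right _ _).trans (min_le_right _ _))
  · refine ⟨haS.smooth.mul (isSmoothQuot_comp_pi hY hχ _), fun w hw x => ?_⟩
    rcases Nat.eq_zero_or_pos w.length with hz | hpos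
    · obtain rfl := List.length_eq_zero_iff.1 hz
      simp only [iterLieDeriv, List.length_nil, pow_zero]
      by_cases hx : ∃ y ∈ O, Ψ.symm y • x₀ = x
      · obtain ⟨y, hy, rfl⟩ := hx
        rw [hvalue y hy, abs_of_nonneg (mul_nonneg χ₂.nonneg φ.nonneg)]
        exact mul_le_one₀ χ₂.le_one φ.nonneg φ.le_one
      · push Not at hx
        rw [ha, chartExtend_eq_zero _ hx, zero_mul, abs_zero]
        exact zero_le_one
    · refine (hCb w R hR hR1 x).trans ?_
      rw [div_eq_mul_inv, mul_pow]
      gcongr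
      calc C w ≤ M := hM ⟨w, hw, rfl⟩
        _ ≤ max M 1 := le_max_left _ _
        _ ≤ max M 1 ^ w.length := le_self_pow₀ (le_max_right _ _) hpos.ne'
  · intro x
    beta_reduce
    by_cases hx : ∃ y ∈ O, Ψ.symm y • x₀ = x
    · obtain ⟨y, hy, rfl⟩ := hx
      rw [hvalue y hy]
      exact mul_nonneg χ₂.nonneg φ.nonneg
    · push Not at hx
      rw [ha, chartExtend_eq_zero _ hx, zero_mul]
  · rintro _ ⟨u, hu, rfl⟩
    have hpos : 0 < (1 - η) * R := mul_pos (by linarith) hR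
    have hle : (1 - η) * R ≤ R := mul_le_of_le_one_left hR.le (by linarith)
    obtain ⟨hus, hlt⟩ := (hball _ hpos (hle.trans hRR₁)).2 u hu
    have hlt' : ‖Ψ u‖ < ε / 3 := by
      have h3 : r * ((1 - η) * R) ≤ 1 * R := by
        rw [← mul_assoc]
        have : (1 : ℝ) / r < 1 := by rw [div_lt_one hr0]; exact hr1
        gcongr
        linarith
      linarith
    have hΨO : Ψ u ∈ O := hεO (mem_closedBall_zero_iff.2 (by linarith))
    have h4 := hvalue (Ψ u) hΨO R
    rw [Ψ.left_inv hus] at h4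
    beta_reduce
    rw [h4, χ₂.one_of_mem_closedBall (mem_closedBall_zero_iff.2 hlt'.le),
      χ₁.one_of_mem_closedBall (mem_closedBall_zero_iff.2
        (by change _ ≤ 2 * ε / 3; linarith)), one_smul, one_mul]
    refine φ.one_of_mem_closedBall (mem_closedBall_zero_iff.2 ?_)
    change _ ≤ r * (1 - η)
    rw [norm_smul, norm_inv, Real.norm_of_nonneg hR.le, inv_mul_le_iff₀ hR]
    linarith
  · intro x hx
    by_contra hne
    beta_reduce at hne
    by_cases hx' : ∃ y ∈ O, Ψ.symm y • x₀ = x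
    · obtain ⟨y, hy, rfl⟩ := hx'
      rw [hvalue y hy] at hne
      have h3 : y ∈ Function.support χ₂ := left_ne_zero_of_mul hne
      have h4 : R⁻¹ • χ₁ y • y ∈ Function.support φ := right_ne_zero_of_mul hne
      rw [χ₂.support_eq, mem_ball_zero_iff] at h3
      rw [φ.support_eq, mem_ball_zero_iff, χ₁.one_of_mem_closedBall
        (mem_closedBall_zero_iff.2 h3.le), one_smul, norm_smul, norm_inv,
        Real.norm_of_nonneg hR.le, inv_mul_lt_iff₀ hR] at h4
      change _ < R * (1 / r) at h4
      refine hx ⟨Ψ.symm y, (hball R hR hRR₁).1 _ (Ψ.map_target (hOt hy)) ?_, rfl⟩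
      rw [Ψ.right_inv (hOt hy)]
      rwa [mul_one_div, lt_div_iff₀ hr0, mul_comm] at h4
    · push Not at hx'
      exact hne (by rw [ha, chartExtend_eq_zero _ hx', zero_mul])

end CutoffFunctions


/-! ### From smooth bumps to indicators. -/

section Sandwich

/-- From `exp (-p / (1 - p)) ≤ 1 - p ≤ exp (-p)`, raised to the power `N`. -/
lemma tendsto_one_sub_pow {N : ℕ → ℕ} {p : ℕ → ℝ} {L : ℝ}
    (h : Tendsto (fun n => N n * p n) atTop (𝓝 L)) (hp : Tendsto p atTop (𝓝 0)) :
    Tendsto (fun n => (1 - p n) ^ N n) atTop (𝓝 (Real.exp (-L))) := by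
  have h1 : Tendsto (fun n => Real.exp (-(N n * p n) / (1 - p n))) atTop (𝓝 (Real.exp (-L))) := by
    refine (Real.continuous_exp.tendsto _).comp ?_
    have := h.neg.div (tendsto_const_nhds.sub hp : Tendsto (fun n => 1 - p n) atTop (𝓝 (1 - 0)))
      (by norm_num)
    rw [sub_zero, div_one] at this
    exact this
  have h2 : Tendsto (fun n => Real.exp (-(N n * p n))) atTop (𝓝 (Real.exp (-L))) :=
    (Real.continuous_exp.tendsto _).comp h.neg
  have hlt : ∀ᶠ n in atTop, p n < 1 := hp.eventually (gt_mem_nhds one_pos)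
  refine tendsto_of_tendsto_of_tendsto_of_le_of_le' h1 h2 ?_ ?_
  · filter_upwards [hlt] with n hn
    have h3 : 0 < 1 - p n := sub_pos.2 hn
    have h4 : Real.exp (-p n / (1 - p n)) ≤ 1 - p n := by
      rw [neg_div, Real.exp_neg, inv_le_comm₀ (Real.exp_pos _) h3]
      refine le_trans (le_of_eq ?_) (Real.add_one_le_exp _)
      field_simp
      ring
    calc _ = Real.exp (-p n / (1 - p n)) ^ N n := by rw [← Real.exp_nat_mul]; congr 1; ring
      _ ≤ _ := by gcongr
  · filter_upwards [hlt] with n hn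
    have h4 : 1 - p n ≤ Real.exp (-p n) := by
      have := Real.add_one_le_exp (-p n)
      linarith
    calc _ ≤ Real.exp (-p n) ^ N n := by gcongr
      _ = _ := by rw [← Real.exp_nat_mul]; congr 1; ring

variable {X : Type*} [MeasurableSpace X] {μ : Measure X} [IsProbabilityMeasure μ]

lemma integral_prod_one_sub_mono {T : ℕ → X → X} (hT : ∀ i, Measurable (T i)) {s : ℝ}
    (hs0 : 0 ≤ s) (hs1 : s ≤ 1) {f g : X → ℝ} (hf : Measurable f) (hg : Measurable g)
    (hf0 : ∀ x, 0 ≤ f x) (hg1 : ∀ x, g x ≤ 1) (hfg : ∀ x, f x ≤ g x) (N : ℕ) :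
    ∫ x, ∏ i ∈ Finset.range N, (1 - s * g (T i x)) ∂μ ≤
      ∫ x, ∏ i ∈ Finset.range N, (1 - s * f (T i x)) ∂μ := by
  have hint : ∀ h : X → ℝ, Measurable h → (∀ x, 0 ≤ h x) → (∀ x, h x ≤ 1) →
      Integrable (fun x => ∏ i ∈ Finset.range N, (1 - s * h (T i x))) μ := by
    intro h hh h0 h1
    refine Integrable.of_bound (C := 1) (Measurable.aestronglyMeasurable
      (Finset.measurable_prod _ fun i _ => by
        exact measurable_const.sub ((hh.comp (hT i)).const_mul s))) ?_
    refine Eventually.of_forall fun x => ?_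
    have h3 : ∀ y, 0 ≤ 1 - s * h y ∧ 1 - s * h y ≤ 1 := fun y =>
      ⟨by nlinarith [h0 y, h1 y], by nlinarith [h0 y, h1 y]⟩
    rw [Real.norm_of_nonneg (Finset.prod_nonneg fun i _ => (h3 _).1)]
    exact Finset.prod_le_one (fun i _ => (h3 _).1) fun i _ => (h3 _).2
  refine integral_mono (hint g hg (fun x => (hf0 x).trans (hfg x)) hg1)
    (hint f hf hf0 fun x => (hfg x).trans (hg1 x)) fun x => ?_
  refine Finset.prod_le_prod (fun i _ => ?_) fun i _ => ?_
  · nlinarith [hf0 (T i x), hfg (T i x), hg1 (T i x)]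
  · have := hfg (T i x)
    gcongr

/-- Convergence of the probability generating function of the number of visits to shrinking sets
`S (b ε_n)`, provided that visits can be decorrelated for functions approximating the indicator
functions of these sets. -/
lemma tendsto_integral_prod_indicator {T : ℕ → ℕ → X → X} (hT : ∀ n i, Measurable (T n i))
    {S : ℝ → Set X} (hS : ∀ R, MeasurableSet (S R)) {ε : ℕ → ℝ} {N : ℕ → ℕ} {w s : ℝ} {d : ℕ}
    (hs0 : 0 < s) (hs1 : s ≤ 1)
    (hN : Tendsto N atTop atTop)
    (hvol : ∀ b : ℝ, 0 < b → Tendsto (fun n => N n * μ.real (S (b * ε n))) atTop (𝓝 (w * b ^ d)))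
    (hbump : ∀ b η : ℝ, 0 < b → 0 < η → η < 1 → ∃ f : ℕ → X → ℝ,
      (∀ᶠ n in atTop, Measurable (f n) ∧ (∀ x, 0 ≤ f n x ∧ f n x ≤ 1) ∧
        (∀ x ∈ S ((1 - η) * (b * ε n)), f n x = 1) ∧ ∀ x ∉ S (b * ε n), f n x = 0) ∧
      Tendsto (fun n => ∫ x, ∏ i ∈ Finset.range (N n), (1 - s * f n (T n i x)) ∂μ -
        (1 - s * ∫ x, f n x ∂μ) ^ N n) atTop (𝓝 0))
    {b : ℝ} (hb : 0 < b) :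
    Tendsto (fun n => ∫ x, ∏ i ∈ Finset.range (N n),
      (1 - s * (S (b * ε n)).indicator (fun _ => 1) (T n i x)) ∂μ) atTop
      (𝓝 (Real.exp (-(s * (w * b ^ d))))) := by
  have hind : ∀ R, Measurable ((S R).indicator fun _ => (1 : ℝ)) := fun R =>
    measurable_const.indicator (hS R)
  have hind0 : ∀ R x, 0 ≤ (S R).indicator (fun _ => (1 : ℝ)) x := fun R x =>
    indicator_nonneg (fun _ _ => zero_le_one) x
  have hind1 : ∀ R x, (S R).indicator (fun _ => (1 : ℝ)) x ≤ 1 := fun R x =>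
    indicator_le_self' (fun _ _ => zero_le_one) x
  have hpow : ∀ b : ℝ, 0 < b → Tendsto (fun n => (1 - s * μ.real (S (b * ε n))) ^ N n) atTop
      (𝓝 (Real.exp (-(s * (w * b ^ d))))) := by
    intro b hb
    refine tendsto_one_sub_pow ?_ ?_
    · refine ((hvol b hb).const_mul s).congr fun n => by ring
    · have h1 : Tendsto (fun n => (N n : ℝ)⁻¹) atTop (𝓝 0) :=
        tendsto_inv_atTop_zero.comp (tendsto_natCast_atTop_atTop.comp hN)
      have h2 := ((hvol b hb).mul h1).const_mul s
      rw [mul_zero, mul_zero] at h2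
      refine h2.congr' ?_
      filter_upwards [hN.eventually_gt_atTop 0] with n hn
      have : (N n : ℝ) ≠ 0 := by positivity
      field_simp
  have hint : ∀ R, ∫ x, (S R).indicator (fun _ => (1 : ℝ)) x ∂μ = μ.real (S R) := fun R => by
    rw [integral_indicator_const _ (hS R), smul_eq_mul, mul_one]
  have hintb : ∀ f : X → ℝ, Measurable f → (∀ x, 0 ≤ f x ∧ f x ≤ 1) → Integrable f μ :=
    fun f hf h => Integrable.of_bound (C := 1) hf.aestronglyMeasurable
      (Eventually.of_forall fun x => by rw [Real.norm_of_nonneg (h x).1]; exact (h x).2)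
  have hcont : Tendsto (fun c : ℝ => Real.exp (-(s * (w * (c * b) ^ d)))) (𝓝 1)
      (𝓝 (Real.exp (-(s * (w * b ^ d))))) := by
    have : Continuous fun c : ℝ => Real.exp (-(s * (w * (c * b) ^ d))) := by fun_prop
    simpa using this.tendsto 1
  refine tendsto_order.2 ⟨fun A hA => ?_, fun A hA => ?_⟩
  · obtain ⟨c, hc, hc1⟩ : ∃ c : ℝ, A < Real.exp (-(s * (w * (c * b) ^ d))) ∧ 1 < c :=
      ((hcont.mono_left nhdsWithin_le_nhds).eventually (lt_mem_nhds hA) |>.and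
        (self_mem_nhdsWithin (s := Ioi 1))).exists
    have hc0 : 0 < c := one_pos.trans hc1
    obtain ⟨f, hf, hlim⟩ := hbump (c * b) (1 - c⁻¹) (mul_pos hc0 hb)
      (by rw [sub_pos]; exact inv_lt_one_of_one_lt₀ hc1) (by simpa using hc0)
    have h1 := (hlim.add (hpow (c * b) (mul_pos hc0 hb))).eventually
      (lt_mem_nhds (by rwa [zero_add]))
    filter_upwards [h1, hf] with n hn hfn
    obtain ⟨hfm, hfb, hf1, hf0⟩ := hfn
    have hscale : (1 - (1 - c⁻¹)) * (c * b * ε n) = b * ε n := by field_simp; ring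
    rw [hscale] at hf1
    have h2 : ∀ x, (S (b * ε n)).indicator (fun _ => (1 : ℝ)) x ≤ f n x := fun x =>
      indicator_le' (fun x hx => (hf1 x hx).ge) (fun x _ => (hfb x).1) x
    have h3 := integral_prod_one_sub_mono (μ := μ) (hT n) hs0.le hs1 (hind (b * ε n)) hfm
      (hind0 _) (fun x => (hfb x).2) h2 (N n)
    refine lt_of_lt_of_le hn (le_trans ?_ h3)
    have h4 : ∫ x, f n x ∂μ ≤ μ.real (S (c * b * ε n)) := by
      rw [← hint]
      refine integral_mono (hintb _ hfm hfb) (hintb _ (hind _) fun x => ⟨hind0 _ x, hind1 _ x⟩)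
        fun x => ?_
      by_cases hx : x ∈ S (c * b * ε n)
      · rw [indicator_of_mem hx]; exact (hfb x).2
      · rw [indicator_of_notMem hx, hf0 x hx]
    have h5 : (1 - s * μ.real (S (c * b * ε n))) ^ N n ≤ (1 - s * ∫ x, f n x ∂μ) ^ N n := by
      gcongr
      have := measureReal_le_one (μ := μ) (s := S (c * b * ε n))
      have h6 : s * μ.real (S (c * b * ε n)) ≤ 1 * 1 :=
        mul_le_mul hs1 this measureReal_nonneg zero_le_one
      linarith
    linarith
  · obtain ⟨c, hc, hc0, hc1⟩ : ∃ c : ℝ, Real.exp (-(s * (w * (c * b) ^ d))) < A ∧ 0 < c ∧ c < 1 :=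
      ((hcont.mono_left nhdsWithin_le_nhds).eventually (gt_mem_nhds hA) |>.and
        ((Eventually.filter_mono nhdsWithin_le_nhds (lt_mem_nhds one_pos)).and (self_mem_nhdsWithin (s := Iio 1)))).exists
    obtain ⟨f, hf, hlim⟩ := hbump b (1 - c) hb (by linarith) (by linarith)
    have h1 := (hlim.add (hpow (c * b) (mul_pos hc0 hb))).eventually
      (gt_mem_nhds (by rwa [zero_add]))
    filter_upwards [h1, hf] with n hn hfn
    obtain ⟨hfm, hfb, hf1, hf0⟩ := hfn
    have hscale : (1 - (1 - c)) * (b * ε n) = c * b * ε n := by ring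
    rw [hscale] at hf1
    have h2 : ∀ x, f n x ≤ (S (b * ε n)).indicator (fun _ => (1 : ℝ)) x := fun x => by
      by_cases hx : x ∈ S (b * ε n)
      · rw [indicator_of_mem hx]; exact (hfb x).2
      · rw [indicator_of_notMem hx, hf0 x hx]
    have h3 := integral_prod_one_sub_mono (μ := μ) (hT n) hs0.le hs1 hfm (hind (b * ε n))
      (fun x => (hfb x).1) (hind1 _) h2 (N n)
    refine lt_of_le_of_lt (h3.trans ?_) hn
    have h4 : μ.real (S (c * b * ε n)) ≤ ∫ x, f n x ∂μ := by
      rw [← hint]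
      refine integral_mono (hintb _ (hind _) fun x => ⟨hind0 _ x, hind1 _ x⟩) (hintb _ hfm hfb)
        fun x => ?_
      exact indicator_le' (fun x hx => (hf1 x hx).ge) (fun x _ => (hfb x).1) x
    have h5 : (1 - s * ∫ x, f n x ∂μ) ^ N n ≤ (1 - s * μ.real (S (c * b * ε n))) ^ N n := by
      gcongr
      have h7 : ∫ x, f n x ∂μ ≤ ∫ _, (1 : ℝ) ∂μ :=
        integral_mono (hintb _ hfm hfb) (integrable_const _) fun x => (hfb x).2
      have h8 : 0 ≤ ∫ x, f n x ∂μ := integral_nonneg fun x => (hfb x).1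
      simp only [integral_const, probReal_univ, smul_eq_mul, mul_one] at h7
      have h6 : s * ∫ x, f n x ∂μ ≤ 1 * 1 := mul_le_mul hs1 h7 h8 zero_le_one
      linarith
    linarith

end Sandwich

/-! ### Balls are open, hence measurable. -/

section Balls

set_option linter.unusedSectionVars false

open Manifold

variable {d : ℕ} {G : Type*} [TopologicalSpace G] [ChartedSpace (EuclideanSpace ℝ (Fin d)) G]
  [Group G] [LieGroup (𝓡 d) ∞ G] [T3Space G] {B : LieRiemannianMetric d G} {Γ : Subgroup G}

lemma LieRiemannianMetric.distG_triangle (B : LieRiemannianMetric d G) (g h k : G) :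
    B.distG g k ≤ B.distG g h + B.distG h k := by
  unfold LieRiemannianMetric.distG
  let : RiemannianBundle (fun x : G => TangentSpace (𝓡 d) x) := ⟨B.toRiemannianMetric⟩
  have : IsManifold (𝓡 d) 1 G := isManifold_one_of_lieGroup
  exact riemannianEDist_triangle

lemma LieRiemannianMetric.ballG_mem_nhds (B : LieRiemannianMetric d G) {R : ℝ} (hR : 0 < R) :
    B.ballG R ∈ 𝓝 (1 : G) := by
  obtain ⟨Ψ, h1, h0, -, -, hB⟩ := B.exists_chart
  obtain ⟨R₀, hR₀, h⟩ := hB 2 one_lt_two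
  have hpos : 0 < min R R₀ := lt_min hR hR₀
  have hsub : ∀ᶠ u in 𝓝 (1 : G), u ∈ Ψ.source ∧ 2 * ‖Ψ u‖ < min R R₀ := by
    refine Eventually.and (Ψ.open_source.mem_nhds h1) ?_
    have hc : ContinuousAt (fun u => 2 * ‖Ψ u‖) 1 :=
      continuousAt_const.mul (Ψ.continuousAt h1).norm
    refine hc.eventually (gt_mem_nhds ?_)
    simpa [h0] using ⟨hR, hR₀⟩
  filter_upwards [hsub] with u hu
  have h2 := (h _ hpos (min_le_right _ _)).1 u hu.1 hu.2
  exact lt_of_lt_of_le h2 (ENNReal.ofReal_le_ofReal (min_le_left _ _))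

/-- Right invariance moves a small ball at `1` to `g`, where the triangle inequality uses up the
slack. -/
lemma LieRiemannianMetric.IsRightInvariant.isOpen_ballG (hB : B.IsRightInvariant) (R : ℝ) :
    IsOpen (B.ballG R) := by
  have := topologicalGroup_of_lieGroup (𝓡 d) ∞ (G := G)
  refine isOpen_iff_mem_nhds.2 fun g hg => ?_
  obtain ⟨δ, hδ, hlt⟩ := ENNReal.lt_iff_exists_add_pos_lt.1 (show B.distG g 1 < _ from hg)
  have h1 : B.ballG δ ∈ 𝓝 (g * g⁻¹) := by
    rw [mul_inv_cancel]
    exact B.ballG_mem_nhds (by exact_mod_cast hδ)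
  have h2 : Tendsto (fun g' : G => g' * g⁻¹) (𝓝 g) (𝓝 (g * g⁻¹)) :=
    (continuous_mul_const g⁻¹).tendsto g
  filter_upwards [h2.eventually h1] with g' hg'
  have h3 : B.distG g' g < δ := by
    have h4 := hB.distG_mul_right g' g g⁻¹
    rw [mul_inv_cancel] at h4
    rw [← h4]
    have h5 : B.distG (g' * g⁻¹) 1 < ENNReal.ofReal δ := hg'
    rwa [ENNReal.ofReal_coe_nnreal] at h5
  refine lt_of_le_of_lt (B.distG_triangle g' g 1) (lt_of_le_of_lt ?_ hlt)
  rw [add_comm]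
  gcongr

lemma LieRiemannianMetric.IsRightInvariant.isOpen_ball (hB : B.IsRightInvariant) (x₀ : G ⧸ Γ)
    (R : ℝ) : IsOpen ((fun u : G => u • x₀) '' B.ballG R) := by
  have := topologicalGroup_of_lieGroup (𝓡 d) ∞ (G := G)
  exact isOpenMap_smul_quotient x₀ _ (hB.isOpen_ballG R)

end Balls


/-! ### Counting visits to shrinking balls. -/

section VisitCounts

set_option linter.unusedSectionVars false

variable {d : ℕ} {G : Type*} [TopologicalSpace G] [ChartedSpace (EuclideanSpace ℝ (Fin d)) G]
  [Group G] [LieGroup (𝓡 d) ∞ G] [IsTopologicalGroup G] [T3Space G] [SecondCountableTopology G]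
  {Γ : Subgroup G} [DiscreteTopology Γ] [MeasurableSpace (G ⧸ Γ)] [BorelSpace (G ⧸ Γ)]
  {μ : Measure (G ⧸ Γ)} [IsProbabilityMeasure μ] [SMulInvariantMeasure G (G ⧸ Γ) μ]

/-- Decorrelation of the visits to balls of radius `b N ^ (-1 / d)`, tested on smooth functions. -/
lemma LieRiemannianMetric.exists_bump_decorrelated (B : LieRiemannianMetric d G)
    {a : ℝ → G} {ζ : Fin d → GroupLieAlgebra (𝓡 d) G} {γ : Fin d → ℝ} {γmax δ c c₁ ρ : ℝ} {k : ℕ}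
    (hAd : ∀ (t : ℝ) (i : Fin d), lieAd (a t) (ζ i) = Real.exp (γ i * t) • ζ i)
    (hγ : ∀ i, γ i ≤ γmax) (hγ0 : 0 ≤ γmax) (hk : k ≠ 0) (hc : 0 < c)
    (hmix : ∀ f g : G ⧸ Γ → ℝ, IsSobolev ζ μ k f → IsSobolev ζ μ k g → ∀ t : ℝ, 0 ≤ t →
      |(∫ x, f x * g (a t • x) ∂μ) - (∫ x, f x ∂μ) * (∫ x, g x ∂μ)|
        ≤ c * Real.exp (-δ * t) * sobolevNorm ζ μ k f * sobolevNorm ζ μ k g)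
    {m : ℕ → ℝ} (hm : ∀ j, 0 < m j) (hmono : Monotone m)
    (hgap : ∀ j, k * γmax * m j ≤ (δ - c₁) * m (j + 1)) (hc₁ : 0 < c₁) (hρ : 1 < ρ)
    (hmρ : ∀ j, m 0 * ρ ^ j ≤ m j) {α N : ℕ → ℕ} (hα : Tendsto α atTop atTop)
    {ε : ℕ → ℝ} (hε : ∀ n, 0 < ε n) (hε0 : Tendsto ε atTop (𝓝 0))
    (hεα : ∀ K : ℝ, ∀ᶠ n in atTop, K * (ε n)⁻¹ ^ (2 * k) ≤ Real.exp (c₁ * m 0 * ρ ^ α n))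
    {s : ℝ} (hs0 : 0 ≤ s) (hs1 : s ≤ 1) (x₀ : G ⧸ Γ) {b η : ℝ} (hb : 0 < b) (hη0 : 0 < η)
    (hη1 : η < 1) : ∃ f : ℕ → G ⧸ Γ → ℝ,
      (∀ᶠ n in atTop, Measurable (f n) ∧ (∀ x, 0 ≤ f n x ∧ f n x ≤ 1) ∧
        (∀ x ∈ (fun u : G => u • x₀) '' B.ballG ((1 - η) * (b * ε n)), f n x = 1) ∧
        ∀ x ∉ (fun u : G => u • x₀) '' B.ballG (b * ε n), f n x = 0) ∧
      Tendsto (fun n => ∫ x, ∏ i ∈ Finset.range (N n), (1 - s * f n (a (m (α n + i)) • x)) ∂μ -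
        (1 - s * ∫ x, f n x ∂μ) ^ N n) atTop (𝓝 0) := by
  obtain ⟨C, R₀, hC, hR₀, hbump⟩ := B.exists_bump ζ k x₀ hη0 hη1
  have hbε : Tendsto (fun n => b * ε n) atTop (𝓝 0) := by simpa using hε0.const_mul b
  -- Bumps exist only once `b ε n ≤ R₀`; earlier indices get the irrelevant value `0`.
  have hex : ∀ n, ∃ f : G ⧸ Γ → ℝ, b * ε n ≤ R₀ → HasDerivBound ζ k (C / (b * ε n)) f ∧
      (∀ x, 0 ≤ f x) ∧
      (∀ x ∈ (fun u : G => u • x₀) '' B.ballG ((1 - η) * (b * ε n)), f x = 1) ∧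
      ∀ x ∉ (fun u : G => u • x₀) '' B.ballG (b * ε n), f x = 0 := fun n => by
    by_cases h : b * ε n ≤ R₀
    · obtain ⟨f, hf⟩ := hbump _ (mul_pos hb (hε n)) h
      exact ⟨f, fun _ => hf⟩
    · exact ⟨0, fun h' => absurd h' h⟩
  choose f hf using hex
  have hsmall : ∀ᶠ n in atTop, b * ε n ≤ R₀ ∧ b * ε n ≤ C :=
    (hbε.eventually (ge_mem_nhds hR₀)).and (hbε.eventually (ge_mem_nhds hC))
  refine ⟨f, ?_, ?_⟩
  · filter_upwards [hsmall] with n hn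
    obtain ⟨h1, h2, h3, h4⟩ := hf n hn.1
    refine ⟨h1.smooth.continuous.measurable, fun x => ⟨h2 x, ?_⟩, h3, h4⟩
    have h5 := h1.bound [] (by simp) x
    simp only [iterLieDeriv, List.length_nil, pow_zero] at h5
    exact (abs_le.1 h5).2
  · set D : ℝ := c * ∑ q ∈ Finset.range (k + 1), (d : ℝ) ^ q with hD
    have hD0 : 0 ≤ D := mul_nonneg hc.le (Finset.sum_nonneg fun q _ => by positivity)
    have hA0 : ∀ n, 0 ≤ D * (C / (b * ε n)) ^ (2 * k) := fun n =>
      mul_nonneg hD0 (pow_nonneg (div_nonneg hC.le (mul_pos hb (hε n)).le) _)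
    have hlim := tendsto_sum_pow_mul_exp (mul_pos hc₁ (hm 0)) hρ k (N := N) hα hA0 (by
      filter_upwards [hεα (D * (C / b) ^ (2 * k))] with n hn
      refine le_trans (le_of_eq ?_) hn
      rw [div_mul_eq_div_div, div_eq_mul_inv (C / b), mul_pow, ← mul_assoc])
    refine squeeze_zero_norm' ?_ hlim
    filter_upwards [hsmall] with n hn
    obtain ⟨h1, h2, -, -⟩ := hf n hn.1
    have hpos := mul_pos hb (hε n)
    have hest := abs_integral_prod_sub_le μ hAd hγ hγ0 hk hc hmix (m := fun i => m (α n + i))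
      (fun j => hm _) (fun i j hij => hmono (by omega)) (fun j => hgap (α n + j)) hs0 hs1
      ((one_le_div hpos).2 hn.2) h2 h1 (N n)
    rw [Real.norm_eq_abs]
    refine hest.trans ?_
    rw [← Finset.mul_sum]
    refine mul_le_mul_of_nonneg_left ?_ (hA0 n)
    -- The index `0` has weight `0 ^ k = 0`. It must be removed, as the series estimate gains over
    -- `exp (c₁ m_0 ρ ^ α)` only from `i = 1` on.
    calc ∑ i ∈ Finset.range (N n), (i : ℝ) ^ k * Real.exp (-c₁ * m (α n + i))
        ≤ ∑ i ∈ insert 0 (Finset.Icc 1 (N n)), (i : ℝ) ^ k * Real.exp (-c₁ * m (α n + i)) := by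
          refine Finset.sum_le_sum_of_subset_of_nonneg (fun i hi => ?_) fun i _ _ => by positivity
          rw [Finset.mem_range] at hi
          rw [Finset.mem_insert, Finset.mem_Icc]
          omega
      _ = ∑ i ∈ Finset.Icc 1 (N n), (i : ℝ) ^ k * Real.exp (-c₁ * m (α n + i)) := by
          rw [Finset.sum_insert (by simp)]
          simp [hk]
      _ ≤ _ := by
          refine Finset.sum_le_sum fun i _ => ?_
          refine mul_le_mul_of_nonneg_left (Real.exp_le_exp.2 ?_) (by positivity)
          have := mul_le_mul_of_nonneg_left (hmρ (α n + i)) hc₁.le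
          linarith

/-- This writes the generating function of the count as a product of observables along the orbit,
with `s = 1 - q`. -/
lemma pow_card_filter_eq_prod {ι : Type*} (s : Finset ι) (q : ℝ) {X : Type*} (S : Set X)
    (y : ι → X) [DecidablePred fun j => y j ∈ S] :
    q ^ (s.filter fun j => y j ∈ S).card =
      ∏ j ∈ s, (1 - (1 - q) * S.indicator (fun _ => 1) (y j)) := by
  rw [← Finset.prod_const, Finset.prod_filter]
  refine Finset.prod_congr rfl fun j _ => ?_
  by_cases h : y j ∈ S <;> simp [h]

lemma prod_Icc_eq_prod_range {α β N : ℕ} (h : α < β) (hN : N = β - α + 1) (f : ℕ → ℝ) :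
    ∏ j ∈ Finset.Icc α β, f j = ∏ i ∈ Finset.range N, f (α + i) := by
  have h1 : Finset.Icc α β = Finset.Ico α (β + 1) := by
    ext j; simp only [Finset.mem_Icc, Finset.mem_Ico]; omega
  rw [h1, Finset.prod_Ico_eq_prod_range]
  congr 2
  omega

lemma measurable_card_filter {ι X : Type*} [MeasurableSpace X] (s : Finset ι) {S : Set X}
    (hS : MeasurableSet S) {T : ι → X → X} (hT : ∀ i, Measurable (T i))
    [∀ x, DecidablePred fun j => T j x ∈ S] :
    Measurable fun x => (s.filter fun j => T j x ∈ S).card := by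
  simp only [Finset.card_filter]
  refine Finset.measurable_sum _ fun i _ => ?_
  have : (fun x => if T i x ∈ S then 1 else 0) = (T i ⁻¹' S).indicator (fun _ => (1 : ℕ)) := by
    ext x
    by_cases h : T i x ∈ S <;> simp [h]
  rw [this]
  exact measurable_const.indicator (hT i hS)

end VisitCounts

/-! ### Parameters and the main theorem. -/

/-- The hypothesis gives `N ^ κ ≤ exp (σ κ ρ ^ α)`, and the spare power `κ - θ > 0` absorbs any
constant. -/
lemma eventually_mul_rpow_le_exp {N α : ℕ → ℕ} (hN : Tendsto N atTop atTop) {σ ρ κ θ L : ℝ}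
    (hNσ : (fun n => (N n : ℝ)) =o[atTop] fun n => Real.exp (σ * ρ ^ α n)) (hκ : 0 ≤ κ)
    (hθ : θ < κ) (hL : σ * κ = L) (K : ℝ) :
    ∀ᶠ n in atTop, K * (N n : ℝ) ^ θ ≤ Real.exp (L * ρ ^ α n) := by
  have h1 : Tendsto (fun n => (N n : ℝ) ^ (κ - θ)) atTop atTop :=
    (tendsto_rpow_atTop (sub_pos.2 hθ)).comp (tendsto_natCast_atTop_atTop.comp hN)
  filter_upwards [h1.eventually_ge_atTop K, hN.eventually_gt_atTop 0,
    hNσ.bound one_pos] with n hK hn0 hn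
  have hpos : (0 : ℝ) < N n := by exact_mod_cast hn0
  rw [one_mul, Real.norm_of_nonneg hpos.le, Real.norm_of_nonneg (Real.exp_pos _).le] at hn
  calc K * (N n : ℝ) ^ θ ≤ (N n : ℝ) ^ (κ - θ) * (N n : ℝ) ^ θ := by gcongr
    _ = (N n : ℝ) ^ κ := by rw [← Real.rpow_add hpos]; congr 1; ring
    _ ≤ Real.exp (σ * ρ ^ α n) ^ κ := by gcongr
    _ = Real.exp (L * ρ ^ α n) := by rw [← Real.exp_mul, ← hL]; congr 1; ring

theorem mainTheorem10
    {d : ℕ} (hd : 0 < d)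
    -- a `d`-dimensional Lie group
    {G : Type*} [TopologicalSpace G] [T2Space G] [SecondCountableTopology G]
    [ChartedSpace (EuclideanSpace ℝ (Fin d)) G] [Group G] [LieGroup (𝓡 d) ∞ G]
    -- a lattice and the normalized Haar measure on the quotient
    (Γ : Subgroup G) [DiscreteTopology Γ]
    [MeasurableSpace (G ⧸ Γ)] [BorelSpace (G ⧸ Γ)]
    (μ : Measure (G ⧸ Γ)) [IsProbabilityMeasure μ] [SMulInvariantMeasure G (G ⧸ Γ) μ]
    -- a right-invariant Riemannian metric
    (B : LieRiemannianMetric d G) (hB : B.IsRightInvariant)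
    -- a one-parameter subgroup with diagonalizable adjoint action, with eigenbasis `ζ`
    (a : ℝ → G) (ha : IsOneParameterSubgroup a)
    (ζ : Module.Basis (Fin d) ℝ (GroupLieAlgebra (𝓡 d) G)) (γ : Fin d → ℝ)
    (hAd : ∀ (t : ℝ) (i : Fin d), lieAd (a t) (ζ i) = Real.exp (γ i * t) • ζ i)
    (γmax : ℝ) (hγmax : IsGreatest (Set.range γ) γmax)
    -- exponential mixing
    (k : ℕ) (δ : ℝ) (hδ : 0 < δ)
    (hmix : HasExpDecayOfCorrelations a ζ μ k δ)
    -- the times `m j`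
    (m : ℕ → ℝ) (hm : ∀ j, 0 < m j)
    (ρ : ℝ) (hρ : IsLUB (Set.range fun s : ℕ => m s / m (s + 1)) ρ⁻¹)
    (hsup : ρ⁻¹ < min 1 (δ / (k * γmax)))
    -- the windows `α n, …, β n`
    (α β : ℕ → ℕ) (hαβ : ∀ n, α n < β n) (hα : Tendsto α atTop atTop)
    (hβα : Tendsto (fun n => β n - α n) atTop atTop)
    (N : ℕ → ℕ) (hN : ∀ n, N n = β n - α n + 1)
    (l : ℕ) (hl : 1 ≤ l)
    (σ : ℝ)
    (hσ : σ = -m 0 / (k * (3 / 2 + 2 / (d : ℝ)) + 1 / 2 * ((l : ℝ) - 1)) * (k * γmax / ρ - δ))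
    (hNσ : (fun n => (N n : ℝ)) =o[atTop] fun n => Real.exp (σ * ρ ^ α n)) :
    ∃ w : ℝ, 0 < w ∧ ∀ x₀ : G ⧸ Γ,
      ((fun z : ℝ => μ.real {x | (z : EReal) < B.closeness Γ x₀ x} - w * Real.exp (-d * z))
        =o[atTop] fun z : ℝ => Real.exp (-d * z)) ∧
      ∀ r : ℝ, Tendsto
        (fun n => μ.real {x |
          lthLargest (Finset.Icc (α n) (β n)) (fun j => B.closeness Γ x₀ (a (m j) • x)) l
            ≤ ((r + 1 / d * Real.log (N n) : ℝ) : EReal)})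
        atTop
        (𝓝 (Real.exp (-w * Real.exp (-d * r)) *
          ∑ i ∈ Finset.range l, (w * Real.exp (-d * r)) ^ i / (i.factorial : ℝ))) := by
  classical
  have := topologicalGroup_of_lieGroup (𝓡 d) ∞ (G := G)
  have hd0 : (0 : ℝ) < d := by exact_mod_cast hd
  -- the parameters
  have hratio : ∀ s, m s / m (s + 1) ≤ ρ⁻¹ := fun s => hρ.1 ⟨s, rfl⟩
  have hρpos : 0 < ρ⁻¹ := (div_pos (hm 0) (hm 1)).trans_le (hratio 0)
  have hρ0 : 0 < ρ := inv_pos.1 hρpos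
  have hρ1 : 1 < ρ := (inv_lt_one₀ hρ0).1 (hsup.trans_le (min_le_left _ _))
  have hρδ : ρ⁻¹ < δ / (k * γmax) := hsup.trans_le (min_le_right _ _)
  -- Otherwise `δ / (k γmax)` would be at most `0` (division by zero gives `0`), below the positive
  -- `ρ⁻¹`.
  have hkγ : 0 < k * γmax := by
    by_contra! h
    exact absurd (hρpos.trans hρδ) (not_lt.2 (div_nonpos_of_nonneg_of_nonpos hδ.le h))
  have hk : k ≠ 0 := by rintro rfl; simp at hkγ
  have hk1 : (1 : ℝ) ≤ k := by exact_mod_cast Nat.one_le_iff_ne_zero.2 hk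
  have hγ0 : 0 < γmax := pos_of_mul_pos_right hkγ (by positivity)
  have hγ : ∀ i, γ i ≤ γmax := fun i => hγmax.2 ⟨i, rfl⟩
  -- The mixing rate left after paying for the Sobolev norm of the past.
  set c₁ := δ - k * γmax / ρ with hc₁
  have hc₁0 : 0 < c₁ := by
    rw [lt_div_iff₀ hkγ, inv_mul_lt_iff₀ hρ0] at hρδ
    rw [hc₁, sub_pos, div_lt_iff₀ hρ0]
    linarith
  have hstep : ∀ j, ρ * m j ≤ m (j + 1) := fun j => by
    have := hratio j
    rw [div_le_iff₀ (hm _), inv_mul_eq_div, le_div_iff₀ hρ0] at this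
    linarith
  have hmono : Monotone m := monotone_nat_of_le_succ fun j =>
    (le_mul_of_one_le_left (hm j).le hρ1.le).trans (hstep j)
  have hmρ : ∀ j, m 0 * ρ ^ j ≤ m j := by
    intro j
    induction j with
    | zero => simp
    | succ j ih =>
      calc m 0 * ρ ^ (j + 1) = ρ * (m 0 * ρ ^ j) := by ring
        _ ≤ ρ * m j := by gcongr
        _ ≤ m (j + 1) := hstep j
  have hgap : ∀ j, k * γmax * m j ≤ (δ - c₁) * m (j + 1) := fun j => by
    calc k * γmax * m j = k * γmax / ρ * (ρ * m j) := by field_simp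
      _ ≤ k * γmax / ρ * m (j + 1) := by gcongr; exact hstep j
      _ = _ := by rw [hc₁]; ring
  have hNtop : Tendsto N atTop atTop :=
    tendsto_atTop_mono (fun n => by rw [hN]; exact Nat.le_succ _) hβα
  have hNpos : ∀ n, (0 : ℝ) < N n := fun n => by rw [hN]; positivity
  obtain ⟨c, hc, hmix⟩ := hmix
  obtain ⟨w, hw, hvol⟩ := B.exists_tendsto_measureReal_ball μ
  -- the radii
  set ε : ℕ → ℝ := fun n => (N n : ℝ) ^ (-(1 / d) : ℝ) with hε
  have hεpos : ∀ n, 0 < ε n := fun n => Real.rpow_pos_of_pos (hNpos n) _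
  have hε0 : Tendsto ε atTop (𝓝 0) :=
    (tendsto_rpow_neg_atTop (by positivity)).comp (tendsto_natCast_atTop_atTop.comp hNtop)
  have hεd : ∀ n, ε n ^ d = (N n : ℝ)⁻¹ := fun n => by
    rw [hε, ← Real.rpow_natCast, ← Real.rpow_mul (hNpos n).le, ← Real.rpow_neg_one]
    congr 1
    field_simp
  -- The bumps cost `(ε n)⁻¹ ^ (2k) = N ^ (2k/d)`, so `2k/d < κ` is all that is asked of `κ`; the
  -- choice of `σ` amounts to `σ κ = c₁ m_0`.
  set κ : ℝ := k * (3 / 2 + 2 / (d : ℝ)) + 1 / 2 * ((l : ℝ) - 1) with hκ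
  have hl1 : (1 : ℝ) ≤ l := by exact_mod_cast hl
  have hκθ : 2 * k / (d : ℝ) < κ := by
    have h1 : κ - 2 * k / (d : ℝ) = 3 / 2 * k + 1 / 2 * ((l : ℝ) - 1) := by rw [hκ]; ring
    have : 0 < κ - 2 * k / (d : ℝ) := by rw [h1]; linarith
    linarith
  have hκ0 : 0 < κ := lt_of_le_of_lt (by positivity) hκθ
  have hσκ : σ * κ = c₁ * m 0 := by
    rw [hσ, hc₁]
    field_simp
    ring
  have hεα : ∀ K : ℝ, ∀ᶠ n in atTop,
      K * (ε n)⁻¹ ^ (2 * k) ≤ Real.exp (c₁ * m 0 * ρ ^ α n) := by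
    intro K
    filter_upwards [eventually_mul_rpow_le_exp hNtop hNσ hκ0.le hκθ hσκ K] with n hn
    refine le_trans (le_of_eq ?_) hn
    congr 1
    rw [hε, ← Real.rpow_neg (hNpos n).le, ← Real.rpow_natCast, ← Real.rpow_mul (hNpos n).le]
    congr 1
    push_cast
    ring
  refine ⟨w, hw, fun x₀ => ⟨?_, fun r => ?_⟩⟩
  · have hset : ∀ z : ℝ, {x | (z : EReal) < B.closeness Γ x₀ x} =
        (fun u : G => u • x₀) '' B.ballG (Real.exp (-z)) := fun z => by
      ext x
      rw [mem_ofPred_eq, LieRiemannianMetric.lt_closeness_iff, hB.dist_lt_iff]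
      exact ⟨fun ⟨u, hu, h⟩ => ⟨u, hu, h.symm⟩, fun ⟨u, hu, h⟩ => ⟨u, hu, h.symm⟩⟩
    have hexp : Tendsto (fun z : ℝ => Real.exp (-z)) atTop (𝓝[>] 0) :=
      tendsto_nhdsWithin_iff.2 ⟨Real.tendsto_exp_neg_atTop_nhds_zero,
        Eventually.of_forall fun z => Real.exp_pos _⟩
    have h1 := ((hvol x₀).comp hexp).sub_const w
    rw [sub_self] at h1
    rw [Asymptotics.isLittleO_iff_tendsto' (Eventually.of_forall fun z h =>
      absurd h (Real.exp_pos _).ne')]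
    refine h1.congr fun z => ?_
    have h2 : Real.exp (-z) ^ d = Real.exp (-d * z) := by
      rw [← Real.exp_nat_mul]; congr 1; ring
    simp only [Function.comp]
    rw [hset, h2, sub_div, mul_div_cancel_right₀ _ (Real.exp_pos _).ne']
  · set b := Real.exp (-r) with hb
    have hb0 : 0 < b := Real.exp_pos _
    have hbd : w * b ^ d = w * Real.exp (-d * r) := by
      rw [hb, ← Real.exp_nat_mul]; congr 2; ring
    set S : ℝ → Set (G ⧸ Γ) := fun R => (fun u : G => u • x₀) '' B.ballG R with hS
    have hSm : ∀ R, MeasurableSet (S R) := fun R => (hB.isOpen_ball x₀ R).measurableSet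
    have hT : ∀ t : ℝ, Measurable fun x : G ⧸ Γ => a t • x := fun t =>
      (continuous_const_smul (a t)).measurable
    set Z : ℕ → G ⧸ Γ → ℕ := fun n x =>
      ((Finset.Icc (α n) (β n)).filter fun j => a (m j) • x ∈ S (b * ε n)).card with hZ
    have hZm : ∀ n, Measurable (Z n) := fun n =>
      measurable_card_filter (T := fun (j : ℕ) (x : G ⧸ Γ) => a (m j) • x) _ (hSm _)
        fun j => hT _
    have hrad : ∀ n, Real.exp (-(r + 1 / d * Real.log (N n))) = b * ε n := fun n => by
      have h1 : ε n = Real.exp (Real.log (N n) * -(1 / d)) := Real.rpow_def_of_pos (hNpos n) _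
      rw [neg_add, Real.exp_add, h1]
      congr 2
      ring
    have hset : ∀ n, {x | lthLargest (Finset.Icc (α n) (β n))
        (fun j => B.closeness Γ x₀ (a (m j) • x)) l ≤ ((r + 1 / d * Real.log (N n) : ℝ) : EReal)} =
        {x | Z n x < l} := fun n => by
      ext x
      rw [mem_ofPred_eq, lthLargest_le_iff _ _ hl, mem_ofPred_eq]
      have : ∀ j, (((r + 1 / d * Real.log (N n) : ℝ) : EReal) < B.closeness Γ x₀ (a (m j) • x)) ↔
          a (m j) • x ∈ S (b * ε n) := fun j => by
        rw [LieRiemannianMetric.lt_closeness_iff, hrad, hB.dist_lt_iff]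
        exact ⟨fun ⟨u, hu, h⟩ => ⟨u, hu, h.symm⟩, fun ⟨u, hu, h⟩ => ⟨u, hu, h.symm⟩⟩
      simp only [this, hZ]
    simp only [hset]
    rw [neg_mul, ← hbd]
    refine tendsto_prob_lt_of_tendsto_pgf μ hZm (by positivity) (fun q hq0 hq1 => ?_) l
    have hpgf := tendsto_integral_prod_indicator (μ := μ) (N := N) (ε := ε) (S := S) (w := w)
      (d := d) (T := fun n i x => a (m (α n + i)) • x) (fun n i => hT _) hSm
      (s := 1 - q) (by linarith) (by linarith) hNtop (fun b' hb' => ?_)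
      (fun b' η hb' hη0 hη1 => B.exists_bump_decorrelated hAd hγ hγ0.le hk hc hmix hm hmono hgap
        hc₁0 hρ1 hmρ hα hεpos hε0 hεα (by linarith) (by linarith) x₀ hb' hη0 hη1) hb0
    · rw [neg_mul]
      refine hpgf.congr fun n => ?_
      refine integral_congr_ae (Eventually.of_forall fun x => ?_)
      simp only [hZ]
      rw [pow_card_filter_eq_prod, prod_Icc_eq_prod_range (hαβ n) (hN n)]
    · have hlim : Tendsto (fun n => b' * ε n) atTop (𝓝[>] 0) :=
        tendsto_nhdsWithin_iff.2 ⟨by simpa using hε0.const_mul b',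
          Eventually.of_forall fun n => mul_pos hb' (hεpos n)⟩
      refine (((hvol x₀).comp hlim).mul_const (b' ^ d)).congr fun n => ?_
      simp only [Function.comp]
      rw [mul_pow, hεd]
      have := (hNpos n).ne'
      field_simp
      rfl
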